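/- **Setting.** Let $f(x_1,x_2,x_3)$ be the normal form of a simple singularity of type $A_N$ ($N\ge1$), $D_N$ ($N\ge4$), $E_6,E_7,E_8$, let $h$ be its Coxeter number, $H=\mathbb C[x]/(\partial f)$, $N=\dim H$, with the residue pairing $(\varphi,\psi)=\operatorname{Res}\,\varphi\psi\,dx_1dx_2dx_3/(f_{x_1}f_{x_2}f_{x_3})$. Let $\{\psi_a\}$ be weighted-homogeneous polynomials containing $1$ that form a basis of $H$ (with $\deg f=1$), $m_a=1+h\deg\psi_a$, and let $\mu$ be the operator on $H$ with $\mu\psi_a=(\tfrac12-\tfrac{m_a}{h})\psi_a$; $\mu^*$ is its transpose with respect to the residue pairing. Let $f_\tau=f+\sum\tau^a\psi_a$, $E=\sum(1-\frac{m_a-1}{h})\tau^a\partial_{\tau^a}$, and identify $T_\tau\cong\mathbb C[x]/(\partial f_\tau)$, $\partial_{\tau^a}\mapsto\psi_a$, with $H=T_0$ by weighted-homogeneous flat coordinates of the residue metric; $E\bullet$ denotes multiplication by $E$. Let $\tau$ be semisimple: $f_\tau$ has only non-degenerate critical points $x^{(i)}$, $i=1,\dots,N$; let $u^i=f_\tau(x^{(i)})$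 be the critical values, $\Delta_i$ the Hessians, $U=\operatorname{diag}(u^i)$, and $\Psi:\mathbb C^N\to T_\tau=H$, $\Psi(q)=\sum q^i\sqrt{\Delta_i}\,\partial_{u^i}$. Let $S(z)=1+S_1z^{-1}+\cdots$ with $S^*(-z)S(z)=1$ conjugate $\partial_z-\mu/z+E\bullet/z^2$ to $\partial_z-\mu/z$, and let $R(z)=1+R_1z+\cdots$ with $R^t(-z)R(z)=1$ be such that $\Psi R(z)e^{U/z}$ is a formal solution of $(z\partial_z-\mu+z^{-1}E\bullet)J=0$. For a finite-dimensional space $V$ with a symmetric non-degenerate bilinear form, an infinitesimal symplectic transformation $A$ of the space of $V$-valued Laurent series in $z$ with the form $\Omega(\mathbf f,\mathbf g)=\frac1{2\pi i}\oint(\mathbf f(-z),\mathbf g(z))dz$ has the quadratic hamiltonian $\Omega(A\mathbf f,\mathbf f)/2$; in Darboux coordinates given by $\mathbf f=\sum_{k\ge0} q_kz^k+\sum_{k\ge0} p_k(-z)^{-1-k}$ its quantization $\hat A$ is obtained by $q_\alpha q_\beta\mapsto q_\alpha q_\beta/\hbar$, $q_\alpha p_\beta\mapsto q_\alpha\partial_{q_\beta}$,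 $p_\alpha p_\beta\mapsto\hbar\,\partial_{q_\alpha}\partial_{q_\beta}$. The cocycle $\mathcal C$ is the antisymmetric bilinear function of quadratic hamiltonians with $\mathcal C(p_\alpha p_\beta,q_\alpha q_\beta)=1$ for $\alpha\ne\beta$, $=2$ for $\alpha=\beta$, and zero on all other pairs of quadratic Darboux monomials. Put $l_0=z\partial_z+\frac12-\mu$, $M=S^{-1}\Psi Re^{U/z}$, and $\hat M=e^{c}\,\hat S^{-1}\hat\Psi\hat R\,e^{(U/z)^{\wedge}}$ with any constant $c$, where $\hat S=\exp(\ln S)^\wedge$, $\hat R=\exp(\ln R)^\wedge$, $(\hat\Psi F)(\mathbf q)=F(\Psi^{-1}\mathbf q)$, and conjugation by $M$ is the successive conjugation by its four factors. The operators act on formal power series in $\mathbf q=(q_0,q_1,\dots)$ over $\mathbb C((\hbar))$: $\hat M$ has the domain $\mathcal F=e^{-(U/z)^\wedge}\{\text{polynomials on }\mathbb C^N[z]\}$ and the range $\mathcal F'=\hat S^{-1}\{\text{polynomials on }H[z]\}$. **Proposition.** $\hat M:\mathcal F\to\mathcal F'$ is a bijection, with inverse $\hat M^{-1}=e^{-c}e^{-(U/z)^\wedge}\hat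 R^{-1}\hat\Psi^{-1}\hat S$; $\hat l_0$ preserves $\mathcal F'$; and on $\mathcal F$ $$\hat M^{-1}\,\hat l_0\,\hat M=(M^{-1}l_0M)^{\wedge}+\tfrac14\operatorname{tr}(\mu\mu^*).$$ The central term comes from the cocycle: on polynomials $$\hat R^{-1}(U/z)^\wedge\hat R=(R^{-1}(U/z)R)^\wedge+\mathcal C(U/z,\ln R),$$ $$\mathcal C(U/z,\ln R)=\tfrac12\sum_iR_1^{ii}u^i=\tfrac14\operatorname{tr}(\mu\mu^*).$$ -/

import Mathlib

open scoped TensorProduct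

noncomputable section

namespace ADEVirasoro

/-! ### Simple singularities -/

/-- The polynomial ring in three variables. -/
abbrev Poly3 : Type := MvPolynomial (Fin 3) ℂ

/-- The list of simple singularities. -/
inductive SimpleSing : Type
  | A (N : ℕ) (hN : 1 ≤ N)
  | D (N : ℕ) (hN : 4 ≤ N)
  | E6
  | E7
  | E8

namespace SimpleSing

/-- The multiplicity `N = dim H`. -/
def rank : SimpleSing → ℕ
  | A N _ => N
  | D N _ => N
  | E6 => 6
  | E7 => 7
  | E8 => 8

/-- The Coxeter number `h`. -/
def coxeter : SimpleSing → ℕ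
  | A N _ => N + 1
  | D N _ => 2 * N - 2
  | E6 => 12
  | E7 => 18
  | E8 => 30

/-- The normal form `f`. -/
def poly : SimpleSing → Poly3
  | A N _ => MvPolynomial.C (1 / ((N : ℂ) + 1)) * MvPolynomial.X 0 ^ (N + 1)
      + MvPolynomial.C (1 / 2) * MvPolynomial.X 1 ^ 2
      + MvPolynomial.C (1 / 2) * MvPolynomial.X 2 ^ 2
  | D N _ => MvPolynomial.X 0 ^ 2 * MvPolynomial.X 1 - MvPolynomial.X 1 ^ (N - 1)
      + MvPolynomial.X 2 ^ 2
  | E6 => MvPolynomial.X 0 ^ 3 + MvPolynomial.X 1 ^ 4 + MvPolynomial.X 2 ^ 2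
  | E7 => MvPolynomial.X 0 ^ 3 + MvPolynomial.X 0 * MvPolynomial.X 1 ^ 3
      + MvPolynomial.X 2 ^ 2
  | E8 => MvPolynomial.X 0 ^ 3 + MvPolynomial.X 1 ^ 5 + MvPolynomial.X 2 ^ 2

/-- The weights of `x₁, x₂, x₃`, normalized so that `f` has degree `1`. -/
def weight : SimpleSing → Fin 3 → ℚ
  | A N _ => ![1 / ((N : ℚ) + 1), 1 / 2, 1 / 2]
  | D N _ => ![((N : ℚ) - 2) / (2 * ((N : ℚ) - 1)), 1 / ((N : ℚ) - 1), 1 / 2]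
  | E6 => ![1 / 3, 1 / 4, 1 / 2]
  | E7 => ![1 / 3, 2 / 9, 1 / 2]
  | E8 => ![1 / 3, 1 / 5, 1 / 2]

end SimpleSing

/-- The gradient of a polynomial. -/
def grad (f : Poly3) : Fin 3 → Poly3 := fun j => MvPolynomial.pderiv j f

/-- The gradient (Jacobian) ideal of a polynomial. -/
def jacIdeal (f : Poly3) : Ideal Poly3 := Ideal.span (Set.range (grad f))

/-- The Hessian determinant of `f` at the point `p`. -/
def hessDet (f : Poly3) (p : Fin 3 → ℂ) : ℂ :=
  (Matrix.of fun i j : Fin 3 =>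
    MvPolynomial.eval p (MvPolynomial.pderiv i (MvPolynomial.pderiv j f))).det

/-! ### The residue

The total Grothendieck residue `φ ↦ Res [φ dx₁∧dx₂∧dx₃ / (g₁, g₂, g₃)]` (the sum of the local
residues at all common zeros) of a complete intersection with finitely many zeros, in its algebraic
form: it is the unique linear functional `ρ` on `ℂ[x]/(g)` such that `ρ`, applied in the variable
`x` to the Bezoutian `det (B i j (x, y))`, where `g i (x) - g i (y) = ∑ j, B i j (x, y) (x j - y j)`,
gives `1` in `ℂ[y]/(g)`.  At simple zeros it is `∑ φ / det (∂g i / ∂x j)`. -/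

/-- The characteristic property of the residue functional. -/
def IsResidue (g : Fin 3 → Poly3) (ρ : Poly3 →ₗ[ℂ] ℂ) : Prop :=
  (∀ φ ∈ Ideal.span (Set.range g), ρ φ = 0) ∧
  ∀ B : Matrix (Fin 3) (Fin 3) (Poly3 ⊗[ℂ] Poly3),
    (∀ i, g i ⊗ₜ[ℂ] (1 : Poly3) - (1 : Poly3) ⊗ₜ[ℂ] g i =
      ∑ j, B i j * ((MvPolynomial.X j : Poly3) ⊗ₜ[ℂ] (1 : Poly3)
        - (1 : Poly3) ⊗ₜ[ℂ] (MvPolynomial.X j : Poly3))) →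
    TensorProduct.lid ℂ Poly3 (ρ.rTensor Poly3 B.det) - 1 ∈ Ideal.span (Set.range g)

/-- The residue functional. -/
def residue (g : Fin 3 → Poly3) : Poly3 →ₗ[ℂ] ℂ := Classical.epsilon (IsResidue g)

/-! ### Miniversal deformation, residue metric, flat coordinates -/

section Deformation

variable (X : SimpleSing) (ψ : Fin X.rank → Poly3) (d : Fin X.rank → ℚ)

/-- `ψ` is a family of weighted-homogeneous polynomials, `ψ a` of degree `d a`, containing `1`,
whose classes form a basis of the local algebra `H = ℂ[x]/(∂f)`. -/
def IsHomogeneousBasis : Prop :=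
  (∀ a, MvPolynomial.IsWeightedHomogeneous X.weight (ψ a) (d a)) ∧
  (∃ a, ψ a = 1) ∧
  LinearIndependent ℂ (fun a => Ideal.Quotient.mk (jacIdeal X.poly) (ψ a)) ∧
  Submodule.span ℂ (Set.range fun a => Ideal.Quotient.mk (jacIdeal X.poly) (ψ a)) = ⊤

/-- The exponents `m_a = 1 + h deg ψ_a`. -/
def exponent (a : Fin X.rank) : ℚ := 1 + (X.coxeter : ℚ) * d a

/-- The operator `μ` on `H`, in the basis `ψ`: diagonal with eigenvalues `1/2 - m_a/h`. -/
def mu : Matrix (Fin X.rank) (Fin X.rank) ℂ :=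
  Matrix.diagonal fun a => ((1 / 2 - exponent X d a / (X.coxeter : ℚ) : ℚ) : ℂ)

/-- The miniversal deformation `f_τ = f + ∑ τ^a ψ_a`. -/
def deform (τ : Fin X.rank → ℂ) : Poly3 := X.poly + ∑ a, MvPolynomial.C (τ a) * ψ a

/-- The Gram matrix of the residue metric on `T_τ` in the basis `∂/∂τ^a ↔ ψ_a`; at `τ = 0` it is
the Gram matrix of the residue pairing on `H` in the basis `ψ`. -/
def residueMetric (τ : Fin X.rank → ℂ) : Matrix (Fin X.rank) (Fin X.rank) ℂ :=
  Matrix.of fun a b => residue (grad (deform X ψ τ)) (ψ a * ψ b)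

/-- The Euler vector field `E = ∑ (deg τ^a) τ^a ∂/∂τ^a`, `deg τ^a = 1 - (m_a - 1)/h`. -/
def euler (τ : Fin X.rank → ℂ) : Fin X.rank → ℂ :=
  fun a => ((1 - (exponent X d a - 1) / (X.coxeter : ℚ) : ℚ) : ℂ) * τ a

/-- The Jacobian matrix `∂t^c/∂τ^a`. -/
def jacobian (t : (Fin X.rank → ℂ) → (Fin X.rank → ℂ)) (τ : Fin X.rank → ℂ) :
    Matrix (Fin X.rank) (Fin X.rank) ℂ :=
  Matrix.of fun c a => fderiv ℂ t τ (Pi.single a 1) c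

/-- `t` is a weighted-homogeneous flat coordinate system of the residue metric, normalized by
`∂/∂t^a = ∂/∂τ^a` at `τ = 0`, i.e. `∂/∂t^a` corresponds to `[ψ_a] ∈ H = T_0`.  Parallel transport
of the flat metric identifies `T_τ` with `H` through the differential of `t` at `τ`. -/
def IsFlatCoords (t : (Fin X.rank → ℂ) → (Fin X.rank → ℂ)) : Prop :=
  Differentiable ℂ t ∧
  jacobian X t 0 = 1 ∧
  (∀ τ a, fderiv ℂ t τ (euler X d τ) a =
    ((1 - (exponent X d a - 1) / (X.coxeter : ℚ) : ℚ) : ℂ) * t τ a) ∧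
  ∀ τ, residueMetric X ψ τ =
    (jacobian X t τ).transpose * residueMetric X ψ 0 * jacobian X t τ

/-- The canonical map `T_τ → ℂ[x]/(∂f_τ)`, `∂/∂τ^a ↦ ψ_a`. -/
def tangentMap (τ : Fin X.rank → ℂ) (v : Fin X.rank → ℂ) :
    Poly3 ⧸ jacIdeal (deform X ψ τ) :=
  Ideal.Quotient.mk _ (∑ a, MvPolynomial.C (v a) * ψ a)

/-- The matrix, in the basis `∂/∂τ^a` of `T_τ`, of the multiplication operator `E •`. -/
def eulerMul (τ : Fin X.rank → ℂ) : Matrix (Fin X.rank) (Fin X.rank) ℂ :=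
  Matrix.of fun c b =>
    Function.invFun (tangentMap X ψ τ)
      (tangentMap X ψ τ (euler X d τ) * tangentMap X ψ τ (Pi.single b 1)) c

/-- The operator `E •` on `T_τ`, transported to `H` by the flat coordinates `t`. -/
def eulerMulH (t : (Fin X.rank → ℂ) → (Fin X.rank → ℂ)) (τ : Fin X.rank → ℂ) :
    Matrix (Fin X.rank) (Fin X.rank) ℂ :=
  jacobian X t τ * eulerMul X ψ d τ * (jacobian X t τ)⁻¹

/-- `τ` is semisimple: `f_τ` is a Morse function, and `x` enumerates its critical points. -/
def IsCritEnum (τ : Fin X.rank → ℂ) (x : Fin X.rank → (Fin 3 → ℂ)) : Prop :=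
  Function.Injective x ∧
  (∀ p : Fin 3 → ℂ,
    (∀ j, MvPolynomial.eval p (grad (deform X ψ τ) j) = 0) ↔ ∃ i, x i = p) ∧
  ∀ i, hessDet (deform X ψ τ) (x i) ≠ 0

/-- The diagonal matrix `U` of the critical values `u^i` (canonical coordinates). -/
def critU (τ : Fin X.rank → ℂ) (x : Fin X.rank → (Fin 3 → ℂ)) :
    Matrix (Fin X.rank) (Fin X.rank) ℂ :=
  Matrix.diagonal fun i => MvPolynomial.eval (x i) (deform X ψ τ)

/-- The matrix `∂u^i/∂τ^a = ψ_a(x^(i))`. -/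
def critDiff (x : Fin X.rank → (Fin 3 → ℂ)) : Matrix (Fin X.rank) (Fin X.rank) ℂ :=
  Matrix.of fun i a => MvPolynomial.eval (x i) (ψ a)

/-- The matrix of `Ψ : ℂ^N → T_τ = H`, `Ψ(q) = ∑ q^i √Δ_i ∂/∂u^i`; `r i` is a choice of `√Δ_i`.
The `i`-th column of `(critDiff X ψ x)⁻¹` is the vector `∂/∂u^i` in the basis `∂/∂τ^a`. -/
def psiMat (t : (Fin X.rank → ℂ) → (Fin X.rank → ℂ)) (τ : Fin X.rank → ℂ)
    (x : Fin X.rank → (Fin 3 → ℂ)) (r : Fin X.rank → ℂ) :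
    Matrix (Fin X.rank) (Fin X.rank) ℂ :=
  jacobian X t τ * (critDiff X ψ x)⁻¹ * Matrix.diagonal r

end Deformation

/-! ### Matrix series -/

section Series

variable {N : ℕ}

/-- `N × N` matrices. -/
abbrev Mat (N : ℕ) : Type := Matrix (Fin N) (Fin N) ℂ

/-- The transpose of `A` with respect to the symmetric bilinear form with Gram matrix `G`. -/
def adj (G A : Mat N) : Mat N := G⁻¹ * A.transpose * G

/-- The logarithm of a matrix series with constant term `1`. -/
def logSeries (F : PowerSeries (Mat N)) : PowerSeries (Mat N) :=
  PowerSeries.mk fun k =>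
    ∑ n ∈ Finset.Icc 1 k, ((-1 : ℂ) ^ (n + 1) / (n : ℂ)) • PowerSeries.coeff k ((F - 1) ^ n)

/-- The series `exp (s A)` in the variable `s`. -/
def expSeries (A : Mat N) : PowerSeries (Mat N) :=
  PowerSeries.mk fun k => ((k.factorial : ℂ)⁻¹) • A ^ k

/-- The series `s A` in the variable `s`. -/
def linSeries (A : Mat N) : PowerSeries (Mat N) :=
  PowerSeries.mk fun k => if k = 1 then A else 0

/-- `F(-s)^* F(s) = 1`, the transpose being taken with respect to the form with Gram matrix `G`. -/
def IsSymplecticSeries (G : Mat N) (F : PowerSeries (Mat N)) : Prop :=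
  PowerSeries.mk (fun k => (-1 : ℂ) ^ k • adj G (PowerSeries.coeff k F)) * F = 1

/-- `S(z) = 1 + S₁ z⁻¹ + S₂ z⁻² + ⋯` (a power series in `z⁻¹`) is a symplectic gauge transformation
conjugating `∂_z - μ/z + 𝓔/z²` to `∂_z - μ/z`, i.e.
`(∂_z - μ/z + 𝓔/z²) ∘ S = S ∘ (∂_z - μ/z)`; the equation is written coefficientwise. -/
def IsCalibration (G μ 𝓔 : Mat N) (S : PowerSeries (Mat N)) : Prop :=
  PowerSeries.coeff 0 S = 1 ∧
  (∀ k : ℕ, -((k : ℂ) + 1) • PowerSeries.coeff (k + 1) S - μ * PowerSeries.coeff (k + 1) S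
    + PowerSeries.coeff (k + 1) S * μ + 𝓔 * PowerSeries.coeff k S = 0) ∧
  IsSymplecticSeries G S

/-- `R(z) = 1 + R₁ z + R₂ z² + ⋯`, with `R(-z)^t R(z) = 1`, is such that `Ψ R(z) e^{U/z}` is a formal
solution of `(z ∂_z - μ + 𝓔/z) J = 0`; the equation is written coefficientwise, after
cancellation of `e^{U/z}`. -/
def IsAsymptoticSolution (μ 𝓔 Ψ U : Mat N) (R : PowerSeries (Mat N)) : Prop :=
  PowerSeries.coeff 0 R = 1 ∧
  (∀ k : ℕ, (k : ℂ) • (Ψ * PowerSeries.coeff k R) - μ * Ψ * PowerSeries.coeff k R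
    - Ψ * PowerSeries.coeff (k + 1) R * U + 𝓔 * Ψ * PowerSeries.coeff (k + 1) R = 0) ∧
  IsSymplecticSeries 1 R

end Series

/-! ### Operators on vector-valued Laurent series in `z`

An operator is given by its block matrix: `A m n` maps the coefficient at `z^n` of the argument to
the coefficient at `z^m` of the value. -/

section Operators

variable {N : ℕ}

/-- Formal sums `∑ f_k z^k`. -/
abbrev Loop (N : ℕ) : Type := ℤ → Fin N → ℂ

/-- Block matrices of operators. -/
abbrev Op (N : ℕ) : Type := ℤ → ℤ → Mat N

/-- Action of an operator. -/
def Op.app (A : Op N) (f : Loop N) : Loop N := fun m => ∑ᶠ n : ℤ, (A m n).mulVec (f n)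

/-- Composition of operators. -/
def Op.comp (A B : Op N) : Op N := fun m n => ∑ᶠ k : ℤ, A m k * B k n

/-- Multiplication by a constant matrix. -/
def opConst (A : Mat N) : Op N := fun m n => if m = n then A else 0

/-- Multiplication by `∑ A_k z^k`, `k ≥ 0`. -/
def opPos (A : PowerSeries (Mat N)) : Op N :=
  fun m n => if n ≤ m then PowerSeries.coeff (m - n).toNat A else 0

/-- Multiplication by `∑ A_k z^{-k}`, `k ≥ 0`. -/
def opNeg (A : PowerSeries (Mat N)) : Op N :=
  fun m n => if m ≤ n then PowerSeries.coeff (n - m).toNat A else 0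

/-- The Virasoro operator `l₀ = z ∂_z + 1/2 - μ`. -/
def virasoro (μ : Mat N) : Op N :=
  fun m n => if m = n then ((n : ℂ) + 1 / 2) • (1 : Mat N) - μ else 0

/-- The symplectic form `Ω(f, g) = (1/2πi) ∮ (f(-z), g(z)) dz`, where `(·,·)` has Gram
matrix `G`. -/
def symp (G : Mat N) (f g : Loop N) : ℂ :=
  ∑ᶠ k : ℤ, (-1 : ℂ) ^ k * dotProduct (f k) (G.mulVec (g (-1 - k)))

/-- Indices of Darboux coordinates: `(k, a)`. -/
abbrev Idx (N : ℕ) : Type := ℕ × Fin N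

/-- The basis vector `e_a z^k` of the coordinate `q_k^a`. -/
def qVec (i : Idx N) : Loop N := Pi.single (i.1 : ℤ) (Pi.single i.2 1)

/-- The basis vector `e^a (-z)^{-1-k}` of the coordinate `p_k^a`, where `e^1, …, e^N` is the basis
dual to `e_1, …, e_N` with respect to the form with Gram matrix `G`.  Thus
`Ω(f, g) = ∑ (p(f) q(g) - q(f) p(g))`. -/
def pVec (G : Mat N) (i : Idx N) : Loop N :=
  Pi.single (-1 - (i.1 : ℤ)) ((-1 : ℂ) ^ (i.1 + 1) • G⁻¹.mulVec (Pi.single i.2 1))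

/-- The symmetric bilinear form whose quadratic form is the quadratic hamiltonian
`h_A(f) = Ω(A f, f)/2`. -/
def ham (G : Mat N) (A : Op N) (v w : Loop N) : ℂ :=
  (1 / 4) * (symp G (A.app v) w + symp G (A.app w) v)

/-- The cocycle: the antisymmetric bilinear function of quadratic hamiltonians with
`C(p_i p_j, q_i q_j) = 1` for `i ≠ j`, `= 2` for `i = j`, vanishing on all other pairs of
monomials, evaluated on `h_A`, `h_B`.  (A hamiltonian is
`∑_{i,j} (ham(q_i,q_j) q_i q_j + 2 ham(q_i,p_j) q_i p_j + ham(p_i,p_j) p_i p_j)`.) -/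
def cocycle (G : Mat N) (A B : Op N) : ℂ :=
  2 * ∑ᶠ ij : Idx N × Idx N,
    (ham G A (pVec G ij.1) (pVec G ij.2) * ham G B (qVec ij.1) (qVec ij.2)
      - ham G A (qVec ij.1) (qVec ij.2) * ham G B (pVec G ij.1) (pVec G ij.2))

end Operators

/-! ### Quantization -/

section Quantization

variable {N : ℕ}

/-- The field `ℂ((ħ))`. -/
abbrev Coef : Type := LaurentSeries ℂ

/-- The parameter `ħ`. -/
def hbar : Coef := HahnSeries.single (1 : ℤ) (1 : ℂ)

/-- Formal functions of `q = q_0 + q_1 z + q_2 z² + ⋯` over `ℂ((ħ))`. -/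
abbrev Fock (N : ℕ) : Type := MvPowerSeries (Idx N) Coef

/-- The polynomial functions of `q`. -/
def polys (N : ℕ) : Set (Fock N) :=
  Set.range fun P : MvPolynomial (Idx N) Coef => (P : MvPowerSeries (Idx N) Coef)

/-- The quantization of the quadratic hamiltonian `Ω(A f, f)/2` by the rules
`q_i q_j ↦ q_i q_j/ħ`, `q_i p_j ↦ q_i ∂_j`, `p_i p_j ↦ ħ ∂_i ∂_j`. -/
def quantize (G : Mat N) (A : Op N) (F : Fock N) : Fock N := fun m =>
  (∑ᶠ ij : Idx N × Idx N, HahnSeries.C (ham G A (qVec ij.1) (qVec ij.2)) * hbar⁻¹ *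
    MvPowerSeries.coeff m (MvPowerSeries.X ij.1 * MvPowerSeries.X ij.2 * F)) +
  (∑ᶠ ij : Idx N × Idx N, HahnSeries.C (2 * ham G A (qVec ij.1) (pVec G ij.2)) *
    MvPowerSeries.coeff m (MvPowerSeries.X ij.1 * MvPowerSeries.pderiv Coef ij.2 F)) +
  (∑ᶠ ij : Idx N × Idx N, HahnSeries.C (ham G A (pVec G ij.1) (pVec G ij.2)) * hbar *
    MvPowerSeries.coeff m (MvPowerSeries.pderiv Coef ij.1 (MvPowerSeries.pderiv Coef ij.2 F)))

/-- The exponential `∑ T^n/n!` of an operator `T`, the sum being taken coefficientwise. -/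
def expOp (T : Fock N → Fock N) (F : Fock N) : Fock N := fun m =>
  ∑ᶠ n : ℕ, HahnSeries.C ((n.factorial : ℂ)⁻¹) * MvPowerSeries.coeff m (T^[n] F)

/-- The linear change of variables `F ↦ F(A q)`, `(A q)_k = A q_k`. -/
def changeVar (A : Mat N) (F : Fock N) : Fock N :=
  MvPowerSeries.subst
    (fun i : Idx N => ∑ b, MvPowerSeries.C (HahnSeries.C (A i.2 b)) *
      (MvPowerSeries.X (i.1, b) : Fock N)) F

/-- `M̂ = e^c Ŝ⁻¹ Ψ̂ R̂ e^{(U/z)^}`.  Here `Ŝ = exp (ln S)^`, `R̂ = exp (ln R)^`, `Ψ̂` identifies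
functions on `ℂ^N[z]` with functions on `H[z]`, `(Ψ̂ F)(q) = F(Ψ⁻¹ q)`, and `G` is the Gram matrix
of the pairing on `H`. -/
def quantM (G Ψ U : Mat N) (S R : PowerSeries (Mat N)) (c : ℂ) (F : Fock N) : Fock N :=
  MvPowerSeries.C (HahnSeries.C (Complex.exp c)) *
    expOp (quantize G (-opNeg (logSeries S)))
      (changeVar Ψ⁻¹
        (expOp (quantize 1 (opPos (logSeries R)))
          (expOp (quantize 1 (opNeg (linSeries U))) F)))

/-- `M̂⁻¹ = e^{-c} e^{-(U/z)^} R̂⁻¹ Ψ̂⁻¹ Ŝ`. -/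
def quantMInv (G Ψ U : Mat N) (S R : PowerSeries (Mat N)) (c : ℂ) (F : Fock N) : Fock N :=
  MvPowerSeries.C (HahnSeries.C (Complex.exp (-c))) *
    expOp (quantize 1 (-opNeg (linSeries U)))
      (expOp (quantize 1 (-opPos (logSeries R)))
        (changeVar Ψ
          (expOp (quantize G (opNeg (logSeries S))) F)))

/-- The domain of `M̂`: all `e^{-(U/z)^} P` with `P` a polynomial function on `ℂ^N[z]`. -/
def domM (U : Mat N) : Set (Fock N) :=
  expOp (quantize 1 (-opNeg (linSeries U))) '' polys N

/-- The range of `M̂`: all `Ŝ⁻¹ P` with `P` a polynomial function on `H[z]`. -/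
def ranM (G : Mat N) (S : PowerSeries (Mat N)) : Set (Fock N) :=
  expOp (quantize G (-opNeg (logSeries S))) '' polys N

/-- `M⁻¹ T M` for `M = S⁻¹ Ψ R e^{U/z}`, i.e. `e^{-U/z} (R⁻¹ (Ψ⁻¹ (S T S⁻¹) Ψ) R) e^{U/z}`. -/
def conjM (Ψ U : Mat N) (S R : PowerSeries (Mat N)) (T : Op N) : Op N :=
  let T₁ := Op.comp (Op.comp (opNeg S) T) (opNeg (Ring.inverse S))
  let T₂ := Op.comp (Op.comp (opConst Ψ⁻¹) T₁) (opConst Ψ)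
  let T₃ := Op.comp (Op.comp (opPos (Ring.inverse R)) T₂) (opPos R)
  Op.comp (Op.comp (opNeg (expSeries (-U))) T₃) (opNeg (expSeries U))

end Quantization

end ADEVirasoro

end

open ADEVirasoro

noncomputable section

namespace ADEVirasoro

/-! ### Exponential and logarithm of power series with non-commuting coefficients -/

section SeriesCalculus

open PowerSeries Finset

/-! The quantization of quadratic hamiltonians respects commutators up to scalars. Its root is an
exact identity: the commutator of `Â` with the operator of the linear hamiltonian of `f` is the
operator of `A f` (`qPart_mul_linOp`). Consequently `e^{-Â} B̂ e^{Â}` and the quantization of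
`e^{-A} B e^{A}` have the same commutators with every `q_i` and `∂_i`. Their difference commutes
with all of these (`conjDefect_commute`), so it acts on polynomials as a scalar
(`apply_coe_of_commute`), which is found by applying it to `1`.

Before quantization, `S` turns `z∂ + 1/2 - μ` into `z∂ + 1/2 - μ + 𝓔/z`, the frame `Ψ` turns this
into `z∂ + 1/2 - V + U/z` with `V = Ψ⁻¹ μ Ψ`, `R` removes `V`, and `e^{U/z}` removes `U/z`
(`conjM_virasoro`). After quantization, `S` and `e^{U/z}` contribute no scalar, because the parts of
degree zero in `z` annihilate `1` (`conjDefect_zero_one`), and a linear change of variables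
contributes none either. Only `R` does: the `ħ ∂∂` part of the quantized `R₁ z` meets the `q₀ q₀/ħ`
part of the quantized `U/z` (`conjDefect_one_one`), which gives the cocycle `½ ∑ R₁^{ii} u^i`. The
equation of `R` in its two lowest degrees gives `V = [U, R₁]` and the diagonal of `R₁`, and
antisymmetry of `V` turns the sum into `¼ tr(μ μ*)` (`trace_formula`).

All infinite sums are controlled by a grading. With weight `2k + 1` on `q_k`, the quantization of
the `z^k` part of an operator lowers the weight by `2k`. Series in `z⁻¹` therefore act on all power
series, whose weights are bounded below, and series in `z` act on polynomials, whose weights are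
bounded above. An operator is decomposed into a formal series of homogeneous parts, algebra is done
with these series, and the series is evaluated at `1` on such functions (`evalOne_mul`).

The singularity enters only through `IsFrame`. Monomials of weight at least `1` lie in the jacobian
ideal of `f`, so all deformation parameters have positive weight and the `ψ_a` still span
`ℂ[x]/(∂f_τ)`; at a Morse point they become a basis of functions on the critical set. The residue is
then `∑ φ/Δ_i`, which makes `Ψ` orthonormal, and Euler's identity makes `𝓔` diagonal in it with
eigenvalues `u^i`. Antisymmetry of `μ` follows from the equation of `R`, because `R₁` is symmetric.
-/

theorem sum_range_antidiagonal_of_vanish {M : Type*} [AddCommMonoid M] (f : ℕ → ℕ → M) (K : ℕ)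
    (hf : ∀ a b, K ≤ a + b → f a b = 0) :
    ∑ n ∈ range K, ∑ p ∈ antidiagonal n, f p.1 p.2 = ∑ a ∈ range K, ∑ b ∈ range K, f a b := by
  rw [← Finset.sum_product', Finset.sum_sigma']
  symm
  have h : ∑ x ∈ range K ×ˢ range K, f x.1 x.2 =
      ∑ x ∈ (range K ×ˢ range K).filter (fun x => x.1 + x.2 < K), f x.1 x.2 := by
    symm
    apply Finset.sum_subset (Finset.filter_subset _ _)
    intro x hx hx'
    apply hf
    simp only [mem_filter, not_and, not_lt] at hx'
    exact hx' hx
  rw [h]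
  apply Finset.sum_bij' (fun x _ => (⟨x.1 + x.2, x⟩ : Σ _ : ℕ, ℕ × ℕ)) (fun y _ => y.2)
  · intro x hx
    simp only [mem_filter, mem_product, mem_range] at hx
    simp [hx.2]
  · rintro ⟨n, a, b⟩ hy
    simp only [mem_sigma, mem_range, Finset.HasAntidiagonal.mem_antidiagonal] at hy
    simp only [mem_filter, mem_product, mem_range]
    omega
  · intros; rfl
  · rintro ⟨n, a, b⟩ hy
    simp only [mem_sigma, mem_range, Finset.HasAntidiagonal.mem_antidiagonal] at hy
    simp [hy.2]
  · intros; rfl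

variable {𝓡 : Type*} [Ring 𝓡] [Algebra ℂ 𝓡]

theorem coeff_smul_complex (n : ℕ) (c : ℂ) (F : PowerSeries 𝓡) :
    coeff n (c • F) = c • coeff n F := rfl

theorem coeff_pow_of_lt {A : PowerSeries 𝓡} (hA : coeff 0 A = 0) {k i : ℕ} (h : k < i) :
    coeff k (A ^ i) = 0 := by
  induction i generalizing k with
  | zero => omega
  | succ i ih =>
    rw [pow_succ, coeff_mul]
    apply Finset.sum_eq_zero
    rintro ⟨a, b⟩ hab
    simp only [Finset.HasAntidiagonal.mem_antidiagonal] at hab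
    rcases Nat.eq_zero_or_pos b with rfl | hb
    · simp [hA]
    · rw [ih (by omega), zero_mul]

/-- Substitution of a series without constant term into a scalar power series. -/
def evS (A : PowerSeries 𝓡) (φ : PowerSeries ℂ) : PowerSeries 𝓡 :=
  PowerSeries.mk fun k => ∑ i ∈ range (k + 1), coeff i φ • coeff k (A ^ i)

theorem coeff_evS_eq_sum {A : PowerSeries 𝓡} (hA : coeff 0 A = 0) (φ : PowerSeries ℂ) {k K : ℕ}
    (h : k < K) : coeff k (evS A φ) = ∑ i ∈ range K, coeff i φ • coeff k (A ^ i) := by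
  rw [evS, coeff_mk]
  apply Finset.sum_subset
  · intro x hx; simp only [mem_range] at *; omega
  · intro x _ hx
    simp only [mem_range, not_lt] at hx
    rw [coeff_pow_of_lt hA (by omega), smul_zero]

theorem coeff_evS_eq_aeval {A : PowerSeries 𝓡} (hA : coeff 0 A = 0) (φ : PowerSeries ℂ)
    (p : Polynomial ℂ) {k : ℕ} (h : ∀ i ≤ k, p.coeff i = coeff i φ) :
    coeff k (evS A φ) = coeff k (Polynomial.aeval A p) := by
  have hK : p.natDegree < max (p.natDegree + 1) (k + 1) := by omega
  rw [coeff_evS_eq_sum hA φ (show k < max (p.natDegree + 1) (k + 1) by omega),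
    Polynomial.aeval_eq_sum_range' hK, map_sum]
  apply Finset.sum_congr rfl
  intro i _
  rw [coeff_smul_complex]
  by_cases hi : i ≤ k
  · rw [h i hi]
  · rw [coeff_pow_of_lt hA (by omega), smul_zero, smul_zero]

/-- Only powers of the single series `A` occur, and these commute with each other, so
noncommutativity of `𝓡` does no harm. In degree `k` both factors may be truncated to polynomials,
where the claim is multiplicativity of `Polynomial.aeval`. -/
theorem evS_mul {A : PowerSeries 𝓡} (hA : coeff 0 A = 0) (φ χ : PowerSeries ℂ) :
    evS A (φ * χ) = evS A φ * evS A χ := by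
  ext k
  have ht : ∀ (θ : PowerSeries ℂ), ∀ i ≤ k, (trunc (k + 1) θ).coeff i = coeff i θ := by
    intro θ i hi
    rw [coeff_trunc, if_pos (by omega)]
  rw [coeff_mul, coeff_evS_eq_aeval hA (φ * χ) (trunc (k + 1) φ * trunc (k + 1) χ), map_mul,
    coeff_mul]
  · apply Finset.sum_congr rfl
    rintro ⟨a, b⟩ hab
    simp only [Finset.HasAntidiagonal.mem_antidiagonal] at hab
    rw [coeff_evS_eq_aeval hA φ (trunc (k + 1) φ) (fun i hi => ht φ i (by omega)),
      coeff_evS_eq_aeval hA χ (trunc (k + 1) χ) (fun i hi => ht χ i (by omega))]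
  · intro i hi
    rw [Polynomial.coeff_mul, coeff_mul]
    apply Finset.sum_congr rfl
    rintro ⟨a, b⟩ hab
    simp only [Finset.HasAntidiagonal.mem_antidiagonal] at hab
    rw [ht φ a (by omega), ht χ b (by omega)]

theorem evS_one (A : PowerSeries 𝓡) : evS A 1 = 1 := by
  ext k
  rw [evS, coeff_mk, Finset.sum_eq_single 0]
  · simp
  · intro i _ hi
    rw [coeff_one, if_neg hi, zero_smul]
  · simp

theorem evS_pow {A : PowerSeries 𝓡} (hA : coeff 0 A = 0) (φ : PowerSeries ℂ) (n : ℕ) :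
    evS A (φ ^ n) = evS A φ ^ n := by
  induction n with
  | zero => simp [evS_one]
  | succ n ih => rw [pow_succ, evS_mul hA, ih, pow_succ]

/-- Since `χ` has no constant term, `χ ^ i` starts in degree `i`; every sum is finite in a given
degree and the two summations can be exchanged. -/
theorem evS_evS {A : PowerSeries 𝓡} (hA : coeff 0 A = 0) (φ χ : PowerSeries ℂ)
    (hχ : constantCoeff χ = 0) : evS (evS A χ) φ = evS A (φ.subst χ) := by
  have hs : HasSubst χ := HasSubst.of_constantCoeff_zero' hχ
  ext k
  rw [show coeff k (evS (evS A χ) φ) = ∑ i ∈ range (k + 1), coeff i φ • coeff k (evS A χ ^ i) from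
    coeff_mk _ _, show coeff k (evS A (φ.subst χ)) = ∑ i ∈ range (k + 1), coeff i (φ.subst χ) •
    coeff k (A ^ i) from coeff_mk _ _]
  have h1 : ∀ i ∈ range (k + 1), coeff i φ • coeff k (evS A χ ^ i) =
      ∑ j ∈ range (k + 1), (coeff i φ * coeff j (χ ^ i)) • coeff k (A ^ j) := by
    intro i _
    rw [← evS_pow hA, evS, coeff_mk, Finset.smul_sum]
    simp only [mul_smul]
  rw [Finset.sum_congr rfl h1, Finset.sum_comm]
  apply Finset.sum_congr rfl
  intro j hj
  simp only [mem_range] at hj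
  rw [← Finset.sum_smul, PowerSeries.coeff_subst' hs, finsum_eq_sum_of_support_subset (s := range (k + 1))]
  · simp
  · intro i hi
    simp only [Function.mem_support, smul_eq_mul] at hi
    simp only [coe_range, Set.mem_Iio]
    by_contra hcon
    apply hi
    rw [coeff_pow_of_lt (by simpa using hχ) (by omega : j < i), mul_zero]

/-- The exponential of a series without constant term. -/
def expS (A : PowerSeries 𝓡) : PowerSeries 𝓡 := evS A (PowerSeries.exp ℂ)

theorem coeff_exp_complex (n : ℕ) : coeff n (PowerSeries.exp ℂ) = ((n.factorial : ℂ))⁻¹ := by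
  simp [coeff_exp]

theorem coeff_expS {A : PowerSeries 𝓡} (hA : coeff 0 A = 0) {k K : ℕ} (h : k < K) :
    coeff k (expS A) = ∑ i ∈ range K, ((i.factorial : ℂ))⁻¹ • coeff k (A ^ i) := by
  rw [expS, coeff_evS_eq_sum hA _ h]
  simp only [coeff_exp_complex]

theorem coeff_zero_expS {A : PowerSeries 𝓡} (hA : coeff 0 A = 0) : coeff 0 (expS A) = 1 := by
  rw [coeff_expS hA Nat.zero_lt_one]; simp

theorem coeff_one_expS {A : PowerSeries 𝓡} (hA : coeff 0 A = 0) :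
    coeff 1 (expS A) = coeff 1 A := by
  rw [coeff_expS hA (by norm_num : 1 < 2)]; simp [Finset.sum_range_succ, coeff_one]

theorem neg_one_pow_smul_evS (A : PowerSeries 𝓡) (φ : PowerSeries ℂ) :
    evS (-A) φ = evS A (evalNegHom φ) := by
  ext k
  rw [evS, evS, coeff_mk, coeff_mk]
  apply Finset.sum_congr rfl
  intro i _
  rw [evalNegHom, coeff_rescale, ← neg_one_smul ℂ A, smul_pow, coeff_smul_complex, smul_smul,
    mul_comm]

theorem expS_mul_expS_neg {A : PowerSeries 𝓡} (hA : coeff 0 A = 0) :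
    expS A * expS (-A) = 1 := by
  rw [expS, expS, neg_one_pow_smul_evS, ← evS_mul hA, exp_mul_exp_neg_eq_one, evS_one]

theorem expS_neg_mul_expS {A : PowerSeries 𝓡} (hA : coeff 0 A = 0) :
    expS (-A) * expS A = 1 := by
  have := expS_mul_expS_neg (A := -A) (by rw [map_neg, hA, neg_zero])
  rwa [neg_neg] at this

/-- The composite `h` satisfies `(1 + X) h' = h` and `h(0) = 1`. The resulting recursion `(n + 1)
h_{n+1} + n h_n = h_n` forces `h₁ = 1` and then kills all higher coefficients. -/
theorem exp_subst_log : (PowerSeries.exp ℂ).subst (PowerSeries.log ℂ) = 1 + (X : PowerSeries ℂ) := by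
  set h : PowerSeries ℂ := (PowerSeries.exp ℂ).subst (PowerSeries.log ℂ) with hh
  have hd : d⁄dX ℂ h = h * d⁄dX ℂ (log ℂ) := by
    rw [hh, derivative_subst HasSubst.log, derivative_exp]
  have hl : (1 + X) * d⁄dX ℂ (log ℂ) = 1 := by
    rw [deriv_log]
    ext n
    cases n with
    | zero => simp [add_mul]
    | succ n => simp [add_mul, coeff_succ_X_mul, pow_succ, coeff_one]
  have he : (1 + X) * d⁄dX ℂ h = h := by
    rw [hd, mul_left_comm, hl, mul_one]
  have h0 : coeff 0 h = 1 := by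
    rw [hh, PowerSeries.coeff_subst' HasSubst.log, finsum_eq_single _ 0]
    · simp
    · intro n hn
      simp [hn]
  have hn : ∀ n, coeff (n + 1) h * ((n : ℂ) + 1) + n * coeff n h = coeff n h := by
    intro n
    have := congrArg (coeff n) he
    cases n with
    | zero =>
      rw [add_mul, one_mul, map_add, coeff_zero_X_mul, coeff_derivative] at this
      simpa using this
    | succ n =>
      rw [add_mul, one_mul, map_add, coeff_succ_X_mul, coeff_derivative, coeff_derivative] at this
      push_cast at this ⊢
      linear_combination this
  have h1 : coeff 1 h = 1 := by simpa [h0] using hn 0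
  have h2 : ∀ n, coeff (n + 2) h = 0 := by
    intro n
    induction n with
    | zero =>
      have := hn 1
      rw [h1] at this
      norm_num at this
      simpa using this
    | succ n ih =>
      have := hn (n + 2)
      rw [ih] at this
      simp only [mul_zero, add_zero, mul_eq_zero] at this
      rcases this with h | h
      · exact h
      · exact absurd h (by exact_mod_cast Nat.succ_ne_zero (n + 2))
  ext n
  match n with
  | 0 => simpa using h0
  | 1 => simp [h1, coeff_one]
  | n + 2 => simp [h2, coeff_one, coeff_X]

/-- The logarithm of a series with constant term `1`. -/
def logS (F : PowerSeries 𝓡) : PowerSeries 𝓡 := evS (F - 1) (PowerSeries.log ℂ)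

theorem coeff_zero_logS (F : PowerSeries 𝓡) : coeff 0 (logS F) = 0 := by
  rw [logS, evS, coeff_mk]; simp

theorem coeff_one_logS (F : PowerSeries 𝓡) : coeff 1 (logS F) = coeff 1 F := by
  rw [logS, evS, coeff_mk]; simp [Finset.sum_range_succ, coeff_one]

theorem expS_logS {F : PowerSeries 𝓡} (hF : coeff 0 F = 1) : expS (logS F) = F := by
  have h0 : coeff 0 (F - 1) = 0 := by rw [map_sub, hF]; simp
  rw [expS, logS, evS_evS h0 _ _ constantCoeff_log, exp_subst_log]
  ext k
  rw [coeff_evS_eq_sum h0 _ (show k < k + 2 by omega), Finset.sum_eq_add_of_mem 0 1 (by simp)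
    (by simp) (by simp)]
  · simp [coeff_one, coeff_X]
  · intro c _ hc
    simp [coeff_one, coeff_X, hc.1, hc.2]

theorem logSeries_eq_logS {n : ℕ} (F : PowerSeries (Mat n)) : logSeries F = logS F := by
  ext1 k
  rw [logSeries, logS, evS, coeff_mk, coeff_mk, Finset.range_eq_Ico,
    Finset.sum_eq_sum_Ico_succ_bot (by omega)]
  simp only [coeff_log, if_true, zero_smul, zero_add]
  apply Finset.sum_congr
  · ext; simp [Finset.mem_Ico, Finset.mem_Icc]
  · intro i hi
    have : i ≠ 0 := by simp only [Finset.mem_Ico] at hi; omega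
    simp [this]

theorem coeff_pow_congr {A B : PowerSeries 𝓡} {k : ℕ} (h : ∀ i ≤ k, coeff i A = coeff i B)
    (n : ℕ) : ∀ i ≤ k, coeff i (A ^ n) = coeff i (B ^ n) := by
  induction n with
  | zero => simp
  | succ n ih =>
    intro i hi
    rw [pow_succ, pow_succ, coeff_mul, coeff_mul]
    apply Finset.sum_congr rfl
    rintro ⟨a, b⟩ hab
    simp only [Finset.HasAntidiagonal.mem_antidiagonal] at hab
    rw [ih a (by omega), h b (by omega)]

/-- Induction on the degree: without constant terms, the degree `k` coefficient of a power with
exponent at least `2` involves only coefficients of lower degree, so the linear term of the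
exponential determines the degree `k` coefficient. -/
theorem expS_injective {A B : PowerSeries 𝓡} (hA : coeff 0 A = 0) (hB : coeff 0 B = 0)
    (h : expS A = expS B) : A = B := by
  ext k
  induction k using Nat.strong_induction_on with
  | _ k ih =>
    rcases Nat.eq_zero_or_pos k with rfl | hk
    · rw [hA, hB]
    have hp : ∀ n, coeff k (A ^ (n + 2)) = coeff k (B ^ (n + 2)) := by
      intro n
      rw [pow_succ _ (n + 1), pow_succ _ (n + 1), coeff_mul, coeff_mul]
      apply Finset.sum_congr rfl
      rintro ⟨a, b⟩ hab
      simp only [Finset.HasAntidiagonal.mem_antidiagonal] at hab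
      rcases Nat.eq_zero_or_pos b with rfl | hb
      · simp only [hA, hB, mul_zero]
      rcases Nat.eq_zero_or_pos a with rfl | ha
      · simp only [coeff_pow_of_lt hA (Nat.succ_pos n), coeff_pow_of_lt hB (Nat.succ_pos n),
          zero_mul]
      · simp only
        rw [ih b (by omega), coeff_pow_congr (k := a) (fun i hi => ih i (by omega)) (n + 1) a le_rfl]
    have := congrArg (coeff k) h
    rw [coeff_expS hA (show k < k + 2 by omega), coeff_expS hB (show k < k + 2 by omega),
      Finset.sum_range_succ', Finset.sum_range_succ', Finset.sum_range_succ',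
      Finset.sum_range_succ'] at this
    simpa [hp] using this

/-- An additive anti-endomorphism of the coefficients, twisted by `z ↦ -z`, commutes with the
exponential. -/
theorem expS_anti (s : 𝓡 →ₗ[ℂ] 𝓡) (h1 : s 1 = 1) (hmul : ∀ a b, s (a * b) = s b * s a)
    {A : PowerSeries 𝓡} (hA : coeff 0 A = 0) :
    PowerSeries.mk (fun k => (-1 : ℂ) ^ k • s (coeff k (expS A))) =
      expS (PowerSeries.mk fun k => (-1 : ℂ) ^ k • s (coeff k A)) := by
  set t : PowerSeries 𝓡 → PowerSeries 𝓡 :=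
    fun F => PowerSeries.mk fun k => (-1 : ℂ) ^ k • s (coeff k F) with ht
  have tmul : ∀ F F' : PowerSeries 𝓡, t (F * F') = t F' * t F := by
    intro F F'
    ext k
    simp only [ht, coeff_mk, coeff_mul, map_sum, Finset.smul_sum]
    rw [← Finset.Nat.sum_antidiagonal_swap]
    apply Finset.sum_congr rfl
    rintro ⟨a, b⟩ hab
    simp only [Finset.HasAntidiagonal.mem_antidiagonal] at hab
    simp only [Prod.swap_prod_mk]
    rw [hmul, smul_mul_smul_comm, ← pow_add, hab]
  have tone : t 1 = 1 := by
    ext k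
    simp only [ht, coeff_mk, coeff_one]
    split_ifs with hk
    · simp [hk, h1]
    · simp
  -- `t` reverses products, which is invisible on powers of one element.
  have tpow : ∀ n, t (A ^ n) = t A ^ n := by
    intro n
    induction n with
    | zero => simp [tone]
    | succ n ih => rw [pow_succ, tmul, ih, ← pow_succ']
  have hA' : coeff 0 (t A) = 0 := by
    simp only [ht, coeff_mk, hA, map_zero, smul_zero]
  change t (expS A) = expS (t A)
  ext k
  rw [coeff_expS hA' (Nat.lt_succ_self k)]
  simp only [ht, coeff_mk, coeff_expS hA (Nat.lt_succ_self k), map_sum, map_smul, Finset.smul_sum]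
  apply Finset.sum_congr rfl
  intro i _
  rw [← tpow]
  simp only [ht, coeff_mk]
  rw [smul_comm]

/-- The passage from a symplectic group to its Lie algebra: the twisted adjoint of `F` is `F⁻¹ = exp
(-log F)`, and it is also the exponential of the twisted adjoint of `log F`. Injectivity of the
exponential compares the exponents. -/
theorem logS_anti (s : 𝓡 →ₗ[ℂ] 𝓡) (h1 : s 1 = 1) (hmul : ∀ a b, s (a * b) = s b * s a)
    {F : PowerSeries 𝓡} (hF : coeff 0 F = 1)
    (hs : PowerSeries.mk (fun k => (-1 : ℂ) ^ k • s (coeff k F)) * F = 1) (k : ℕ) :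
    (-1 : ℂ) ^ k • s (coeff k (logS F)) = - coeff k (logS F) := by
  have h0 := coeff_zero_logS F
  have key : (PowerSeries.mk fun k => (-1 : ℂ) ^ k • s (coeff k (logS F))) = - logS F := by
    apply expS_injective
    · simp only [coeff_mk, h0, map_zero, smul_zero]
    · rw [map_neg, h0, neg_zero]
    · rw [← expS_anti s h1 hmul h0, expS_logS hF]
      have h2 := expS_mul_expS_neg h0
      rw [expS_logS hF] at h2
      exact left_inv_eq_right_inv hs h2
  have := congrArg (coeff k) key
  rwa [coeff_mk, map_neg] at this

/-- If `T Λ(Y) - Λ(Y) T = Λ(A Y)` for a graded map `Λ`, then `e^T Λ(Y) = Λ(e^A Y) e^T`. -/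
theorem expS_intertwine {𝓜 : Type*} [Ring 𝓜] [Algebra ℂ 𝓜]
    (l : ℕ → 𝓜 →ₗ[ℂ] 𝓡) {T : PowerSeries 𝓡} {A : PowerSeries 𝓜}
    (hT : coeff 0 T = 0) (hA : coeff 0 A = 0)
    (hc : ∀ Y : PowerSeries 𝓜, T * PowerSeries.mk (fun n => l n (coeff n Y)) =
      PowerSeries.mk (fun n => l n (coeff n Y)) * T +
        PowerSeries.mk (fun n => l n (coeff n (A * Y))))
    (Y : PowerSeries 𝓜) :
    expS T * PowerSeries.mk (fun n => l n (coeff n Y)) =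
      PowerSeries.mk (fun n => l n (coeff n (expS A * Y))) * expS T := by
  set Λ : PowerSeries 𝓜 →ₗ[ℂ] PowerSeries 𝓡 :=
    { toFun := fun Y => PowerSeries.mk fun n => l n (coeff n Y)
      map_add' := fun a b => by ext n; simp
      map_smul' := fun c a => by
        ext n; simp } with hΛ
  change ∀ Y, T * Λ Y = Λ Y * T + Λ (A * Y) at hc
  change expS T * Λ Y = Λ (expS A * Y) * expS T
  have hpow : ∀ n, ((n.factorial : ℂ))⁻¹ • (T ^ n * Λ Y) =
      ∑ p ∈ antidiagonal n, (((p.1.factorial : ℂ))⁻¹ • Λ (A ^ p.1 * Y)) *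
        (((p.2.factorial : ℂ))⁻¹ • T ^ p.2) := by
    -- Moving the factors `T` to the right of `Λ Y` one at a time gives a Leibniz rule, hence
    -- binomial coefficients; after division by `n!` it becomes a Cauchy product of two
    -- exponentials.
    have hbin : ∀ n, T ^ n * Λ Y = ∑ p ∈ antidiagonal n, n.choose p.1 •
        (Λ (A ^ p.1 * Y) * T ^ p.2) := by
      intro n
      induction n with
      | zero => simp
      | succ n ih =>
        rw [Finset.sum_antidiagonal_choose_succ_nsmul (fun a b => Λ (A ^ a * Y) * T ^ b) n,
          pow_succ', mul_assoc, ih, Finset.mul_sum, ← Finset.sum_add_distrib]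
        apply Finset.sum_congr rfl
        rintro ⟨a, b⟩ hab
        simp only [Finset.HasAntidiagonal.mem_antidiagonal] at hab
        subst hab
        simp only
        rw [mul_smul_comm, ← mul_assoc, hc, ← Nat.choose_symm_add, ← smul_add, add_mul, pow_succ',
          pow_succ', mul_assoc, mul_assoc]
    intro n
    rw [hbin, Finset.smul_sum]
    apply Finset.sum_congr rfl
    rintro ⟨a, b⟩ hab
    simp only [Finset.HasAntidiagonal.mem_antidiagonal] at hab
    subst hab
    rw [smul_mul_smul_comm, ← Nat.cast_smul_eq_nsmul ℂ, smul_smul]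
    congr 1
    have h1 : ((a + b).factorial : ℂ) ≠ 0 := by exact_mod_cast Nat.factorial_ne_zero _
    have h2 : (a.factorial : ℂ) ≠ 0 := by exact_mod_cast Nat.factorial_ne_zero _
    have h3 : (b.factorial : ℂ) ≠ 0 := by exact_mod_cast Nat.factorial_ne_zero _
    have h4 := Nat.add_choose_mul_factorial_mul_factorial a b
    rw [← Nat.choose_symm_add] at h4
    have h5 : ((a + b).choose a : ℂ) * a.factorial * b.factorial = (a + b).factorial := by
      exact_mod_cast h4
    simp only
    field_simp
    rw [← h5]
  have hΛ' : ∀ Y n, coeff n (Λ Y) = l n (coeff n Y) := fun Y n => by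
    simp [hΛ]
  ext K
  -- In degree at most `K` each exponential may be replaced by the same finite partial sum.
  have hE : ∀ i ≤ K, coeff i (expS T) =
      coeff i (∑ n ∈ range (K + 1), ((n.factorial : ℂ))⁻¹ • T ^ n) := by
    intro i hi
    rw [coeff_expS hT (show i < K + 1 by omega), map_sum]
    rfl
  have hEA : ∀ i ≤ K, coeff i (expS A) =
      coeff i (∑ n ∈ range (K + 1), ((n.factorial : ℂ))⁻¹ • A ^ n) := by
    intro i hi
    rw [coeff_expS hA (show i < K + 1 by omega), map_sum]
    rfl
  have hAY : ∀ i ≤ K, coeff i (expS A * Y) =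
      coeff i ((∑ n ∈ range (K + 1), ((n.factorial : ℂ))⁻¹ • A ^ n) * Y) := by
    intro i hi
    rw [coeff_mul, coeff_mul]
    apply Finset.sum_congr rfl
    rintro ⟨a, b⟩ hab
    simp only [Finset.HasAntidiagonal.mem_antidiagonal] at hab
    rw [hEA a (by omega)]
  have hL : coeff K (expS T * Λ Y) =
      coeff K ((∑ n ∈ range (K + 1), ((n.factorial : ℂ))⁻¹ • T ^ n) * Λ Y) := by
    rw [coeff_mul, coeff_mul]
    apply Finset.sum_congr rfl
    rintro ⟨a, b⟩ hab
    simp only [Finset.HasAntidiagonal.mem_antidiagonal] at hab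
    rw [hE a (by omega)]
  have hR : coeff K (Λ (expS A * Y) * expS T) =
      coeff K (Λ ((∑ n ∈ range (K + 1), ((n.factorial : ℂ))⁻¹ • A ^ n) * Y) *
        (∑ n ∈ range (K + 1), ((n.factorial : ℂ))⁻¹ • T ^ n)) := by
    rw [coeff_mul, coeff_mul]
    apply Finset.sum_congr rfl
    rintro ⟨a, b⟩ hab
    simp only [Finset.HasAntidiagonal.mem_antidiagonal] at hab
    rw [hE b (by omega), hΛ', hΛ', hAY a (by omega)]
  rw [hL, hR, Finset.sum_mul, Finset.sum_mul, map_sum Λ, Finset.sum_mul]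
  simp only [smul_mul_assoc, hpow, Finset.mul_sum, map_smul]
  -- The Cauchy products run over the triangle `a + b ≤ K`, the product of partial sums over a
  -- square. The extra terms vanish in degree `K`, since `A ^ a` and `T ^ b` start in degrees `a`
  -- and `b`.
  have hv := sum_range_antidiagonal_of_vanish (fun a b => coeff K ((((a.factorial : ℂ))⁻¹ •
    Λ (A ^ a * Y)) * (((b.factorial : ℂ))⁻¹ • T ^ b))) (K + 1) ?_
  · simp only [smul_mul_assoc] at hv
    simp only [map_sum]
    rw [hv, Finset.sum_comm]
  · intro a b hab
    rw [smul_mul_smul_comm, coeff_smul_complex, coeff_mul, Finset.sum_eq_zero, smul_zero]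
    rintro ⟨i, j⟩ hij
    simp only [Finset.HasAntidiagonal.mem_antidiagonal] at hij
    rcases lt_or_ge j b with hj | hj
    · simp only [coeff_pow_of_lt hT hj, mul_zero]
    · have : coeff i (A ^ a * Y) = 0 := by
        rw [coeff_mul, Finset.sum_eq_zero]
        rintro ⟨p, q⟩ hpq
        simp only [Finset.HasAntidiagonal.mem_antidiagonal] at hpq
        rw [coeff_pow_of_lt hA (by omega), zero_mul]
      simp only [hΛ', this, map_zero, zero_mul]

end SeriesCalculus

/-! ### Quadratic differential operators on formal power series -/

section QuadraticOperators

open MvPowerSeries Finset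

variable {ι K : Type*} [CommRing K]

/-- Multiplication by a variable. -/
def mulX (i : ι) : Module.End K (MvPowerSeries ι K) := LinearMap.mulLeft K (X i)

/-- Partial derivative. -/
def derX (i : ι) : Module.End K (MvPowerSeries ι K) :=
  (pderiv K i : MvPowerSeries ι K →ₗ[K] MvPowerSeries ι K)

theorem mulX_apply (i : ι) (F : MvPowerSeries ι K) : mulX i F = X i * F := rfl

theorem derX_apply (i : ι) (F : MvPowerSeries ι K) : derX i F = pderiv K i F := rfl

theorem coeff_mulX [DecidableEq ι] (i : ι) (F : MvPowerSeries ι K) (m : ι →₀ ℕ) :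
    coeff m (mulX i F) =
      if Finsupp.single i 1 ≤ m then coeff (m - Finsupp.single i 1) F else 0 := by
  rw [mulX_apply, X_def, coeff_monomial_mul]
  simp only [one_mul]

theorem coeff_derX (i : ι) (F : MvPowerSeries ι K) (m : ι →₀ ℕ) :
    coeff m (derX i F) = coeff (m + Finsupp.single i 1) F * (m i + 1) := by
  rw [derX_apply, coeff_pderiv]

theorem mulX_mul_mulX (i j : ι) : (mulX i * mulX j : Module.End K (MvPowerSeries ι K)) =
    mulX j * mulX i := by
  ext1 F
  simp only [Module.End.mul_apply, mulX_apply]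
  ring

theorem derX_mul_mulX [DecidableEq ι] (i j : ι) :
    (derX i * mulX j : Module.End K (MvPowerSeries ι K)) =
    mulX j * derX i + if i = j then 1 else 0 := by
  ext1 F
  simp only [Module.End.mul_apply, mulX_apply, derX_apply, LinearMap.add_apply, Derivation.leibniz,
    smul_eq_mul]
  split_ifs with h
  · subst h
    simp
  · rw [pderiv_X_of_ne (Ne.symm h)]
    simp

theorem derX_mul_derX (i j : ι) : (derX i * derX j : Module.End K (MvPowerSeries ι K)) =
    derX j * derX i := by
  classical
  refine LinearMap.ext fun F => MvPowerSeries.ext fun m => ?_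
  simp only [Module.End.mul_apply, coeff_derX, Finsupp.add_apply]
  rw [add_right_comm]
  by_cases h : i = j
  · subst h; rfl
  · simp only [Finsupp.single_eq_of_ne h, Finsupp.single_eq_of_ne (Ne.symm h), add_zero]
    ring

/-- The operator `∑ a_ij x_i x_j + ∑ b_ij x_i ∂_j + ∑ c_ij ∂_i ∂_j`, the sums being taken
coefficientwise. -/
def quad (a b c : ι → ι → K) (F : MvPowerSeries ι K) : MvPowerSeries ι K := fun m =>
  (∑ᶠ ij : ι × ι, a ij.1 ij.2 * coeff m (X ij.1 * X ij.2 * F)) +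
  (∑ᶠ ij : ι × ι, b ij.1 ij.2 * coeff m (X ij.1 * pderiv K ij.2 F)) +
  (∑ᶠ ij : ι × ι, c ij.1 ij.2 * coeff m (pderiv K ij.1 (pderiv K ij.2 F)))

/-- The part of a quadratic operator that involves only the indices in `s`. -/
def quadFin (s : Finset ι) (a b c : ι → ι → K) : Module.End K (MvPowerSeries ι K) :=
  ∑ i ∈ s, ∑ j ∈ s, (a i j • (mulX i * mulX j) + b i j • (mulX i * derX j) +
    c i j • (derX i * derX j))

theorem coeff_quadFin (s : Finset ι) (a b c : ι → ι → K) (F : MvPowerSeries ι K) (m : ι →₀ ℕ) :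
    coeff m (quadFin s a b c F) =
      (∑ ij ∈ s ×ˢ s, a ij.1 ij.2 * coeff m (X ij.1 * X ij.2 * F)) +
      (∑ ij ∈ s ×ˢ s, b ij.1 ij.2 * coeff m (X ij.1 * pderiv K ij.2 F)) +
      (∑ ij ∈ s ×ˢ s, c ij.1 ij.2 * coeff m (pderiv K ij.1 (pderiv K ij.2 F))) := by
  rw [← Finset.sum_add_distrib, ← Finset.sum_add_distrib, Finset.sum_product, quadFin]
  simp only [LinearMap.sum_apply, map_sum, LinearMap.add_apply, LinearMap.smul_apply, map_add,
    Module.End.mul_apply, mulX_apply, derX_apply, mul_assoc]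
  rfl

theorem coeff_X_mul_eq_zero {i : ι} {m : ι →₀ ℕ} (h : i ∉ m.support) (F : MvPowerSeries ι K) :
    coeff m (X i * F) = 0 := by
  classical
  rw [← mulX_apply, coeff_mulX, if_neg]
  intro hle
  apply h
  have := hle i
  rw [Finsupp.single_eq_same] at this
  rw [Finsupp.mem_support_iff]
  omega

theorem finite_support_quad₁ (a : ι → ι → K) (F : MvPowerSeries ι K) (m : ι →₀ ℕ) :
    (Function.support fun ij : ι × ι => a ij.1 ij.2 * coeff m (X ij.1 * X ij.2 * F)).Finite := by
  apply (m.support ×ˢ m.support).finite_toSet.subset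
  rintro ⟨i, j⟩ h
  rw [Function.mem_support] at h
  rw [Finset.coe_product]
  refine ⟨?_, ?_⟩
  · by_contra hi
    exact h (by rw [mul_assoc, coeff_X_mul_eq_zero hi, mul_zero])
  · by_contra hi
    exact h (by rw [mul_comm (X _), mul_assoc, coeff_X_mul_eq_zero hi, mul_zero])

theorem finite_support_quad₂ {b : ι → ι → K} (hb : ∀ i, {j | b i j ≠ 0}.Finite)
    (F : MvPowerSeries ι K) (m : ι →₀ ℕ) :
    (Function.support fun ij : ι × ι => b ij.1 ij.2 * coeff m (X ij.1 * pderiv K ij.2 F)).Finite := by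
  classical
  apply (m.support.biUnion fun i => (hb i).toFinset.image fun j => (i, j)).finite_toSet.subset
  rintro ⟨i, j⟩ h
  rw [Function.mem_support] at h
  simp only [coe_biUnion, mem_coe, coe_image, Set.Finite.coe_toFinset, Set.mem_iUnion]
  refine ⟨i, ?_, j, ?_, rfl⟩
  · by_contra hi
    exact h (by rw [coeff_X_mul_eq_zero hi, mul_zero])
  · intro h0
    exact h (by simp only [h0, zero_mul])

theorem finite_support_quad₃ {c : ι → ι → K} (hc : {p : ι × ι | c p.1 p.2 ≠ 0}.Finite)
    (F : MvPowerSeries ι K) (m : ι →₀ ℕ) :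
    (Function.support fun ij : ι × ι =>
      c ij.1 ij.2 * coeff m (pderiv K ij.1 (pderiv K ij.2 F))).Finite := by
  apply hc.subset
  intro p h h0
  exact h (by simp only [h0, zero_mul])

open Filter in
theorem finsum_eventually_eq {M : Type*} [AddCommMonoid M] {f : ι × ι → M}
    (hf : (Function.support f).Finite) :
    ∀ᶠ s : Finset ι in atTop, ∑ᶠ ij, f ij = ∑ ij ∈ s ×ˢ s, f ij := by
  classical
  filter_upwards [eventually_ge_atTop (hf.toFinset.image Prod.fst ∪ hf.toFinset.image Prod.snd)]
    with s hs
  apply finsum_eq_sum_of_support_subset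
  rintro ⟨i, j⟩ h
  rw [Finset.coe_product]
  refine ⟨hs ?_, hs ?_⟩
  · exact Finset.mem_union_left _ (Finset.mem_image.2 ⟨(i, j), by simpa using h, rfl⟩)
  · exact Finset.mem_union_right _ (Finset.mem_image.2 ⟨(i, j), by simpa using h, rfl⟩)

open Filter in
-- A monomial `m` lets through only finitely many index pairs: a factor `X i` needs `i` in the
-- support of `m`, and the hypotheses on `b` and `c` bound the derivatives. Operator identities are
-- thereby reduced to the finite sums `quadFin`.
theorem coeff_quad_eventually_eq (a : ι → ι → K) {b c : ι → ι → K}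
    (hb : ∀ i, {j | b i j ≠ 0}.Finite) (hc : {p : ι × ι | c p.1 p.2 ≠ 0}.Finite)
    (F : MvPowerSeries ι K) (m : ι →₀ ℕ) :
    ∀ᶠ s : Finset ι in atTop, coeff m (quad a b c F) = coeff m (quadFin s a b c F) := by
  filter_upwards [finsum_eventually_eq (finite_support_quad₁ a F m),
    finsum_eventually_eq (finite_support_quad₂ hb F m),
    finsum_eventually_eq (finite_support_quad₃ hc F m)] with s h1 h2 h3
  rw [coeff_quadFin, ← h1, ← h2, ← h3]
  rfl

/-- A quadratic operator with locally finite coefficients, as a linear map. -/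
def quadEnd (a b c : ι → ι → K)
    (hb : ∀ i, {j | b i j ≠ 0}.Finite) (hc : {p : ι × ι | c p.1 p.2 ≠ 0}.Finite) :
    Module.End K (MvPowerSeries ι K) where
  toFun := quad a b c
  map_add' F F' := by
    refine MvPowerSeries.ext fun m => ?_
    obtain ⟨s, h1, h2, h3⟩ := ((coeff_quad_eventually_eq a hb hc (F + F') m).and
      ((coeff_quad_eventually_eq a hb hc F m).and (coeff_quad_eventually_eq a hb hc F' m))).exists
    rw [map_add, h1, h2, h3, map_add, map_add]
  map_smul' r F := by
    refine MvPowerSeries.ext fun m => ?_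
    obtain ⟨s, h1, h2⟩ := ((coeff_quad_eventually_eq a hb hc (r • F) m).and
      (coeff_quad_eventually_eq a hb hc F m)).exists
    rw [RingHom.id_apply, map_smul, h1, h2, map_smul, map_smul]

theorem quadFin_mul_mulX [DecidableEq ι] (s : Finset ι) (a b c : ι → ι → K) {l : ι} (hl : l ∈ s) :
    quadFin s a b c * mulX l = mulX l * quadFin s a b c + ∑ i ∈ s, b i l • mulX i +
      ∑ j ∈ s, (c l j + c j l) • derX j := by
  have h : ∀ i j : ι, (a i j • (mulX i * mulX j) + b i j • (mulX i * derX j) +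
      c i j • (derX i * derX j)) * mulX l = mulX l * (a i j • (mulX i * mulX j) +
      b i j • (mulX i * derX j) + c i j • (derX i * derX j)) +
      ((if j = l then b i j • mulX i else 0) + ((if i = l then c i j • derX j else 0) +
        (if j = l then c i j • derX i else 0)) : Module.End K (MvPowerSeries ι K)) := by
    intro i j
    have e1 : (mulX i * mulX j * mulX l : Module.End K (MvPowerSeries ι K)) =
        mulX l * (mulX i * mulX j) := by
      rw [mul_assoc, mulX_mul_mulX j l, ← mul_assoc, mulX_mul_mulX i l, mul_assoc]
    have e2 : (mulX i * derX j * mulX l : Module.End K (MvPowerSeries ι K)) =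
        mulX l * (mulX i * derX j) + if j = l then mulX i else 0 := by
      rw [mul_assoc, derX_mul_mulX, mul_add, ← mul_assoc, mulX_mul_mulX i l, mul_assoc]
      split_ifs <;> simp
    have e3 : (derX i * derX j * mulX l : Module.End K (MvPowerSeries ι K)) =
        mulX l * (derX i * derX j) + ((if i = l then derX j else 0) +
          if j = l then derX i else 0) := by
      rw [mul_assoc, derX_mul_mulX, mul_add, ← mul_assoc, derX_mul_mulX, add_mul, mul_assoc]
      split_ifs <;> simp [add_assoc]
    rw [add_mul, add_mul, smul_mul_assoc, smul_mul_assoc, smul_mul_assoc, e1, e2, e3, mul_add,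
      mul_add, mul_smul_comm, mul_smul_comm, mul_smul_comm]
    simp only [smul_add, smul_ite, smul_zero]
    abel
  rw [quadFin, Finset.sum_mul, Finset.mul_sum]
  simp only [Finset.sum_mul, Finset.mul_sum]
  simp only [h]
  simp only [Finset.sum_add_distrib]
  have e1 : ∑ i ∈ s, ∑ j ∈ s, (if j = l then b i j • mulX i else 0) =
      (∑ i ∈ s, b i l • mulX i : Module.End K (MvPowerSeries ι K)) := by
    refine Finset.sum_congr rfl fun i _ => ?_
    rw [Finset.sum_ite_eq' s l, if_pos hl]
  have e2 : ∑ i ∈ s, ∑ j ∈ s, (if i = l then c i j • derX j else 0) =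
      (∑ j ∈ s, c l j • derX j : Module.End K (MvPowerSeries ι K)) := by
    rw [Finset.sum_comm]
    refine Finset.sum_congr rfl fun i _ => ?_
    rw [Finset.sum_ite_eq' s l, if_pos hl]
  have e3 : ∑ i ∈ s, ∑ j ∈ s, (if j = l then c i j • derX i else 0) =
      (∑ j ∈ s, c j l • derX j : Module.End K (MvPowerSeries ι K)) := by
    refine Finset.sum_congr rfl fun i _ => ?_
    rw [Finset.sum_ite_eq' s l, if_pos hl]
  rw [e1, e2, e3]
  simp only [add_smul, Finset.sum_add_distrib]
  abel

theorem quadFin_mul_derX [DecidableEq ι] (s : Finset ι) (a b c : ι → ι → K) {l : ι} (hl : l ∈ s) :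
    quadFin s a b c * derX l + ∑ j ∈ s, (a l j + a j l) • mulX j + ∑ j ∈ s, b l j • derX j =
      derX l * quadFin s a b c := by
  have h : ∀ i j : ι, derX l * (a i j • (mulX i * mulX j) + b i j • (mulX i * derX j) +
      c i j • (derX i * derX j)) = (a i j • (mulX i * mulX j) +
      b i j • (mulX i * derX j) + c i j • (derX i * derX j)) * derX l +
      (((if i = l then a i j • mulX j else 0) + (if j = l then a i j • mulX i else 0)) +
        (if i = l then b i j • derX j else 0) : Module.End K (MvPowerSeries ι K)) := by
    intro i j
    have e1 : (derX l * (mulX i * mulX j) : Module.End K (MvPowerSeries ι K)) =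
        mulX i * mulX j * derX l + ((if i = l then mulX j else 0) +
          if j = l then mulX i else 0) := by
      rw [← mul_assoc, derX_mul_mulX, add_mul, mul_assoc, derX_mul_mulX, mul_add, mul_assoc]
      simp only [eq_comm (a := l)]
      split_ifs <;>
        (simp only [mul_one, one_mul, zero_mul, mul_zero, add_zero, zero_add, ← mul_assoc]; try abel)
    have e2 : (derX l * (mulX i * derX j) : Module.End K (MvPowerSeries ι K)) =
        mulX i * derX j * derX l + if i = l then derX j else 0 := by
      rw [← mul_assoc, derX_mul_mulX, add_mul, mul_assoc, derX_mul_derX l j, mul_assoc]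
      simp only [eq_comm (a := l)]
      split_ifs <;> simp
    have e3 : (derX l * (derX i * derX j) : Module.End K (MvPowerSeries ι K)) =
        derX i * derX j * derX l := by
      rw [← mul_assoc, derX_mul_derX l i, mul_assoc, derX_mul_derX l j, mul_assoc]
    rw [add_mul, add_mul, smul_mul_assoc, smul_mul_assoc, smul_mul_assoc, mul_add,
      mul_add, mul_smul_comm, mul_smul_comm, mul_smul_comm, e1, e2, e3]
    simp only [smul_add, smul_ite, smul_zero]
    abel
  rw [quadFin, Finset.sum_mul, Finset.mul_sum]
  simp only [Finset.sum_mul, Finset.mul_sum]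
  simp only [h]
  simp only [Finset.sum_add_distrib]
  have e1 : ∑ i ∈ s, ∑ j ∈ s, (if i = l then a i j • mulX j else 0) =
      (∑ j ∈ s, a l j • mulX j : Module.End K (MvPowerSeries ι K)) := by
    rw [Finset.sum_comm]
    refine Finset.sum_congr rfl fun i _ => ?_
    rw [Finset.sum_ite_eq' s l, if_pos hl]
  have e2 : ∑ i ∈ s, ∑ j ∈ s, (if j = l then a i j • mulX i else 0) =
      (∑ j ∈ s, a j l • mulX j : Module.End K (MvPowerSeries ι K)) := by
    refine Finset.sum_congr rfl fun i _ => ?_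
    rw [Finset.sum_ite_eq' s l, if_pos hl]
  have e3 : ∑ i ∈ s, ∑ j ∈ s, (if i = l then b i j • derX j else 0) =
      (∑ j ∈ s, b l j • derX j : Module.End K (MvPowerSeries ι K)) := by
    rw [Finset.sum_comm]
    refine Finset.sum_congr rfl fun i _ => ?_
    rw [Finset.sum_ite_eq' s l, if_pos hl]
  rw [e1, e2, e3]
  simp only [add_smul, Finset.sum_add_distrib]
  abel

open Filter in
-- The commutator with a variable is of first order and involves only the row and column of `l`; `T`
-- is any finite set that contains them. It is computed for `quadFin` with `s` large enough for the
-- coefficient under consideration.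
theorem quadEnd_mul_mulX (a b c : ι → ι → K)
    (hb : ∀ i, {j | b i j ≠ 0}.Finite) (hc : {p : ι × ι | c p.1 p.2 ≠ 0}.Finite) (l : ι)
    (T : Finset ι) (hT : ∀ i, b i l ≠ 0 ∨ c l i + c i l ≠ 0 → i ∈ T) :
    quadEnd a b c hb hc * mulX l = mulX l * quadEnd a b c hb hc + ∑ i ∈ T, b i l • mulX i +
      ∑ j ∈ T, (c l j + c j l) • derX j := by
  classical
  refine LinearMap.ext fun F => MvPowerSeries.ext fun m => ?_
  have h0 : ∀ᶠ s : Finset ι in atTop, coeff m (mulX l (quad a b c F)) =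
      coeff m (mulX l (quadFin s a b c F)) := by
    filter_upwards [coeff_quad_eventually_eq a hb hc F (m - Finsupp.single l 1)] with s hs
    rw [coeff_mulX, coeff_mulX, hs]
  obtain ⟨s, h1, h2, h3⟩ := ((coeff_quad_eventually_eq a hb hc (mulX l F) m).and
    (h0.and (eventually_ge_atTop (insert l T)))).exists
  have hs := congrArg (fun W => coeff m (W F))
    (quadFin_mul_mulX s a b c (h3 (Finset.mem_insert_self l T)))
  have hTs : T ⊆ s := (Finset.subset_insert l T).trans h3
  have e1 : (∑ i ∈ s, b i l • mulX i : Module.End K (MvPowerSeries ι K)) =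
      ∑ i ∈ T, b i l • mulX i := by
    symm
    refine Finset.sum_subset hTs fun i _ hi => ?_
    rw [show b i l = 0 by by_contra h; exact hi (hT i (Or.inl h)), zero_smul]
  have e2 : (∑ j ∈ s, (c l j + c j l) • derX j : Module.End K (MvPowerSeries ι K)) =
      ∑ j ∈ T, (c l j + c j l) • derX j := by
    symm
    refine Finset.sum_subset hTs fun i _ hi => ?_
    rw [show c l i + c i l = 0 by by_contra h; exact hi (hT i (Or.inr h)), zero_smul]
  rw [e1, e2] at hs
  simp only [LinearMap.add_apply, Module.End.mul_apply, map_add] at hs ⊢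
  change coeff m (quad a b c (mulX l F)) = coeff m (mulX l (quad a b c F)) + _ + _
  rw [h1, h2, hs]

open Filter in
theorem quadEnd_mul_derX (a b c : ι → ι → K)
    (hb : ∀ i, {j | b i j ≠ 0}.Finite) (hc : {p : ι × ι | c p.1 p.2 ≠ 0}.Finite) (l : ι)
    (T : Finset ι) (hT : ∀ i, b l i ≠ 0 ∨ a l i + a i l ≠ 0 → i ∈ T) :
    quadEnd a b c hb hc * derX l + ∑ j ∈ T, (a l j + a j l) • mulX j + ∑ j ∈ T, b l j • derX j =
      derX l * quadEnd a b c hb hc := by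
  classical
  refine LinearMap.ext fun F => MvPowerSeries.ext fun m => ?_
  have h0 : ∀ᶠ s : Finset ι in atTop, coeff m (derX l (quad a b c F)) =
      coeff m (derX l (quadFin s a b c F)) := by
    filter_upwards [coeff_quad_eventually_eq a hb hc F (m + Finsupp.single l 1)] with s hs
    rw [coeff_derX, coeff_derX, hs]
  obtain ⟨s, h1, h2, h3⟩ := ((coeff_quad_eventually_eq a hb hc (derX l F) m).and
    (h0.and (eventually_ge_atTop (insert l T)))).exists
  have hs := congrArg (fun W => coeff m (W F))
    (quadFin_mul_derX s a b c (h3 (Finset.mem_insert_self l T)))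
  have hTs : T ⊆ s := (Finset.subset_insert l T).trans h3
  have e1 : (∑ j ∈ s, b l j • derX j : Module.End K (MvPowerSeries ι K)) =
      ∑ j ∈ T, b l j • derX j := by
    symm
    refine Finset.sum_subset hTs fun i _ hi => ?_
    rw [show b l i = 0 by by_contra h; exact hi (hT i (Or.inl h)), zero_smul]
  have e2 : (∑ j ∈ s, (a l j + a j l) • mulX j : Module.End K (MvPowerSeries ι K)) =
      ∑ j ∈ T, (a l j + a j l) • mulX j := by
    symm
    refine Finset.sum_subset hTs fun i _ hi => ?_
    rw [show a l i + a i l = 0 by by_contra h; exact hi (hT i (Or.inr h)), zero_smul]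
  rw [e1, e2] at hs
  simp only [LinearMap.add_apply, Module.End.mul_apply, map_add] at hs ⊢
  change coeff m (quad a b c (derX l F)) + _ + _ = coeff m (derX l (quad a b c F))
  rw [h1, h2, ← hs]

theorem isUnit_natCast_add_one [Algebra ℂ K] (n : ℕ) : IsUnit ((n : K) + 1) := by
  have h : IsUnit (algebraMap ℂ K ((n : ℂ) + 1)) := by
    apply IsUnit.map
    rw [isUnit_iff_ne_zero]
    exact_mod_cast Nat.succ_ne_zero n
  simpa using h

/-- An operator commuting with multiplications and derivatives acts on polynomials as a scalar. -/
theorem apply_coe_of_commute [Algebra ℂ K] {W : Module.End K (MvPowerSeries ι K)}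
    (hX : ∀ i, W * mulX i = mulX i * W) (hD : ∀ i, W * derX i = derX i * W)
    (P : MvPolynomial ι K) :
    W (P : MvPowerSeries ι K) = C (coeff 0 (W 1)) * (P : MvPowerSeries ι K) := by
  classical
  have h1 : W 1 = C (coeff 0 (W 1)) := by
    refine MvPowerSeries.ext fun m => ?_
    rw [coeff_C]
    split_ifs with hm
    · rw [hm]
    · obtain ⟨i, hi⟩ := Finsupp.ne_iff.1 hm
      -- Since `∂_i (W 1) = W (∂_i 1) = 0` and positive integers are invertible, `W 1` has no
      -- coefficient divisible by `X i`.
      have h := congrArg (fun V => coeff (m - Finsupp.single i 1) (V 1)) (hD i)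
      simp only [Module.End.mul_apply] at h
      have h2 : (derX i : Module.End K (MvPowerSeries ι K)) 1 = 0 := by
        rw [derX_apply, pderiv_one]
      have hle : Finsupp.single i 1 ≤ m := by
        rw [Finsupp.single_le_iff]
        exact Nat.one_le_iff_ne_zero.2 hi
      rw [h2, map_zero, map_zero, coeff_derX, tsub_add_cancel_of_le hle] at h
      have hu := isUnit_natCast_add_one (K := K) ((m - Finsupp.single i (1 : ℕ) : ι →₀ ℕ) i)
      exact (hu.mul_left_eq_zero.1 h.symm)
  induction P using MvPolynomial.induction_on with
  | C a =>
    rw [MvPolynomial.coe_C, mul_comm, ← MvPowerSeries.smul_eq_C_mul, ← h1, ← map_smul,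
      MvPowerSeries.smul_eq_C_mul, mul_one]
  | add p q hp hq => rw [MvPolynomial.coe_add, map_add, hp, hq, mul_add]
  | mul_X p i hp =>
    have h := congrArg (fun V => V (p : MvPowerSeries ι K)) (hX i)
    simp only [Module.End.mul_apply, mulX_apply] at h
    rw [MvPolynomial.coe_mul, MvPolynomial.coe_X, mul_comm, h, hp]
    ring

end QuadraticOperators

/-! ### Graded series of operators and their values on tame functions -/

section Graded

open Finset

variable {ι K : Type*} [CommRing K] (w : ι → ℤ)

/-- `W` is homogeneous of degree `-d` with respect to the weights `w`. -/
def HasShift (d : ℤ) (W : Module.End K (MvPowerSeries ι K)) : Prop :=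
  ∀ (F : MvPowerSeries ι K) (m : ι →₀ ℕ),
    (∀ m' : ι →₀ ℕ, Finsupp.weight w m' = Finsupp.weight w m + d → MvPowerSeries.coeff m' F = 0) →
      MvPowerSeries.coeff m (W F) = 0

variable {w}

theorem HasShift.mul {d d' : ℤ} {W W' : Module.End K (MvPowerSeries ι K)} (h : HasShift w d W)
    (h' : HasShift w d' W') : HasShift w (d + d') (W * W') := by
  intro F m hF
  refine h _ _ fun m' hm' => h' _ _ fun m'' hm'' => hF m'' ?_
  rw [hm'', hm', add_assoc]

theorem HasShift.zero (d : ℤ) : HasShift w d (0 : Module.End K (MvPowerSeries ι K)) := by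
  intro F m _
  simp

theorem HasShift.one : HasShift w 0 (1 : Module.End K (MvPowerSeries ι K)) := by
  intro F m h
  exact h m (by simp)

theorem HasShift.add {d : ℤ} {W W' : Module.End K (MvPowerSeries ι K)} (h : HasShift w d W)
    (h' : HasShift w d W') : HasShift w d (W + W') := by
  intro F m hF
  rw [LinearMap.add_apply, map_add, h F m hF, h' F m hF, add_zero]

theorem HasShift.neg {d : ℤ} {W : Module.End K (MvPowerSeries ι K)} (h : HasShift w d W) :
    HasShift w d (-W) := by
  intro F m hF
  rw [LinearMap.neg_apply, map_neg, h F m hF, neg_zero]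

theorem HasShift.sum {α : Type*} {d : ℤ} {s : Finset α} {W : α → Module.End K (MvPowerSeries ι K)}
    (h : ∀ i ∈ s, HasShift w d (W i)) : HasShift w d (∑ i ∈ s, W i) := by
  classical
  intro F m hF
  rw [LinearMap.sum_apply, map_sum]
  exact Finset.sum_eq_zero fun i hi => h i hi F m hF

theorem HasShift.smul {d : ℤ} (c : K) {W : Module.End K (MvPowerSeries ι K)} (h : HasShift w d W) :
    HasShift w d (c • W) := by
  intro F m hF
  rw [LinearMap.smul_apply, map_smul, h F m hF, smul_zero]

theorem hasShift_mulX (i : ι) : HasShift w (-w i) (mulX i : Module.End K (MvPowerSeries ι K)) := by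
  classical
  intro F m hF
  rw [coeff_mulX]
  split_ifs with h
  · apply hF
    have h2 := congrArg (Finsupp.weight w) (tsub_add_cancel_of_le h)
    rw [map_add, Finsupp.weight_single, one_smul] at h2
    omega
  · rfl

theorem hasShift_derX (i : ι) : HasShift w (w i) (derX i : Module.End K (MvPowerSeries ι K)) := by
  intro F m hF
  rw [coeff_derX, hF, zero_mul]
  rw [map_add, Finsupp.weight_single, one_smul]

theorem HasShift.quadEnd {a b c : ι → ι → K} {hb : ∀ i, {j | b i j ≠ 0}.Finite}
    {hc : {p : ι × ι | c p.1 p.2 ≠ 0}.Finite} {d : ℤ}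
    (h1 : ∀ i j, a i j ≠ 0 → -(w i + w j) = d) (h2 : ∀ i j, b i j ≠ 0 → w j - w i = d)
    (h3 : ∀ i j, c i j ≠ 0 → w i + w j = d) : HasShift w d (quadEnd a b c hb hc) := by
  classical
  intro F m hF
  obtain ⟨s, hs⟩ := (coeff_quad_eventually_eq a hb hc F m).exists
  change MvPowerSeries.coeff m (quad a b c F) = 0
  rw [hs]
  refine HasShift.sum (w := w) (d := d) (fun i _ => HasShift.sum fun j _ => ?_) F m hF
  refine (HasShift.add ?_ ?_).add ?_
  · by_cases h : a i j = 0
    · rw [h, zero_smul]; exact .zero d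
    · rw [← h1 i j h, neg_add]
      exact ((hasShift_mulX i).mul (hasShift_mulX j)).smul _
  · by_cases h : b i j = 0
    · rw [h, zero_smul]; exact .zero d
    · rw [← h2 i j h, sub_eq_neg_add]
      exact ((hasShift_mulX i).mul (hasShift_derX j)).smul _
  · by_cases h : c i j = 0
    · rw [h, zero_smul]; exact .zero d
    · rw [← h3 i j h]
      exact ((hasShift_derX i).mul (hasShift_derX j)).smul _

variable (w)

/-- The `n`-th coefficient of `W` shifts the weight by `2 σ n + c`. -/
def IsGraded (σ c : ℤ) (W : PowerSeries (Module.End K (MvPowerSeries ι K))) : Prop :=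
  ∀ n : ℕ, HasShift w (2 * σ * n + c) (PowerSeries.coeff n W)

/-- The weights in `F` are bounded in the direction of `σ`. -/
def IsTame (σ : ℤ) (F : MvPowerSeries ι K) : Prop :=
  ∃ B : ℤ, ∀ m : ι →₀ ℕ, B ≤ σ * Finsupp.weight w m → MvPowerSeries.coeff m F = 0

variable {w}

theorem IsGraded.mul {σ c c' : ℤ} {W W' : PowerSeries (Module.End K (MvPowerSeries ι K))}
    (h : IsGraded w σ c W) (h' : IsGraded w σ c' W') : IsGraded w σ (c + c') (W * W') := by
  intro n
  rw [PowerSeries.coeff_mul]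
  refine HasShift.sum fun p hp => ?_
  rw [Finset.HasAntidiagonal.mem_antidiagonal] at hp
  have := (h p.1).mul (h' p.2)
  rwa [show 2 * σ * p.1 + c + (2 * σ * p.2 + c') = 2 * σ * n + (c + c') by
    rw [← hp]; push_cast; ring] at this

theorem IsGraded.add {σ c : ℤ} {W W' : PowerSeries (Module.End K (MvPowerSeries ι K))}
    (h : IsGraded w σ c W) (h' : IsGraded w σ c W') : IsGraded w σ c (W + W') := by
  intro n
  rw [map_add]
  exact (h n).add (h' n)

theorem IsGraded.neg {σ c : ℤ} {W : PowerSeries (Module.End K (MvPowerSeries ι K))}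
    (h : IsGraded w σ c W) : IsGraded w σ c (-W) := by
  intro n
  rw [map_neg]
  exact (h n).neg

theorem IsGraded.one (σ : ℤ) :
    IsGraded w σ 0 (1 : PowerSeries (Module.End K (MvPowerSeries ι K))) := by
  classical
  intro n
  rw [PowerSeries.coeff_one]
  split_ifs with h
  · rw [h]; simpa using HasShift.one
  · exact .zero _

theorem IsGraded.pow {σ : ℤ} {W : PowerSeries (Module.End K (MvPowerSeries ι K))}
    (h : IsGraded w σ 0 W) (n : ℕ) : IsGraded w σ 0 (W ^ n) := by
  induction n with
  | zero => rw [pow_zero]; exact .one σ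
  | succ n ih => rw [pow_succ]; simpa using ih.mul h

theorem HasShift.smul_complex [Algebra ℂ K] {d : ℤ} (c : ℂ)
    {W : Module.End K (MvPowerSeries ι K)} (h : HasShift w d W) : HasShift w d (c • W) := by
  rw [← algebraMap_smul K c W]
  exact h.smul _

theorem IsGraded.expS [Algebra ℂ K] {σ : ℤ} {W : PowerSeries (Module.End K (MvPowerSeries ι K))}
    (h : IsGraded w σ 0 W) : IsGraded w σ 0 (expS W) := by
  intro n
  rw [ADEVirasoro.expS, evS, PowerSeries.coeff_mk]
  exact HasShift.sum fun i _ => (h.pow i n).smul_complex _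

theorem weight_nonneg (hw : ∀ i, 0 ≤ w i) (m : ι →₀ ℕ) : 0 ≤ Finsupp.weight w m := by
  rw [Finsupp.weight_apply]
  exact Finset.sum_nonneg fun i _ => nsmul_nonneg (hw i) _

/-- For `σ = -1` tameness is a lower bound on weights, automatic for nonnegative weights: this is
why series in `z⁻¹` act on all formal power series. -/
theorem isTame_neg_one (hw : ∀ i, 0 ≤ w i) (F : MvPowerSeries ι K) : IsTame w (-1) F :=
  ⟨1, fun m hm => by have := weight_nonneg hw m; omega⟩

theorem isTame_coe (σ : ℤ) (P : MvPolynomial ι K) : IsTame w σ (P : MvPowerSeries ι K) := by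
  obtain ⟨B, hB⟩ := (P.support.image fun m => σ * Finsupp.weight w m).bddAbove
  refine ⟨B + 1, fun m hm => ?_⟩
  rw [MvPolynomial.coeff_coe]
  by_contra h
  have := hB (Finset.mem_coe.2 (Finset.mem_image.2 ⟨m, MvPolynomial.mem_support_iff.2 h, rfl⟩))
  omega

/-- The value of a series of operators at `1`, applied to `F`. -/
def evalOne (W : PowerSeries (Module.End K (MvPowerSeries ι K))) (F : MvPowerSeries ι K) :
    MvPowerSeries ι K :=
  fun m => ∑ᶠ n : ℕ, MvPowerSeries.coeff m (PowerSeries.coeff n W F)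

theorem IsGraded.coeff_eq_zero {σ c : ℤ} (hσ : σ * σ = 1)
    {W : PowerSeries (Module.End K (MvPowerSeries ι K))} (hW : IsGraded w σ c W)
    {F : MvPowerSeries ι K} {B : ℤ}
    (hB : ∀ m : ι →₀ ℕ, B ≤ σ * Finsupp.weight w m → MvPowerSeries.coeff m F = 0)
    {m : ι →₀ ℕ} {n : ℕ} (h : B ≤ σ * Finsupp.weight w m + 2 * n + σ * c) :
    MvPowerSeries.coeff m (PowerSeries.coeff n W F) = 0 := by
  refine hW n F m fun m' hm' => hB m' ?_
  rw [hm']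
  have : σ * (Finsupp.weight w m + (2 * σ * n + c)) =
    σ * Finsupp.weight w m + 2 * (σ * σ) * n + σ * c := by ring
  rw [this, hσ]
  linarith

/-- The `k`-th term reads `F` in a weight displaced by `2σk + c`; for `k ≥ n` this lies beyond the
bound `B`, so the sum defining `evalOne` is finite. -/
theorem IsGraded.coeff_evalOne {σ c : ℤ} (hσ : σ * σ = 1)
    {W : PowerSeries (Module.End K (MvPowerSeries ι K))} (hW : IsGraded w σ c W)
    {F : MvPowerSeries ι K} {B : ℤ}
    (hB : ∀ m : ι →₀ ℕ, B ≤ σ * Finsupp.weight w m → MvPowerSeries.coeff m F = 0)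
    {m : ι →₀ ℕ} {n : ℕ} (h : B ≤ σ * Finsupp.weight w m + 2 * n + σ * c) :
    MvPowerSeries.coeff m (evalOne W F) =
      ∑ k ∈ range n, MvPowerSeries.coeff m (PowerSeries.coeff k W F) := by
  change ∑ᶠ n : ℕ, MvPowerSeries.coeff m (PowerSeries.coeff n W F) = _
  apply finsum_eq_sum_of_support_subset
  intro k hk
  rw [Function.mem_support] at hk
  simp only [coe_range, Set.mem_Iio]
  by_contra hcon
  push Not at hcon
  exact hk (hW.coeff_eq_zero hσ hB (h.trans (by have : (n : ℤ) ≤ k := by exact_mod_cast hcon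
                                                linarith)))

theorem IsGraded.exists_coeff_evalOne {σ c : ℤ} (hσ : σ * σ = 1)
    {W : PowerSeries (Module.End K (MvPowerSeries ι K))} (hW : IsGraded w σ c W)
    {F : MvPowerSeries ι K} (hF : IsTame w σ F) (m : ι →₀ ℕ) :
    ∃ n₀ : ℕ, ∀ n, n₀ ≤ n → MvPowerSeries.coeff m (evalOne W F) =
      ∑ k ∈ range n, MvPowerSeries.coeff m (PowerSeries.coeff k W F) := by
  obtain ⟨B, hB⟩ := hF
  refine ⟨(B - σ * Finsupp.weight w m - σ * c).toNat, fun n hn => ?_⟩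
  apply hW.coeff_evalOne hσ hB
  omega

theorem IsTame.evalOne {σ c : ℤ} (hσ : σ * σ = 1)
    {W : PowerSeries (Module.End K (MvPowerSeries ι K))} (hW : IsGraded w σ c W)
    {F : MvPowerSeries ι K} (hF : IsTame w σ F) : IsTame w σ (evalOne W F) := by
  obtain ⟨B, hB⟩ := hF
  refine ⟨B - σ * c, fun m hm => ?_⟩
  rw [hW.coeff_evalOne hσ hB (n := 0) (by push_cast; linarith)]
  simp

/-- A fixed coefficient sees finitely many terms of the outer series, and each of these reads the
inner value in a single weight, where finitely many inner terms contribute. The double sum is thus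
finite and can be regrouped along antidiagonals. -/
theorem evalOne_mul {σ c c' : ℤ} (hσ : σ * σ = 1)
    {W W' : PowerSeries (Module.End K (MvPowerSeries ι K))}
    (hW : IsGraded w σ c W) (hW' : IsGraded w σ c' W') {F : MvPowerSeries ι K}
    (hF : IsTame w σ F) : ADEVirasoro.evalOne (W * W') F =
      ADEVirasoro.evalOne W (ADEVirasoro.evalOne W' F) := by
  refine MvPowerSeries.ext fun m => ?_
  obtain ⟨B, hB⟩ := hF
  obtain ⟨B', hB'⟩ := IsTame.evalOne hσ hW' ⟨B, hB⟩
  -- One cutoff serves three purposes: it bounds the product series, the outer series acting on the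
  -- inner value, and the inner series read after any outer term.
  set n : ℕ := (B - σ * Finsupp.weight w m - σ * (c + c')).toNat +
    (B' - σ * Finsupp.weight w m - σ * c).toNat with hn
  rw [(hW.mul hW').coeff_evalOne hσ hB (n := n) (by omega),
    hW.coeff_evalOne hσ hB' (n := n) (by omega)]
  have h1 : ∀ k ∈ range n, MvPowerSeries.coeff m (PowerSeries.coeff k W
      (ADEVirasoro.evalOne W' F)) = ∑ l ∈ range n,
        MvPowerSeries.coeff m (PowerSeries.coeff k W (PowerSeries.coeff l W' F)) := by
    intro k _
    rw [← map_sum, ← map_sum, ← sub_eq_zero, ← map_sub, ← map_sub]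
    refine hW k _ m fun m' hm' => ?_
    rw [map_sub, hW'.coeff_evalOne hσ hB (n := n), map_sum, sub_self]
    rw [hm']
    have : σ * (Finsupp.weight w m + (2 * σ * k + c)) =
      σ * Finsupp.weight w m + 2 * (σ * σ) * k + σ * c := by ring
    rw [this, hσ]
    have h3 : σ * (c + c') = σ * c + σ * c' := by ring
    omega
  rw [Finset.sum_congr rfl h1, ← sum_range_antidiagonal_of_vanish (fun k l =>
    MvPowerSeries.coeff m (PowerSeries.coeff k W (PowerSeries.coeff l W' F)))]
  · apply Finset.sum_congr rfl
    intro k _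
    rw [PowerSeries.coeff_mul, LinearMap.sum_apply, map_sum]
    rfl
  · intro k l hkl
    refine hW k _ m fun m' hm' => hW'.coeff_eq_zero hσ hB ?_
    rw [hm']
    have : σ * (Finsupp.weight w m + (2 * σ * k + c)) =
      σ * Finsupp.weight w m + 2 * (σ * σ) * k + σ * c := by ring
    rw [this, hσ]
    have h3 : σ * (c + c') = σ * c + σ * c' := by ring
    omega

theorem evalOne_one (F : MvPowerSeries ι K) : evalOne 1 F = F := by
  classical
  refine MvPowerSeries.ext fun m => ?_
  change ∑ᶠ n : ℕ, MvPowerSeries.coeff m (PowerSeries.coeff n (1 : PowerSeries (Module.End K (MvPowerSeries ι K))) F) = _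
  rw [finsum_eq_single _ 0]
  · simp
  · intro n hn
    rw [PowerSeries.coeff_one, if_neg hn]
    simp

theorem evalOne_add {σ c : ℤ} (hσ : σ * σ = 1)
    {W W' : PowerSeries (Module.End K (MvPowerSeries ι K))}
    (hW : IsGraded w σ c W) (hW' : IsGraded w σ c W') {F : MvPowerSeries ι K}
    (hF : IsTame w σ F) : evalOne (W + W') F = evalOne W F + evalOne W' F := by
  refine MvPowerSeries.ext fun m => ?_
  obtain ⟨B, hB⟩ := hF
  have h : B ≤ σ * Finsupp.weight w m + 2 * ((B - σ * Finsupp.weight w m - σ * c).toNat : ℕ) +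
    σ * c := by omega
  rw [map_add, hW.coeff_evalOne hσ hB h, hW'.coeff_evalOne hσ hB h,
    (hW.add hW').coeff_evalOne hσ hB h, ← Finset.sum_add_distrib]
  simp only [map_add, LinearMap.add_apply]

theorem evalOne_smul {σ c : ℤ} (hσ : σ * σ = 1)
    {W : PowerSeries (Module.End K (MvPowerSeries ι K))} (hW : IsGraded w σ c W)
    {F : MvPowerSeries ι K} (hF : IsTame w σ F) (a : K) :
    evalOne W (a • F) = a • evalOne W F := by
  refine MvPowerSeries.ext fun m => ?_
  obtain ⟨B, hB⟩ := hF
  have h : B ≤ σ * Finsupp.weight w m + 2 * ((B - σ * Finsupp.weight w m - σ * c).toNat : ℕ) +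
    σ * c := by omega
  have hB' : ∀ m : ι →₀ ℕ, B ≤ σ * Finsupp.weight w m → MvPowerSeries.coeff m (a • F) = 0 := by
    intro m hm
    rw [map_smul, hB m hm, smul_zero]
  rw [map_smul, hW.coeff_evalOne hσ hB h, hW.coeff_evalOne hσ hB' h, Finset.smul_sum]
  simp only [map_smul]

/-- The exponential of an operator, the sum being taken coefficientwise. -/
def opExp [Algebra ℂ K] (T : MvPowerSeries ι K → MvPowerSeries ι K) (F : MvPowerSeries ι K) :
    MvPowerSeries ι K :=
  fun m => ∑ᶠ n : ℕ, algebraMap ℂ K ((n.factorial : ℂ)⁻¹) * MvPowerSeries.coeff m (T^[n] F)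

/-- Iterates of `T` are values of the powers `W ^ n`. As `W` has no constant term, `W ^ n` starts in
degree `n`; for a given coefficient only finitely many `n` matter, and the `finsum` over `n` may be
exchanged with the one over degrees. -/
theorem opExp_eq_evalOne [Algebra ℂ K] {σ : ℤ} (hσ : σ * σ = 1)
    {W : PowerSeries (Module.End K (MvPowerSeries ι K))} (hW : IsGraded w σ 0 W)
    (h0 : PowerSeries.coeff 0 W = 0) {T : MvPowerSeries ι K → MvPowerSeries ι K}
    (hT : ∀ F, IsTame w σ F → T F = evalOne W F) {F : MvPowerSeries ι K} (hF : IsTame w σ F) :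
    opExp T F = evalOne (expS W) F := by
  have hpow : ∀ n, T^[n] F = evalOne (W ^ n) F := by
    intro n
    induction n with
    | zero => rw [Function.iterate_zero, id_eq, pow_zero, evalOne_one]
    | succ n ih =>
      rw [Function.iterate_succ_apply', ih, hT _ (IsTame.evalOne hσ (hW.pow n) hF), pow_succ',
        evalOne_mul hσ hW (hW.pow n) hF]
  obtain ⟨B, hB⟩ := hF
  refine MvPowerSeries.ext fun m => ?_
  set K₀ : ℕ := (B - σ * Finsupp.weight w m).toNat with hK₀
  rw [hW.expS.coeff_evalOne hσ hB (n := K₀) (by omega)]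
  change ∑ᶠ n : ℕ, algebraMap ℂ K ((n.factorial : ℂ)⁻¹) * MvPowerSeries.coeff m (T^[n] F) = _
  have h1 : ∀ n, MvPowerSeries.coeff m (T^[n] F) =
      ∑ k ∈ range K₀, MvPowerSeries.coeff m (PowerSeries.coeff k (W ^ n) F) := by
    intro n
    rw [hpow, (hW.pow n).coeff_evalOne hσ hB (n := K₀) (by omega)]
  rw [finsum_eq_sum_of_support_subset (s := range K₀)]
  · simp only [h1, Finset.mul_sum]
    rw [Finset.sum_comm]
    apply Finset.sum_congr rfl
    intro k hk
    rw [coeff_expS h0 (Finset.mem_range.1 hk), LinearMap.sum_apply, map_sum]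
    apply Finset.sum_congr rfl
    intro n _
    rw [← algebraMap_smul K ((n.factorial : ℂ)⁻¹), LinearMap.smul_apply, map_smul, smul_eq_mul]
  · intro n hn
    rw [Function.mem_support] at hn
    simp only [coe_range, Set.mem_Iio]
    by_contra hcon
    apply hn
    rw [h1, Finset.sum_eq_zero, mul_zero]
    intro k hk
    rw [Finset.mem_range] at hk
    rw [coeff_pow_of_lt h0 (by omega)]
    simp

end Graded

/-! ### Hamiltonians of homogeneous operators -/

section Hamiltonians

open Finset

variable {N : ℕ}

/-- The part of an operator that multiplies by `z ^ k`. -/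
def Op.part (A : Op N) (k : ℤ) : Op N := fun m n => if m = n + k then A m n else 0

/-- Infinitesimal symplecticity with respect to the form with Gram matrix `G`. -/
def IsInfSymplectic (G : Mat N) (A : Op N) : Prop :=
  ∀ p n : ℤ, (-1 : ℂ) ^ p • ((A p n).transpose * G) =
    -((-1 : ℂ) ^ n • (G * A (-1 - n) (-1 - p)))

theorem IsInfSymplectic.part {G : Mat N} {A : Op N} (h : IsInfSymplectic G A) (k : ℤ) :
    IsInfSymplectic G (A.part k) := by
  intro p n
  by_cases hp : p = n + k
  · simp only [Op.part]
    rw [if_pos hp, if_pos (by omega)]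
    exact h p n
  · simp only [Op.part]
    rw [if_neg hp, if_neg (by omega)]
    simp

theorem app_single (A : Op N) (n : ℤ) (v : Fin N → ℂ) (m : ℤ) :
    A.app (Pi.single n v) m = (A m n).mulVec v := by
  rw [Op.app, finsum_eq_single _ n]
  · rw [Pi.single_eq_same]
  · intro k hk
    rw [Pi.single_eq_of_ne hk, Matrix.mulVec_zero]

theorem app_part_single (A : Op N) (k n : ℤ) (v : Fin N → ℂ) :
    (A.part k).app (Pi.single n v) = Pi.single (n + k) ((A (n + k) n).mulVec v) := by
  funext m
  rw [app_single]
  by_cases h : m = n + k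
  · subst h
    rw [Pi.single_eq_same, Op.part, if_pos rfl]
  · rw [Pi.single_eq_of_ne h, Op.part, if_neg h, Matrix.zero_mulVec]

theorem symp_single (G : Mat N) (f : Loop N) (n : ℤ) (v : Fin N → ℂ) :
    symp G f (Pi.single n v) = (-1 : ℂ) ^ (-1 - n) * dotProduct (f (-1 - n)) (G.mulVec v) := by
  rw [symp, finsum_eq_single _ (-1 - n)]
  · rw [show -1 - (-1 - n) = n by ring, Pi.single_eq_same]
  · intro k hk
    rw [Pi.single_eq_of_ne (by omega), Matrix.mulVec_zero, dotProduct_zero, mul_zero]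

theorem symp_single_single (G : Mat N) (n n' : ℤ) (v v' : Fin N → ℂ) :
    symp G (Pi.single n v) (Pi.single n' v') =
      if n + n' = -1 then (-1 : ℂ) ^ n * dotProduct v (G.mulVec v') else 0 := by
  rw [symp_single]
  split_ifs with h
  · rw [show -1 - n' = n by omega, Pi.single_eq_same]
  · rw [Pi.single_eq_of_ne (by omega), zero_dotProduct, mul_zero]

/-- The definition of `ham` symmetrizes `Ω(A v, w)`. For infinitesimally symplectic `A` this form is
already symmetric, so the two summands coincide. -/
theorem two_mul_ham {G : Mat N} (hG : G.transpose = G) {A : Op N} (hA : IsInfSymplectic G A)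
    (n n' : ℤ) (v v' : Fin N → ℂ) : 2 * ham G A (Pi.single n v) (Pi.single n' v') =
      symp G (A.app (Pi.single n v)) (Pi.single n' v') := by
  have key : symp G (A.app (Pi.single n' v')) (Pi.single n v) =
      symp G (A.app (Pi.single n v)) (Pi.single n' v') := by
    rw [symp_single, symp_single, app_single, app_single]
    have h := hA (-1 - n') n
    rw [show -1 - (-1 - n') = n' by ring] at h
    have e1 : dotProduct ((A (-1 - n) n').mulVec v') (G.mulVec v) =
        dotProduct v ((G * A (-1 - n) n').mulVec v') := by
      rw [dotProduct_comm, ← Matrix.mulVec_mulVec, Matrix.dotProduct_mulVec v,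
        ← Matrix.mulVec_transpose, hG]
    have e2 : dotProduct ((A (-1 - n') n).mulVec v) (G.mulVec v') =
        dotProduct v (((A (-1 - n') n).transpose * G).mulVec v') := by
      rw [← Matrix.mulVec_mulVec, Matrix.dotProduct_mulVec v, Matrix.vecMul_transpose]
    rw [e1, e2]
    have h2 := congrArg (fun M : Mat N => dotProduct v (M.mulVec v')) h
    simp only [Matrix.smul_mulVec, Matrix.neg_mulVec, dotProduct_smul, dotProduct_neg,
      smul_eq_mul] at h2
    rw [h2, show (-1 : ℤ) - n = -1 + -n by ring, zpow_add₀ (by norm_num), zpow_neg]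
    rcases Int.even_or_odd n with hn | hn
    · simp [hn.neg_one_zpow]
    · simp [hn.neg_one_zpow]
  rw [ham, key]
  ring

theorem ham_single (G : Mat N) (A : Op N) (n n' : ℤ) (v v' : Fin N → ℂ) :
    ham G A (Pi.single n v) (Pi.single n' v') = (1 / 4) *
      ((-1 : ℂ) ^ (-1 - n') * dotProduct ((A (-1 - n') n).mulVec v) (G.mulVec v') +
        (-1 : ℂ) ^ (-1 - n) * dotProduct ((A (-1 - n) n').mulVec v') (G.mulVec v)) := by
  rw [ham, symp_single, symp_single, app_single, app_single]

theorem ham_part_of_eq (G : Mat N) (A : Op N) {k n n' : ℤ} (h : n + n' + k = -1)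
    (v v' : Fin N → ℂ) : ham G (A.part k) (Pi.single n v) (Pi.single n' v') =
      ham G A (Pi.single n v) (Pi.single n' v') := by
  rw [ham_single, ham_single, Op.part, Op.part, if_pos (by omega), if_pos (by omega)]

theorem ham_part_of_ne (G : Mat N) (A : Op N) {k n n' : ℤ} (h : n + n' + k ≠ -1)
    (v v' : Fin N → ℂ) : ham G (A.part k) (Pi.single n v) (Pi.single n' v') = 0 := by
  rw [ham_single, Op.part, Op.part, if_neg (by omega), if_neg (by omega)]
  simp

theorem ham_comm (G : Mat N) (A : Op N) (f g : Loop N) : ham G A f g = ham G A g f := by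
  rw [ham, ham, add_comm]

/-! ### Quantized homogeneous operators -/

variable {K : Type*} [CommRing K] [Algebra ℂ K]

/-- Coefficients at `q_i q_j`. -/
def coefQQ (ħ' : K) (G : Mat N) (A : Op N) (i j : Idx N) : K :=
  algebraMap ℂ K (ham G A (qVec i) (qVec j)) * ħ'

/-- Coefficients at `q_i ∂_j`. -/
def coefQP (K : Type*) [CommRing K] [Algebra ℂ K] (G : Mat N) (A : Op N) (i j : Idx N) : K :=
  algebraMap ℂ K (2 * ham G A (qVec i) (pVec G j))

/-- Coefficients at `∂_i ∂_j`. -/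
def coefPP (ħ : K) (G : Mat N) (A : Op N) (i j : Idx N) : K :=
  algebraMap ℂ K (ham G A (pVec G i) (pVec G j)) * ħ

theorem coefQQ_comm (ħ' : K) (G : Mat N) (A : Op N) (i j : Idx N) :
    coefQQ ħ' G A i j = coefQQ ħ' G A j i := by
  rw [coefQQ, coefQQ, ham_comm]

theorem coefPP_comm (ħ : K) (G : Mat N) (A : Op N) (i j : Idx N) :
    coefPP ħ G A i j = coefPP ħ G A j i := by
  rw [coefPP, coefPP, ham_comm]

theorem coefQQ_part_ne_zero {ħ' : K} {G : Mat N} {A : Op N} {k : ℤ} {i j : Idx N}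
    (h : coefQQ ħ' G (A.part k) i j ≠ 0) : (i.1 : ℤ) + j.1 + k = -1 := by
  by_contra hne
  exact h (by rw [coefQQ, qVec, qVec, ham_part_of_ne G A hne, map_zero, zero_mul])

theorem coefQP_part_ne_zero {G : Mat N} {A : Op N} {k : ℤ} {i j : Idx N}
    (h : coefQP K G (A.part k) i j ≠ 0) : (j.1 : ℤ) = i.1 + k := by
  by_contra hne
  exact h (by rw [coefQP, qVec, pVec, ham_part_of_ne G A (by omega), mul_zero, map_zero])

theorem coefPP_part_ne_zero {ħ : K} {G : Mat N} {A : Op N} {k : ℤ} {i j : Idx N}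
    (h : coefPP ħ G (A.part k) i j ≠ 0) : (i.1 : ℤ) + j.1 + 1 = k := by
  by_contra hne
  exact h (by rw [coefPP, pVec, pVec, ham_part_of_ne G A (by omega), map_zero, zero_mul])

theorem finite_idx_le (B : ℕ) : {i : Idx N | i.1 ≤ B}.Finite := by
  apply (range (B + 1) ×ˢ (Finset.univ : Finset (Fin N))).finite_toSet.subset
  rintro ⟨i, a⟩ h
  simp only [Set.mem_ofPred_eq] at h
  simp only [coe_product, coe_range, coe_univ, Set.mem_prod, Set.mem_Iio, Set.mem_univ, and_true]
  omega

theorem finite_coefQP (G : Mat N) (A : Op N) (k : ℤ) (i : Idx N) :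
    {j | coefQP K G (A.part k) i j ≠ 0}.Finite := by
  apply (finite_idx_le (i.1 + k).toNat).subset
  intro j hj
  have := coefQP_part_ne_zero hj
  simp only [Set.mem_ofPred_eq]
  omega

theorem finite_coefPP (ħ : K) (G : Mat N) (A : Op N) (k : ℤ) :
    {p : Idx N × Idx N | coefPP ħ G (A.part k) p.1 p.2 ≠ 0}.Finite := by
  apply ((finite_idx_le k.toNat).prod (finite_idx_le k.toNat)).subset
  intro p hp
  have := coefPP_part_ne_zero hp
  simp only [Set.mem_prod, Set.mem_ofPred_eq]
  omega

/-- The quantization of the part of `A` that multiplies by `z ^ k`. -/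
def qPart (ħ ħ' : K) (G : Mat N) (A : Op N) (k : ℤ) : Module.End K (MvPowerSeries (Idx N) K) :=
  quadEnd (coefQQ ħ' G (A.part k)) (coefQP K G (A.part k)) (coefPP ħ G (A.part k))
    (finite_coefQP G A k) (finite_coefPP ħ G A k)

/-- The weight of `q_k` is `2 k + 1`. -/
def idxWeight (i : Idx N) : ℤ := 2 * i.1 + 1

theorem hasShift_qPart (ħ ħ' : K) (G : Mat N) (A : Op N) (k : ℤ) :
    HasShift idxWeight (2 * k) (qPart ħ ħ' G A k) := by
  apply HasShift.quadEnd
  · intro i j h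
    have := coefQQ_part_ne_zero h
    simp only [idxWeight]
    omega
  · intro i j h
    have := coefQP_part_ne_zero h
    simp only [idxWeight]
    omega
  · intro i j h
    have := coefPP_part_ne_zero h
    simp only [idxWeight]
    omega

/-- A finite set of indices that contains those of the Darboux coordinates of `v z ^ n`. -/
def idxBelow (N : ℕ) (n : ℤ) : Finset (Idx N) := range (n.natAbs + 1) ×ˢ Finset.univ

theorem mem_idxBelow {n : ℤ} {i : Idx N} : i ∈ idxBelow N n ↔ i.1 ≤ n.natAbs := by
  simp [idxBelow]

/-- The quantization of the linear hamiltonian of `v z ^ n`. -/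
def linOp (ħ : K) (G : Mat N) (n : ℤ) : (Fin N → ℂ) →ₗ[ℂ] Module.End K (MvPowerSeries (Idx N) K) where
  toFun v := ∑ i ∈ idxBelow N n, algebraMap ℂ K (symp G (Pi.single n v) (qVec i)) • mulX i +
    ∑ i ∈ idxBelow N n, (ħ * algebraMap ℂ K (symp G (Pi.single n v) (pVec G i))) • derX i
  map_add' v v' := by
    have h : ∀ (m : ℤ) (u : Fin N → ℂ), symp G (Pi.single n (v + v')) (Pi.single m u) =
        symp G (Pi.single n v) (Pi.single m u) + symp G (Pi.single n v') (Pi.single m u) := by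
      intro m u
      simp only [symp_single_single, add_dotProduct]
      split_ifs <;> ring
    simp only [qVec, pVec, h, map_add, mul_add, add_smul, Finset.sum_add_distrib]
    abel
  map_smul' c v := by
    have h : ∀ (m : ℤ) (u : Fin N → ℂ), symp G (Pi.single n (c • v)) (Pi.single m u) =
        c * symp G (Pi.single n v) (Pi.single m u) := by
      intro m u
      simp only [symp_single_single, smul_dotProduct, smul_eq_mul]
      split_ifs <;> ring
    rw [RingHom.id_apply, ← algebraMap_smul K c (_ : Module.End K (MvPowerSeries (Idx N) K))]
    simp only [qVec, pVec, h, map_mul, smul_add, Finset.smul_sum, smul_smul, mul_left_comm]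

theorem linOp_apply (ħ : K) (G : Mat N) (n : ℤ) (v : Fin N → ℂ) : linOp ħ G n v =
    ∑ i ∈ idxBelow N n, algebraMap ℂ K (symp G (Pi.single n v) (qVec i)) • mulX i +
    ∑ i ∈ idxBelow N n, (ħ * algebraMap ℂ K (symp G (Pi.single n v) (pVec G i))) • derX i := rfl

/-- The vector `v z ^ n` pairs nontrivially only with Darboux vectors of level `n` or `-1 - n`, so
any finite set containing these levels gives the same operator. -/
theorem linOp_eq_of_subset (ħ : K) (G : Mat N) (n : ℤ) (v : Fin N → ℂ) {T : Finset (Idx N)}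
    (hT : ∀ i : Idx N, (i.1 : ℤ) = n ∨ (i.1 : ℤ) = -1 - n → i ∈ T) : linOp ħ G n v =
    ∑ i ∈ T, algebraMap ℂ K (symp G (Pi.single n v) (qVec i)) • mulX i +
    ∑ i ∈ T, (ħ * algebraMap ℂ K (symp G (Pi.single n v) (pVec G i))) • derX i := by
  classical
  have hq : ∀ i : Idx N, (i.1 : ℤ) ≠ -1 - n → symp G (Pi.single n v) (qVec i) = 0 := by
    intro i hi
    rw [qVec, symp_single_single, if_neg (by omega)]
  have hp : ∀ i : Idx N, (i.1 : ℤ) ≠ n → symp G (Pi.single n v) (pVec G i) = 0 := by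
    intro i hi
    rw [pVec, symp_single_single, if_neg (by omega)]
  have key : ∀ T : Finset (Idx N), (∀ i : Idx N, (i.1 : ℤ) = n ∨ (i.1 : ℤ) = -1 - n → i ∈ T) →
      ∀ T', T ⊆ T' → (∑ i ∈ T, algebraMap ℂ K (symp G (Pi.single n v) (qVec i)) • mulX i +
        ∑ i ∈ T, (ħ * algebraMap ℂ K (symp G (Pi.single n v) (pVec G i))) • derX i :
          Module.End K (MvPowerSeries (Idx N) K)) =
      ∑ i ∈ T', algebraMap ℂ K (symp G (Pi.single n v) (qVec i)) • mulX i +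
        ∑ i ∈ T', (ħ * algebraMap ℂ K (symp G (Pi.single n v) (pVec G i))) • derX i := by
    intro T hT T' hTT'
    congr 1
    · refine Finset.sum_subset hTT' fun i _ hi => ?_
      rw [hq i (fun h => hi (hT i (Or.inr h))), map_zero, zero_smul]
    · refine Finset.sum_subset hTT' fun i _ hi => ?_
      rw [hp i (fun h => hi (hT i (Or.inl h))), map_zero, mul_zero, zero_smul]
  rw [linOp_apply, key _ _ (idxBelow N n ∪ T) Finset.subset_union_left,
    ← key _ hT _ Finset.subset_union_right]
  intro i hi
  rw [mem_idxBelow]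
  omega

theorem single_dotProduct_mulVec_inv {G : Mat N} (hG : G.transpose = G) (hG' : IsUnit G.det)
    (a b : Fin N) : dotProduct (G⁻¹.mulVec (Pi.single a 1)) (G.mulVec (Pi.single b 1)) =
      if b = a then (1 : ℂ) else 0 := by
  rw [Matrix.dotProduct_mulVec, ← Matrix.mulVec_transpose, hG, Matrix.mulVec_mulVec,
    Matrix.mul_nonsing_inv _ hG', Matrix.one_mulVec, single_one_dotProduct, Pi.single_apply]
  simp only [eq_comm]

/-- With `linOp_qVec` this shows that the `linOp` exhaust the generators `q_l` and, `ħ` being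
invertible, `∂_l`. -/
theorem linOp_pVec (ħ : K) {G : Mat N} (hG : G.transpose = G) (hG' : IsUnit G.det) (l : Idx N) :
    linOp ħ G (-1 - (l.1 : ℤ)) ((-1 : ℂ) ^ (l.1 + 1) • G⁻¹.mulVec (Pi.single l.2 1)) = mulX l := by
  classical
  have h1 : ∀ i : Idx N, symp G (Pi.single (-1 - (l.1 : ℤ)) ((-1 : ℂ) ^ (l.1 + 1) •
      G⁻¹.mulVec (Pi.single l.2 1))) (qVec i) = if i = l then 1 else 0 := by
    intro i
    rw [qVec, symp_single_single]
    by_cases hi : i.1 = l.1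
    · rw [if_pos (by omega), smul_dotProduct, single_dotProduct_mulVec_inv hG hG', smul_eq_mul,
        ← mul_assoc]
      have hs : (-1 : ℂ) ^ (-1 - (l.1 : ℤ)) * (-1 : ℂ) ^ (l.1 + 1) = 1 := by
        rw [← zpow_natCast, ← zpow_add₀ (by norm_num)]
        push_cast
        rw [show -1 - (l.1 : ℤ) + (l.1 + 1) = 0 by ring, zpow_zero]
      rw [hs, one_mul]
      simp only [Prod.ext_iff, hi, true_and]
    · rw [if_neg (by omega), if_neg (fun h => hi (by rw [h]))]
  have h2 : ∀ i : Idx N, symp G (Pi.single (-1 - (l.1 : ℤ)) ((-1 : ℂ) ^ (l.1 + 1) •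
      G⁻¹.mulVec (Pi.single l.2 1))) (pVec G i) = 0 := by
    intro i
    rw [pVec, symp_single_single, if_neg (by omega)]
  rw [linOp_apply]
  simp only [h1, h2, map_zero, mul_zero, zero_smul, Finset.sum_const_zero, add_zero]
  rw [Finset.sum_eq_single l]
  · simp
  · intro i _ hi
    rw [if_neg hi, map_zero, zero_smul]
  · intro h
    rw [mem_idxBelow] at h
    omega

theorem linOp_qVec (ħ : K) {G : Mat N} (hG' : IsUnit G.det) (l : Idx N) :
    linOp ħ G (l.1 : ℤ) (Pi.single l.2 1) = (-ħ) • derX l := by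
  classical
  have h1 : ∀ i : Idx N, symp G (Pi.single (l.1 : ℤ) (Pi.single l.2 1)) (qVec i) = 0 := by
    intro i
    rw [qVec, symp_single_single, if_neg (by omega)]
  have h2 : ∀ i : Idx N, symp G (Pi.single (l.1 : ℤ) (Pi.single l.2 1)) (pVec G i) =
      if i = l then -1 else 0 := by
    intro i
    rw [pVec, symp_single_single]
    by_cases hi : i.1 = l.1
    · rw [if_pos (by omega), Matrix.mulVec_smul, Matrix.mulVec_mulVec,
        Matrix.mul_nonsing_inv _ hG', Matrix.one_mulVec, dotProduct_smul, single_one_dotProduct,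
        Pi.single_apply, hi, smul_eq_mul, ← mul_assoc, zpow_natCast, ← pow_add]
      have hs : (-1 : ℂ) ^ (l.1 + (l.1 + 1)) = -1 := Odd.neg_one_pow ⟨l.1, by ring⟩
      rw [hs]
      simp only [Prod.ext_iff, hi, true_and, eq_comm (a := i.2)]
      split_ifs <;> simp
    · rw [if_neg (by omega), if_neg (fun h => hi (by rw [h]))]
  rw [linOp_apply]
  simp only [h1, h2, map_zero, zero_smul, Finset.sum_const_zero, zero_add]
  rw [Finset.sum_eq_single l]
  · rw [if_pos rfl, map_neg, map_one, mul_neg, mul_one]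
  · intro i _ hi
    rw [if_neg hi, map_zero, mul_zero, zero_smul]
  · intro h
    rw [mem_idxBelow] at h
    omega

theorem qPart_mul_mulX {ħ ħ' : K} {G : Mat N} (hG : G.transpose = G) {A : Op N}
    (hA : IsInfSymplectic G A) (k : ℤ) (l : Idx N) :
    qPart ħ ħ' G A k * mulX l = mulX l * qPart ħ ħ' G A k + linOp ħ G (-1 - (l.1 : ℤ) + k)
      ((A (-1 - (l.1 : ℤ) + k) (-1 - (l.1 : ℤ))).mulVec
        ((-1 : ℂ) ^ (l.1 + 1) • G⁻¹.mulVec (Pi.single l.2 1))) := by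
  have hT : ∀ i : Idx N, (i.1 : ℤ) = -1 - (l.1 : ℤ) + k ∨ (i.1 : ℤ) = -1 - (-1 - (l.1 : ℤ) + k) →
      i ∈ idxBelow N (-1 - (l.1 : ℤ) + k) ∪ idxBelow N (l.1 - k) := by
    intro i hi
    rw [Finset.mem_union, mem_idxBelow, mem_idxBelow]
    omega
  rw [qPart, quadEnd_mul_mulX _ _ _ _ _ l
    (idxBelow N (-1 - (l.1 : ℤ) + k) ∪ idxBelow N (l.1 - k)),
    linOp_eq_of_subset ħ G _ _ hT, add_assoc]
  · congr 2
    · refine Finset.sum_congr rfl fun i _ => ?_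
      congr 1
      rw [coefQP, ham_comm, qVec, pVec, two_mul_ham hG (hA.part k), app_part_single]
    · refine Finset.sum_congr rfl fun i _ => ?_
      congr 1
      rw [coefPP, coefPP, ham_comm G _ (pVec G i), ← add_mul, ← map_add, ← two_mul, pVec, pVec,
        two_mul_ham hG (hA.part k), app_part_single, mul_comm]
  · intro i hi
    apply hT
    rcases hi with hi | hi
    · have := coefQP_part_ne_zero hi
      omega
    · have h2 : coefPP ħ G (A.part k) l i ≠ 0 := by
        intro h0
        exact hi (by rw [coefPP_comm ħ G _ i l, h0, add_zero])
      have := coefPP_part_ne_zero h2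
      omega

theorem qPart_mul_derX {ħ ħ' : K} (hħ : ħ * ħ' = 1) {G : Mat N} (hG : G.transpose = G) {A : Op N}
    (hA : IsInfSymplectic G A) (k : ℤ) (l : Idx N) :
    qPart ħ ħ' G A k * ((-ħ) • derX l) = ((-ħ) • derX l) * qPart ħ ħ' G A k +
      linOp ħ G ((l.1 : ℤ) + k) ((A ((l.1 : ℤ) + k) (l.1 : ℤ)).mulVec (Pi.single l.2 1)) := by
  have hT : ∀ i : Idx N, (i.1 : ℤ) = (l.1 : ℤ) + k ∨ (i.1 : ℤ) = -1 - ((l.1 : ℤ) + k) →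
      i ∈ idxBelow N ((l.1 : ℤ) + k) ∪ idxBelow N (-1 - ((l.1 : ℤ) + k)) := by
    intro i hi
    rw [Finset.mem_union, mem_idxBelow, mem_idxBelow]
    omega
  have h := quadEnd_mul_derX (coefQQ ħ' G (A.part k)) _ _ (finite_coefQP G A k)
    (finite_coefPP ħ G A k) l (idxBelow N ((l.1 : ℤ) + k) ∪ idxBelow N (-1 - ((l.1 : ℤ) + k))) ?_
  · change qPart ħ ħ' G A k * _ + _ + _ = _ * qPart ħ ħ' G A k at h
    rw [linOp_eq_of_subset ħ G _ _ hT, smul_mul_assoc, ← h, mul_smul_comm,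
      smul_add, smul_add, Finset.smul_sum, Finset.smul_sum]
    -- The factor `-ħ` absorbs the `1/ħ` in the quantization of `q_i q_j`, which is why the result
    -- is again a `linOp` with the same normalization.
    have e1 : ∀ i : Idx N, (-ħ) • (coefQQ ħ' G (A.part k) l i + coefQQ ħ' G (A.part k) i l) •
        (mulX i : Module.End K (MvPowerSeries (Idx N) K)) =
        (-1 : K) • (algebraMap ℂ K (symp G (Pi.single ((l.1 : ℤ) + k)
          ((A ((l.1 : ℤ) + k) (l.1 : ℤ)).mulVec (Pi.single l.2 1))) (qVec i)) • mulX i) := by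
      intro i
      rw [smul_smul, coefQQ, coefQQ, ham_comm G _ (qVec i), ← add_mul, ← map_add, ← two_mul, qVec,
        qVec, two_mul_ham hG (hA.part k), app_part_single, smul_smul]
      congr 1
      linear_combination (-algebraMap ℂ K (symp G (Pi.single ((l.1 : ℤ) + k)
        ((A ((l.1 : ℤ) + k) (l.1 : ℤ)).mulVec (Pi.single l.2 1)))
          (Pi.single (i.1 : ℤ) (Pi.single i.2 1)))) * hħ
    have e2 : ∀ i : Idx N, (-ħ) • coefQP K G (A.part k) l i •
        (derX i : Module.End K (MvPowerSeries (Idx N) K)) =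
        (-1 : K) • ((ħ * algebraMap ℂ K (symp G (Pi.single ((l.1 : ℤ) + k)
          ((A ((l.1 : ℤ) + k) (l.1 : ℤ)).mulVec (Pi.single l.2 1))) (pVec G i))) • derX i) := by
      intro i
      rw [smul_smul, coefQP, qVec, pVec, two_mul_ham hG (hA.part k), app_part_single, smul_smul]
      congr 1
      ring
    simp only [e1, e2, ← Finset.smul_sum]
    module
  · intro i hi
    apply hT
    rcases hi with hi | hi
    · have := coefQP_part_ne_zero hi
      omega
    · have h2 : coefQQ ħ' G (A.part k) l i ≠ 0 := by
        intro h0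
        exact hi (by rw [coefQQ_comm ħ' G _ i l, h0, add_zero])
      have := coefQQ_part_ne_zero h2
      omega

/-- The identity `[Â, f̂] = (A f)^` holds without correction: the commutator of a second-order with
a first-order operator leaves no room for an ordering anomaly. By linearity it suffices to check it
on Darboux vectors, where the coefficients match by `two_mul_ham`. -/
theorem qPart_mul_linOp {ħ ħ' : K} (hħ : ħ * ħ' = 1) {G : Mat N} (hG : G.transpose = G)
    (hG' : IsUnit G.det) {A : Op N} (hA : IsInfSymplectic G A) (k n : ℤ) (v : Fin N → ℂ) :
    qPart ħ ħ' G A k * linOp ħ G n v = linOp ħ G n v * qPart ħ ħ' G A k +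
      linOp ħ G (n + k) ((A (n + k) n).mulVec v) := by
  have hlin : ∀ (s : Finset (Fin N)) (c : Fin N → ℂ) (u : Fin N → Fin N → ℂ),
      (∀ a, qPart ħ ħ' G A k * linOp ħ G n (u a) = linOp ħ G n (u a) * qPart ħ ħ' G A k +
        linOp ħ G (n + k) ((A (n + k) n).mulVec (u a))) →
      qPart ħ ħ' G A k * linOp ħ G n (∑ a ∈ s, c a • u a) =
        linOp ħ G n (∑ a ∈ s, c a • u a) * qPart ħ ħ' G A k +
        linOp ħ G (n + k) ((A (n + k) n).mulVec (∑ a ∈ s, c a • u a)) := by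
    intro s c u hu
    have e : (A (n + k) n).mulVec (∑ a ∈ s, c a • u a) =
        ∑ a ∈ s, c a • (A (n + k) n).mulVec (u a) := by
      rw [← Matrix.mulVecLin_apply, map_sum]
      simp only [map_smul, Matrix.mulVecLin_apply]
    rw [e, map_sum, map_sum, Finset.mul_sum, Finset.sum_mul, ← Finset.sum_add_distrib]
    refine Finset.sum_congr rfl fun a _ => ?_
    rw [map_smul, map_smul, ← algebraMap_smul K (c a), ← algebraMap_smul K (c a), mul_smul_comm,
      smul_mul_assoc, hu, smul_add]
  -- Nonnegative powers of `z` are spanned by the `qVec`, negative powers by the `pVec`.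
  rcases le_or_gt 0 n with hn | hn
  · obtain ⟨l, rfl⟩ := Int.eq_ofNat_of_zero_le hn
    have hv : v = ∑ a, v a • (Pi.single a 1 : Fin N → ℂ) := by
      rw [← pi_eq_sum_univ' v]
    rw [hv]
    refine hlin _ _ _ fun a => ?_
    rw [linOp_qVec ħ hG' (l, a)]
    exact qPart_mul_derX hħ hG hA k (l, a)
  · obtain ⟨l, hl⟩ := Int.eq_ofNat_of_zero_le (show 0 ≤ -1 - n by omega)
    obtain rfl : n = -1 - (l : ℤ) := by omega
    have hv : v = ∑ a, ((-1 : ℂ) ^ (l + 1) * (G.mulVec v) a) • ((-1 : ℂ) ^ (l + 1) •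
        G⁻¹.mulVec (Pi.single a 1)) := by
      have hs : (-1 : ℂ) ^ (l + 1) * (-1 : ℂ) ^ (l + 1) = 1 := by
        rw [← mul_pow]; norm_num
      have h1 : ∀ a, ((-1 : ℂ) ^ (l + 1) * (G.mulVec v) a) • ((-1 : ℂ) ^ (l + 1) •
          G⁻¹.mulVec (Pi.single a 1)) = (G.mulVec v) a • G⁻¹.mulVec (Pi.single a (1 : ℂ)) := by
        intro a
        rw [smul_smul, mul_right_comm, hs, one_mul]
      simp only [h1]
      have h2 : G⁻¹.mulVec (G.mulVec v) =
          ∑ a, (G.mulVec v) a • G⁻¹.mulVec (Pi.single a (1 : ℂ)) := by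
        conv_lhs => rw [pi_eq_sum_univ' (G.mulVec v)]
        rw [← Matrix.mulVecLin_apply, map_sum]
        simp only [map_smul, Matrix.mulVecLin_apply]
      rw [← h2, Matrix.mulVec_mulVec, Matrix.nonsing_inv_mul _ hG', Matrix.one_mulVec]
    rw [hv]
    refine hlin _ _ _ fun a => ?_
    rw [linOp_pVec ħ hG hG' (l, a)]
    exact qPart_mul_mulX hG hA k (l, a)

end Hamiltonians

/-! ### Conjugation of quantized operators -/

section Conjugation

open Finset

variable {N : ℕ} {K : Type*} [CommRing K] [Algebra ℂ K]

/-- The graded series of the quantizations of the homogeneous parts of `A`, starting with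
`z ^ (-σ s)`. -/
def quantSeries (ħ ħ' : K) (G : Mat N) (σ : ℤ) (s : ℕ) (A : Op N) :
    PowerSeries (Module.End K (MvPowerSeries (Idx N) K)) :=
  PowerSeries.mk fun n => qPart ħ ħ' G A (σ * n - σ * s)

/-- The graded series of the quantized linear hamiltonians of `z ^ j ∑ (W_n v) z ^ (σ n)`. -/
def linSeriesOp (ħ : K) (G : Mat N) (σ : ℤ) (v : Fin N → ℂ) (j : ℤ) (W : PowerSeries (Mat N)) :
    PowerSeries (Module.End K (MvPowerSeries (Idx N) K)) :=
  PowerSeries.mk fun n => linOp ħ G (j + σ * n) ((PowerSeries.coeff n W).mulVec v)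

/-- The degreewise sum of the commutators `[Â, f̂] = (A f)^`. The hypothesis `hW` says that `W'` is
the column obtained when `A`, with leading power `z ^ (-σ s)`, acts on `z ^ j W`. -/
theorem quantSeries_mul_linSeriesOp {ħ ħ' : K} (hħ : ħ * ħ' = 1) {G : Mat N}
    (hG : G.transpose = G) (hG' : IsUnit G.det) (σ : ℤ) (s : ℕ) {A : Op N}
    (hA : IsInfSymplectic G A) (v : Fin N → ℂ) (j : ℤ) {W W' : PowerSeries (Mat N)}
    (hW : ∀ n : ℕ, ∑ p ∈ antidiagonal n, A (j + σ * n - σ * s) (j + σ * p.2) *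
      PowerSeries.coeff p.2 W = PowerSeries.coeff n W') :
    quantSeries ħ ħ' G σ s A * linSeriesOp ħ G σ v j W =
      linSeriesOp ħ G σ v j W * quantSeries ħ ħ' G σ s A +
        linSeriesOp ħ G σ v (j - σ * s) W' := by
  ext1 n
  rw [map_add, PowerSeries.coeff_mul, PowerSeries.coeff_mul, ← Finset.Nat.sum_antidiagonal_swap
    (f := fun p => PowerSeries.coeff p.1 (linSeriesOp ħ G σ v j W) *
      PowerSeries.coeff p.2 (quantSeries ħ ħ' G σ s A))]
  have h3 : PowerSeries.coeff n (linSeriesOp ħ G σ v (j - σ * s) W') =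
      ∑ p ∈ antidiagonal n, linOp ħ G (j + σ * n - σ * s)
        ((A (j + σ * n - σ * s) (j + σ * p.2) * PowerSeries.coeff p.2 W).mulVec v) := by
    rw [linSeriesOp, PowerSeries.coeff_mk, ← hW, Matrix.sum_mulVec, map_sum,
      show j - σ * s + σ * n = j + σ * n - σ * s by ring]
  rw [h3, ← Finset.sum_add_distrib]
  refine Finset.sum_congr rfl fun p hp => ?_
  rw [Finset.HasAntidiagonal.mem_antidiagonal] at hp
  simp only [Prod.fst_swap, Prod.snd_swap, quantSeries, linSeriesOp, PowerSeries.coeff_mk]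
  rw [qPart_mul_linOp hħ hG hG' hA, Matrix.mulVec_mulVec,
    show j + σ * (p.2 : ℤ) + (σ * (p.1 : ℤ) - σ * s) = j + σ * n - σ * s by
      rw [← hp]; push_cast; ring]

theorem isGraded_quantSeries (ħ ħ' : K) (G : Mat N) (σ : ℤ) (s : ℕ) (A : Op N) :
    IsGraded idxWeight σ (-(2 * σ * s)) (quantSeries ħ ħ' G σ s A) := by
  intro n
  rw [quantSeries, PowerSeries.coeff_mk]
  have := hasShift_qPart ħ ħ' G A (σ * n - σ * s)
  rwa [show 2 * (σ * (n : ℤ) - σ * s) = 2 * σ * n + -(2 * σ * s) by ring] at this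

theorem linSeriesOp_one (ħ : K) (G : Mat N) (σ : ℤ) (v : Fin N → ℂ) (j : ℤ) :
    linSeriesOp ħ G σ v j 1 = PowerSeries.C (linOp ħ G j v) := by
  ext1 n
  rw [linSeriesOp, PowerSeries.coeff_mk, PowerSeries.coeff_one, PowerSeries.coeff_C]
  split_ifs with h
  · rw [h, Matrix.one_mulVec]; simp
  · rw [Matrix.zero_mulVec, map_zero]

/-- `A` is the operator of multiplication by the series `Y` in `z ^ σ`. -/
def IsMulOp (σ : ℤ) (A : Op N) (Y : PowerSeries (Mat N)) : Prop :=
  (∀ (n : ℕ) (i : ℤ), A (i + σ * n) i = PowerSeries.coeff n Y)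

/-- Exponentiating the commutator relation: the quantized exponential acts on linear hamiltonians
through the matrix series `expS Y` itself. -/
theorem expS_quantSeries_mul_linSeriesOp {ħ ħ' : K} (hħ : ħ * ħ' = 1) {G : Mat N}
    (hG : G.transpose = G) (hG' : IsUnit G.det) {σ : ℤ} {A : Op N}
    (hA : IsInfSymplectic G A) {Y : PowerSeries (Mat N)} (hAY : IsMulOp σ A Y)
    (hY0 : PowerSeries.coeff 0 Y = 0) (hT0 : PowerSeries.coeff 0 (quantSeries ħ ħ' G σ 0 A) = 0)
    (v : Fin N → ℂ) (j : ℤ) (W : PowerSeries (Mat N)) :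
    expS (quantSeries ħ ħ' G σ 0 A) * linSeriesOp ħ G σ v j W =
      linSeriesOp ħ G σ v j (expS Y * W) * expS (quantSeries ħ ħ' G σ 0 A) := by
  refine expS_intertwine (fun n : ℕ => (linOp ħ G (j + σ * n)).comp
    ((Matrix.mulVecBilin ℂ ℂ).flip v : Mat N →ₗ[ℂ] (Fin N → ℂ))) hT0 hY0 ?_ W
  intro W
  have := quantSeries_mul_linSeriesOp hħ hG hG' σ 0 hA v j (W := W) (W' := Y * W) ?_
  · rw [show j - σ * ((0 : ℕ) : ℤ) = j by simp] at this
    exact this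
  · intro n
    rw [PowerSeries.coeff_mul]
    refine Finset.sum_congr rfl fun p hp => ?_
    rw [Finset.HasAntidiagonal.mem_antidiagonal] at hp
    rw [← hAY p.1 (j + σ * p.2), ← hp]
    congr 2
    push_cast
    ring

/-- The difference between the conjugate of a quantized operator and the quantization of the
conjugate. -/
def conjDefect (ħ ħ' : K) (G : Mat N) (σ : ℤ) (s : ℕ) (A B B' : Op N) :
    PowerSeries (Module.End K (MvPowerSeries (Idx N) K)) :=
  expS (-quantSeries ħ ħ' G σ 0 A) * quantSeries ħ ħ' G σ s B * expS (quantSeries ħ ħ' G σ 0 A) -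
    quantSeries ħ ħ' G σ s B'

/-- Conjugation by `e^T` replaces `f` by `e^Y f`, and `hBB'` expresses `B e^Y = e^Y B'`. Thus both
terms of the defect send `f̂` to the same commutator, the operator of `B' f`. -/
theorem conjDefect_commute {ħ ħ' : K} (hħ : ħ * ħ' = 1) {G : Mat N}
    (hG : G.transpose = G) (hG' : IsUnit G.det) {σ : ℤ} {s : ℕ} {A B B' : Op N}
    (hA : IsInfSymplectic G A) {Y : PowerSeries (Mat N)} (hAY : IsMulOp σ A Y)
    (hY0 : PowerSeries.coeff 0 Y = 0) (hT0 : PowerSeries.coeff 0 (quantSeries ħ ħ' G σ 0 A) = 0)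
    (hB : IsInfSymplectic G B) (hB' : IsInfSymplectic G B')
    (hBB' : ∀ (j : ℤ) (n : ℕ), ∑ p ∈ antidiagonal n, B (j + σ * n - σ * s) (j + σ * p.2) *
      PowerSeries.coeff p.2 (expS Y) =
        PowerSeries.coeff n (expS Y * PowerSeries.mk fun b => B' (j + σ * b - σ * s) j))
    (n : ℕ) (j : ℤ) (v : Fin N → ℂ) :
    PowerSeries.coeff n (conjDefect ħ ħ' G σ s A B B') * linOp ħ G j v =
      linOp ħ G j v * PowerSeries.coeff n (conjDefect ħ ħ' G σ s A B B') := by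
  set T := quantSeries ħ ħ' G σ 0 A with hT
  have hE : ∀ (j : ℤ) W, expS T * linSeriesOp ħ G σ v j W =
      linSeriesOp ħ G σ v j (expS Y * W) * expS T :=
    expS_quantSeries_mul_linSeriesOp hħ hG hG' hA hAY hY0 hT0 v
  have hE' : ∀ (j : ℤ) W, expS (-T) * (linSeriesOp ħ G σ v j (expS Y * W) * expS T) =
      linSeriesOp ħ G σ v j W := by
    intro j W
    rw [← hE, ← mul_assoc, expS_neg_mul_expS hT0, one_mul]
  have hQ := quantSeries_mul_linSeriesOp hħ hG hG' σ s hB v j (W := expS Y) (hBB' j)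
  -- For the constant series `1` the convolution reduces to the action of `B'` on a single monomial
  -- `v z ^ j`.
  have hQ' := quantSeries_mul_linSeriesOp hħ hG hG' σ s hB' v j (W := 1)
    (W' := PowerSeries.mk fun b => B' (j + σ * b - σ * s) j) (by
      intro n
      rw [PowerSeries.coeff_mk, Finset.sum_eq_single (n, 0)]
      · simp
      · rintro ⟨a, b⟩ hab hne
        rw [Finset.HasAntidiagonal.mem_antidiagonal] at hab
        rw [PowerSeries.coeff_one, if_neg, mul_zero]
        rintro rfl
        exact hne (by simp at hab; rw [hab])
      · intro h
        exact absurd (by simp) h)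
  have main : conjDefect ħ ħ' G σ s A B B' * linSeriesOp ħ G σ v j 1 =
      linSeriesOp ħ G σ v j 1 * conjDefect ħ ħ' G σ s A B B' := by
    have e1 : expS (-T) * quantSeries ħ ħ' G σ s B * expS T * linSeriesOp ħ G σ v j 1 =
        linSeriesOp ħ G σ v j 1 * (expS (-T) * quantSeries ħ ħ' G σ s B * expS T) +
          linSeriesOp ħ G σ v (j - σ * s) (PowerSeries.mk fun b => B' (j + σ * b - σ * s) j) := by
      have e2 : linSeriesOp ħ G σ v j 1 * expS (-T) =
          expS (-T) * linSeriesOp ħ G σ v j (expS Y) := by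
        rw [← hE' j 1, mul_one, mul_assoc, mul_assoc, expS_mul_expS_neg hT0, mul_one]
      rw [mul_assoc _ (expS T), hE, mul_one, mul_assoc (expS (-T)), ← mul_assoc _ _ (expS T),
        hQ, add_mul, mul_add, hE', ← mul_assoc (linSeriesOp ħ G σ v j 1),
        ← mul_assoc (linSeriesOp ħ G σ v j 1), e2]
      simp only [mul_assoc]
    rw [conjDefect, sub_mul, mul_sub, e1, hQ']
    abel
  rw [linSeriesOp_one] at main
  have := congrArg (PowerSeries.coeff n) main
  rwa [PowerSeries.coeff_mul_C, PowerSeries.coeff_C_mul] at this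

theorem commute_of_commute_linOp {ħ ħ' : K} (hħ : ħ * ħ' = 1) {G : Mat N}
    (hG : G.transpose = G) (hG' : IsUnit G.det) {W : Module.End K (MvPowerSeries (Idx N) K)}
    (h : ∀ j v, W * linOp ħ G j v = linOp ħ G j v * W) :
    (∀ i, W * mulX i = mulX i * W) ∧ ∀ i, W * derX i = derX i * W := by
  constructor
  · intro i
    rw [← linOp_pVec ħ hG hG' i]
    exact h _ _
  · intro i
    have e : (derX i : Module.End K (MvPowerSeries (Idx N) K)) =
        (-ħ') • linOp ħ G (i.1 : ℤ) (Pi.single i.2 1) := by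
      rw [linOp_qVec ħ hG' i, smul_smul, neg_mul_neg, mul_comm, hħ, one_smul]
    rw [e, mul_smul_comm, smul_mul_assoc, h]

theorem idxWeight_pos (i : Idx N) : 0 < idxWeight i := by
  rw [idxWeight]; omega

/-- Each coefficient of the defect is a scalar on polynomials, by commutation with all `q_i` and
`∂_i`. A scalar preserves the weight, so only the coefficient of index `s`, whose shift is zero, can
be nonzero. -/
theorem evalOne_conj_quantSeries {ħ ħ' : K} (hħ : ħ * ħ' = 1) {G : Mat N}
    (hG : G.transpose = G) (hG' : IsUnit G.det) {σ : ℤ} (hσ : σ * σ = 1) {s : ℕ} {A B B' : Op N}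
    (hA : IsInfSymplectic G A) {Y : PowerSeries (Mat N)} (hAY : IsMulOp σ A Y)
    (hY0 : PowerSeries.coeff 0 Y = 0) (hT0 : PowerSeries.coeff 0 (quantSeries ħ ħ' G σ 0 A) = 0)
    (hB : IsInfSymplectic G B) (hB' : IsInfSymplectic G B')
    (hBB' : ∀ (j : ℤ) (n : ℕ), ∑ p ∈ antidiagonal n, B (j + σ * n - σ * s) (j + σ * p.2) *
      PowerSeries.coeff p.2 (expS Y) =
        PowerSeries.coeff n (expS Y * PowerSeries.mk fun b => B' (j + σ * b - σ * s) j))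
    (P : MvPolynomial (Idx N) K) :
    evalOne (expS (-quantSeries ħ ħ' G σ 0 A))
      (evalOne (quantSeries ħ ħ' G σ s B) (evalOne (expS (quantSeries ħ ħ' G σ 0 A))
        (P : MvPowerSeries (Idx N) K))) =
      evalOne (quantSeries ħ ħ' G σ s B') (P : MvPowerSeries (Idx N) K) +
        MvPowerSeries.C (MvPowerSeries.coeff 0
          (PowerSeries.coeff s (conjDefect ħ ħ' G σ s A B B') 1)) *
            (P : MvPowerSeries (Idx N) K) := by
  set T := quantSeries ħ ħ' G σ 0 A with hT
  have gT : IsGraded idxWeight σ 0 T := by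
    simpa using isGraded_quantSeries ħ ħ' G σ 0 A
  have gB := isGraded_quantSeries ħ ħ' G σ s B
  have gB' := isGraded_quantSeries ħ ħ' G σ s B'
  have tP : IsTame idxWeight σ (P : MvPowerSeries (Idx N) K) := isTame_coe σ P
  have tEP := IsTame.evalOne hσ gT.expS tP
  have gC : IsGraded idxWeight σ (-(2 * σ * s))
      (expS (-T) * quantSeries ħ ħ' G σ s B * expS T) := by
    simpa using (gT.neg.expS.mul gB).mul gT.expS
  have gD : IsGraded idxWeight σ (-(2 * σ * s)) (conjDefect ħ ħ' G σ s A B B') := by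
    rw [conjDefect, sub_eq_add_neg]
    exact gC.add gB'.neg
  have g1 : IsGraded idxWeight σ (0 + -(2 * σ * s)) (expS (-T) * quantSeries ħ ħ' G σ s B) :=
    gT.neg.expS.mul gB
  rw [← evalOne_mul hσ gT.neg.expS gB tEP, ← evalOne_mul hσ g1 gT.expS tP,
    show expS (-T) * quantSeries ħ ħ' G σ s B * expS T =
      quantSeries ħ ħ' G σ s B' + conjDefect ħ ħ' G σ s A B B' by rw [conjDefect]; abel,
    evalOne_add hσ gB' gD tP]
  congr 1
  have hscal : ∀ n, PowerSeries.coeff n (conjDefect ħ ħ' G σ s A B B')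
      (P : MvPowerSeries (Idx N) K) = MvPowerSeries.C (MvPowerSeries.coeff 0
        (PowerSeries.coeff n (conjDefect ħ ħ' G σ s A B B') 1)) *
          (P : MvPowerSeries (Idx N) K) := by
    intro n
    obtain ⟨h1, h2⟩ := commute_of_commute_linOp hħ hG hG'
      (conjDefect_commute hħ hG hG' hA hAY hY0 hT0 hB hB' hBB' n)
    exact apply_coe_of_commute h1 h2 P
  refine MvPowerSeries.ext fun m => ?_
  change ∑ᶠ n : ℕ, MvPowerSeries.coeff m (PowerSeries.coeff n (conjDefect ħ ħ' G σ s A B B')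
    (P : MvPowerSeries (Idx N) K)) = _
  rw [finsum_eq_single _ s, hscal]
  intro n hn
  -- The constant term of the image of `1` reads `1` in weight `2σ(n - s) ≠ 0`, where it has no
  -- coefficient.
  have h0 : MvPowerSeries.coeff 0 (PowerSeries.coeff n (conjDefect ħ ħ' G σ s A B B')
      (1 : MvPowerSeries (Idx N) K)) = 0 := by
    classical
    refine gD n _ _ fun m' hm' => ?_
    rw [MvPowerSeries.coeff_one, if_neg]
    rintro rfl
    rw [map_zero, zero_add] at hm'
    have h4 : σ * (n : ℤ) = σ * s := by linarith
    have h5 : (σ * σ) * (n : ℤ) = (σ * σ) * s := by rw [mul_assoc, h4, mul_assoc]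
    rw [hσ] at h5
    exact hn (by omega)
  rw [hscal, h0]
  simp

/-- The sums in `quad` run over all index pairs and have finite support only because `F` is tame.
Each hamiltonian entry belongs to at most one homogeneous part, and parts of index at least `n₀`
cannot affect the given coefficient, so the sum splits into finitely many finite ones. -/
theorem quad_eq_evalOne (ħ ħ' : K) (G : Mat N) {σ : ℤ} (hσ : σ * σ = 1) (s : ℕ) {B : Op N}
    (hB : ∀ m n, B m n ≠ 0 → ∃ k : ℕ, m = n + (σ * k - σ * s))
    {F : MvPowerSeries (Idx N) K} (hF : IsTame idxWeight σ F) :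
    quad (coefQQ ħ' G B) (coefQP K G B) (coefPP ħ G B) F =
      evalOne (quantSeries ħ ħ' G σ s B) F := by
  refine MvPowerSeries.ext fun m => ?_
  obtain ⟨b, hb⟩ := hF
  set n₀ : ℕ := (b - σ * Finsupp.weight idxWeight m + 2 * s).toNat with hn₀
  have hbound : ∀ n : ℕ, n₀ ≤ n → b ≤ σ * Finsupp.weight idxWeight m + 2 * n +
      σ * -(2 * σ * s) := by
    intro n hn
    have : σ * -(2 * σ * s) = -(2 * (σ * σ) * s) := by ring
    rw [this, hσ]
    omega
  rw [(isGraded_quantSeries ħ ħ' G σ s B).coeff_evalOne hσ hb (hbound n₀ le_rfl)]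
  -- The balance `n + n' + (σ k - σ s) = -1` selects the part contributing to an entry. If no `k`
  -- satisfies it, the support condition on `B` makes the entry vanish.
  have key : ∀ (n n' : ℤ) (v v' : Fin N → ℂ) (x : K),
      (∀ k : ℕ, n₀ ≤ k → n + n' + (σ * k - σ * s) = -1 → x = 0) →
      algebraMap ℂ K (ham G B (Pi.single n v) (Pi.single n' v')) * x =
        ∑ k ∈ range n₀, algebraMap ℂ K (ham G (B.part (σ * k - σ * s)) (Pi.single n v)
          (Pi.single n' v')) * x := by
    intro n n' v v' x hx
    by_cases hex : ∃ k : ℕ, n + n' + (σ * k - σ * s) = -1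
    · obtain ⟨k, hk⟩ := hex
      have huniq : ∀ k' : ℕ, n + n' + (σ * k' - σ * s) = -1 → k' = k := by
        intro k' hk'
        have h1 : σ * (k' : ℤ) = σ * k := by linarith
        have h2 : (σ * σ) * (k' : ℤ) = (σ * σ) * k := by rw [mul_assoc, h1, mul_assoc]
        rw [hσ] at h2
        omega
      by_cases hkn : k < n₀
      · rw [Finset.sum_eq_single k, ham_part_of_eq G B hk]
        · intro k' _ hk'
          rw [ham_part_of_ne G B (fun h => hk' (huniq k' h)), map_zero, zero_mul]
        · intro h
          exact absurd (Finset.mem_range.2 hkn) h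
      · rw [hx k (by omega) hk]
        simp
    · have hz : ∀ k ∈ range n₀, algebraMap ℂ K (ham G (B.part (σ * k - σ * s)) (Pi.single n v)
          (Pi.single n' v')) * x = 0 := by
        intro k _
        rw [ham_part_of_ne G B (fun h => hex ⟨k, h⟩), map_zero, zero_mul]
      rw [Finset.sum_eq_zero hz]
      have hz1 : B (-1 - n') n = 0 := by
        by_contra h
        obtain ⟨k, hk⟩ := hB _ _ h
        exact hex ⟨k, by linarith⟩
      have hz2 : B (-1 - n) n' = 0 := by
        by_contra h
        obtain ⟨k, hk⟩ := hB _ _ h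
        exact hex ⟨k, by linarith⟩
      rw [ham_single, hz1, hz2]
      simp
  have hsum : ∀ (f : Idx N × Idx N → K) (g : ℕ → Idx N × Idx N → K),
      (∀ k, (Function.support (g k)).Finite) → (∀ p, f p = ∑ k ∈ range n₀, g k p) →
      ∑ᶠ p, f p = ∑ k ∈ range n₀, ∑ᶠ p, g k p := by
    intro f g hg hfg
    rw [finsum_congr hfg]
    exact finsum_sum_comm _ (fun p k => g k p) fun k _ => hg k
  have hzero : ∀ (W : Module.End K (MvPowerSeries (Idx N) K)) (k : ℕ), n₀ ≤ k →
      HasShift idxWeight (2 * (σ * k - σ * s)) W → MvPowerSeries.coeff m (W F) = 0 := by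
    intro W k hk hW
    refine hW F m fun m' hm' => hb m' ?_
    rw [hm']
    have e : σ * (Finsupp.weight idxWeight m + 2 * (σ * k - σ * s)) =
      σ * Finsupp.weight idxWeight m + 2 * (σ * σ) * k - 2 * (σ * σ) * s := by ring
    rw [e, hσ]
    omega
  have h1 := hsum (fun ij => coefQQ ħ' G B ij.1 ij.2 *
      MvPowerSeries.coeff m (MvPowerSeries.X ij.1 * MvPowerSeries.X ij.2 * F))
    (fun k ij => coefQQ ħ' G (B.part (σ * k - σ * s)) ij.1 ij.2 *
      MvPowerSeries.coeff m (MvPowerSeries.X ij.1 * MvPowerSeries.X ij.2 * F))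
    (fun k => finite_support_quad₁ _ F m) (by
      rintro ⟨i, j⟩
      simp only [coefQQ, mul_assoc]
      refine key _ _ _ _ _ fun k hk hk' => ?_
      have := hzero (mulX i * mulX j) k hk (by
        have := (hasShift_mulX (K := K) (w := idxWeight) i).mul (hasShift_mulX j)
        simp only [idxWeight] at this
        rwa [show -(2 * (i.1 : ℤ) + 1) + -(2 * (j.1 : ℤ) + 1) = 2 * (σ * k - σ * s) by
          linarith] at this)
      rw [Module.End.mul_apply, mulX_apply, mulX_apply] at this
      rw [this, mul_zero])
  have h2 := hsum (fun ij => coefQP K G B ij.1 ij.2 *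
      MvPowerSeries.coeff m (MvPowerSeries.X ij.1 * MvPowerSeries.pderiv K ij.2 F))
    (fun k ij => coefQP K G (B.part (σ * k - σ * s)) ij.1 ij.2 *
      MvPowerSeries.coeff m (MvPowerSeries.X ij.1 * MvPowerSeries.pderiv K ij.2 F))
    (fun k => finite_support_quad₂ (finite_coefQP G B _) F m) (by
      rintro ⟨i, j⟩
      simp only [coefQP, map_mul, mul_assoc, mul_left_comm (algebraMap ℂ K 2)]
      refine key _ _ _ _ _ fun k hk hk' => ?_
      have := hzero (mulX i * derX j) k hk (by
        have := (hasShift_mulX (K := K) (w := idxWeight) i).mul (hasShift_derX j)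
        simp only [idxWeight] at this
        rwa [show -(2 * (i.1 : ℤ) + 1) + (2 * (j.1 : ℤ) + 1) = 2 * (σ * k - σ * s) by
          linarith] at this)
      rw [Module.End.mul_apply, mulX_apply, derX_apply] at this
      rw [this, mul_zero])
  have h3 := hsum (fun ij => coefPP ħ G B ij.1 ij.2 *
      MvPowerSeries.coeff m (MvPowerSeries.pderiv K ij.1 (MvPowerSeries.pderiv K ij.2 F)))
    (fun k ij => coefPP ħ G (B.part (σ * k - σ * s)) ij.1 ij.2 *
      MvPowerSeries.coeff m (MvPowerSeries.pderiv K ij.1 (MvPowerSeries.pderiv K ij.2 F)))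
    (fun k => finite_support_quad₃ (finite_coefPP ħ G B _) F m) (by
      rintro ⟨i, j⟩
      simp only [coefPP, mul_assoc]
      refine key _ _ _ _ _ fun k hk hk' => ?_
      have := hzero (derX i * derX j) k hk (by
        have := (hasShift_derX (K := K) (w := idxWeight) i).mul (hasShift_derX j)
        simp only [idxWeight] at this
        rwa [show (2 * (i.1 : ℤ) + 1) + (2 * (j.1 : ℤ) + 1) = 2 * (σ * k - σ * s) by
          linarith] at this)
      rw [Module.End.mul_apply, derX_apply, derX_apply] at this
      rw [this, mul_zero])
  have hL : MvPowerSeries.coeff m (quad (coefQQ ħ' G B) (coefQP K G B) (coefPP ħ G B) F) =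
    (∑ᶠ ij : Idx N × Idx N, coefQQ ħ' G B ij.1 ij.2 *
      MvPowerSeries.coeff m (MvPowerSeries.X ij.1 * MvPowerSeries.X ij.2 * F)) +
    (∑ᶠ ij : Idx N × Idx N, coefQP K G B ij.1 ij.2 *
      MvPowerSeries.coeff m (MvPowerSeries.X ij.1 * MvPowerSeries.pderiv K ij.2 F)) +
    (∑ᶠ ij : Idx N × Idx N, coefPP ħ G B ij.1 ij.2 *
      MvPowerSeries.coeff m (MvPowerSeries.pderiv K ij.1 (MvPowerSeries.pderiv K ij.2 F))) := rfl
  rw [hL, h1, h2, h3, ← Finset.sum_add_distrib, ← Finset.sum_add_distrib]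
  refine Finset.sum_congr rfl fun k _ => ?_
  rw [quantSeries, PowerSeries.coeff_mk]
  rfl

end Conjugation

/-! ### Quantization over `ℂ((ħ))` -/

section Laurent

open Finset

variable {N : ℕ}

/-- The algebra structure on `ℂ((ħ))` given by the constants. -/
abbrev coefAlgebra : Algebra ℂ Coef := HahnSeries.instAlgebra

/-- The algebra of endomorphisms of the Fock space over a coefficient ring. -/
abbrev fockEndAlgebra (K : Type*) [CommRing K] [Algebra ℂ K] (N : ℕ) :
    Algebra ℂ (Module.End K (MvPowerSeries (Idx N) K)) := inferInstance

/-- The algebra of endomorphisms of the Fock space over `ℂ((ħ))`. -/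
abbrev coefEndAlgebra (N : ℕ) : Algebra ℂ (Module.End Coef (MvPowerSeries (Idx N) Coef)) :=
  @fockEndAlgebra Coef _ coefAlgebra N

attribute [local instance 2000] coefAlgebra coefEndAlgebra

theorem hbar_ne_zero : hbar ≠ 0 := HahnSeries.single_ne_zero one_ne_zero

theorem hbar_mul_inv : hbar * hbar⁻¹ = 1 := mul_inv_cancel₀ hbar_ne_zero

theorem algebraMap_coef (c : ℂ) : algebraMap ℂ Coef c = HahnSeries.C c := rfl

theorem quantize_eq_quad (G : Mat N) (A : Op N) (F : Fock N) : quantize G A F =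
    quad (coefQQ hbar⁻¹ G A) (coefQP Coef G A) (coefPP hbar G A) F := rfl

theorem expOp_eq_opExp (T : Fock N → Fock N) (F : Fock N) : expOp T F = opExp T F := rfl

theorem quantize_eq_evalOne (G : Mat N) {σ : ℤ} (hσ : σ * σ = 1) (s : ℕ) {B : Op N}
    (hB : ∀ m n, B m n ≠ 0 → ∃ k : ℕ, m = n + (σ * k - σ * s))
    {F : Fock N} (hF : IsTame idxWeight σ F) :
    quantize G B F = evalOne (quantSeries hbar hbar⁻¹ G σ s B) F := by
  rw [quantize_eq_quad]
  exact quad_eq_evalOne hbar hbar⁻¹ G hσ s hB hF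

/-- `A` is the operator of multiplication by the series `Y` in `z ^ σ`, which has no constant
term. -/
structure IsPureMulOp (σ : ℤ) (A : Op N) (Y : PowerSeries (Mat N)) : Prop where
  mulOp : IsMulOp σ A Y
  supp : ∀ m n, A m n ≠ 0 → ∃ k : ℕ, m = n + σ * k
  coeff_zero : PowerSeries.coeff 0 Y = 0

theorem IsPureMulOp.neg {σ : ℤ} {A : Op N} {Y : PowerSeries (Mat N)} (h : IsPureMulOp σ A Y) :
    IsPureMulOp σ (-A) (-Y) where
  mulOp n i := by
    rw [map_neg, ← h.mulOp n i]; rfl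
  supp m n hmn := h.supp m n fun h0 => hmn (by
    change -(A m n) = 0
    rw [h0, neg_zero])
  coeff_zero := by rw [map_neg, h.coeff_zero, neg_zero]

theorem isPureMulOp_opPos {Y : PowerSeries (Mat N)} (h : PowerSeries.coeff 0 Y = 0) :
    IsPureMulOp 1 (opPos Y) Y where
  mulOp n i := by
    simp [opPos]
  supp m n hmn := by
    rw [opPos] at hmn
    split_ifs at hmn with hle
    · exact ⟨(m - n).toNat, by omega⟩
    · exact absurd rfl hmn
  coeff_zero := h

theorem isPureMulOp_opNeg {Y : PowerSeries (Mat N)} (h : PowerSeries.coeff 0 Y = 0) :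
    IsPureMulOp (-1) (opNeg Y) Y where
  mulOp n i := by
    simp [opNeg]
  supp m n hmn := by
    rw [opNeg] at hmn
    split_ifs at hmn with hle
    · exact ⟨(n - m).toNat, by omega⟩
    · exact absurd rfl hmn
  coeff_zero := h

theorem ham_zero (G : Mat N) (f g : Loop N) : ham G 0 f g = 0 := by
  have h : ∀ f : Loop N, (0 : Op N).app f = 0 := by
    intro f
    funext m
    rw [Op.app]
    exact (finsum_congr fun n => Matrix.zero_mulVec _).trans finsum_zero
  have h2 : ∀ g : Loop N, symp G 0 g = 0 := by
    intro g
    rw [symp]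
    refine (finsum_congr fun k => ?_).trans finsum_zero
    rw [Pi.zero_apply, zero_dotProduct, mul_zero]
  rw [ham, h, h, h2, h2]
  simp

variable {K : Type*} [CommRing K] [Algebra ℂ K]

theorem qPart_eq_zero (ħ ħ' : K) (G : Mat N) {A : Op N} {k : ℤ} (h : ∀ n, A (n + k) n = 0) :
    qPart ħ ħ' G A k = 0 := by
  have hp : A.part k = 0 := by
    funext m n
    rw [Op.part]
    split_ifs with hm
    · rw [hm, h]; rfl
    · rfl
  refine LinearMap.ext fun F => MvPowerSeries.ext fun m => ?_
  obtain ⟨s, hs⟩ := (coeff_quad_eventually_eq (coefQQ ħ' G (A.part k)) (finite_coefQP G A k)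
    (finite_coefPP ħ G A k) F m).exists
  change MvPowerSeries.coeff m (quad (coefQQ ħ' G (A.part k)) _ _ F) = _
  rw [hs, coeff_quadFin]
  simp [coefQQ, coefQP, coefPP, hp, ham_zero]

theorem IsPureMulOp.coeff_zero_quantSeries {σ : ℤ} {A : Op N} {Y : PowerSeries (Mat N)}
    (h : IsPureMulOp σ A Y) (ħ ħ' : K) (G : Mat N) :
    PowerSeries.coeff 0 (quantSeries ħ ħ' G σ 0 A) = 0 := by
  rw [quantSeries, PowerSeries.coeff_mk]
  apply qPart_eq_zero
  intro n
  have := h.mulOp 0 n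
  rw [h.coeff_zero] at this
  simpa using this

theorem ham_neg (G : Mat N) (A : Op N) (n n' : ℤ) (v v' : Fin N → ℂ) :
    ham G (-A) (Pi.single n v) (Pi.single n' v') = -ham G A (Pi.single n v) (Pi.single n' v') := by
  rw [ham_single, ham_single]
  simp only [Pi.neg_apply, Matrix.neg_mulVec, neg_dotProduct]
  ring

theorem qPart_neg (ħ ħ' : K) (G : Mat N) (A : Op N) (k : ℤ) :
    qPart ħ ħ' G (-A) k = -qPart ħ ħ' G A k := by
  have hp : (-A).part k = -(A.part k) := by
    funext m n
    change (if m = n + k then -(A m n) else 0) = -(if m = n + k then A m n else 0)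
    split_ifs <;> simp
  refine LinearMap.ext fun F => MvPowerSeries.ext fun m => ?_
  obtain ⟨s, hs, hs'⟩ := ((coeff_quad_eventually_eq (coefQQ ħ' G (A.part k)) (finite_coefQP G A k)
    (finite_coefPP ħ G A k) F m).and (coeff_quad_eventually_eq (coefQQ ħ' G ((-A).part k))
    (finite_coefQP G (-A) k) (finite_coefPP ħ G (-A) k) F m)).exists
  rw [LinearMap.neg_apply, map_neg]
  change MvPowerSeries.coeff m (quad (coefQQ ħ' G ((-A).part k)) _ _ F) =
    -MvPowerSeries.coeff m (quad (coefQQ ħ' G (A.part k)) _ _ F)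
  rw [hs, hs', coeff_quadFin, coeff_quadFin]
  simp only [coefQQ, coefQP, coefPP, hp, qVec, pVec, ham_neg, mul_neg, map_neg, neg_mul,
    Finset.sum_neg_distrib]
  ring

theorem quantSeries_neg (ħ ħ' : K) (G : Mat N) (σ : ℤ) (s : ℕ) (A : Op N) :
    quantSeries ħ ħ' G σ s (-A) = -quantSeries ħ ħ' G σ s A := by
  ext1 n
  rw [map_neg, quantSeries, quantSeries, PowerSeries.coeff_mk, PowerSeries.coeff_mk, qPart_neg]

theorem isGraded_quantSeries_zero (ħ ħ' : K) (G : Mat N) (σ : ℤ) (A : Op N) :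
    IsGraded idxWeight σ 0 (quantSeries ħ ħ' G σ 0 A) := by
  simpa using isGraded_quantSeries ħ ħ' G σ 0 A

/-! ### Exponentials of quantized multiplication operators -/

section Exp

variable {σ : ℤ} {A : Op N} {Y : PowerSeries (Mat N)}

theorem IsPureMulOp.expOp_eq (h : IsPureMulOp σ A Y) (hσ : σ * σ = 1) (G : Mat N) {F : Fock N}
    (hF : IsTame idxWeight σ F) :
    expOp (quantize G A) F = evalOne (expS (quantSeries hbar hbar⁻¹ G σ 0 A)) F := by
  rw [expOp_eq_opExp]
  refine opExp_eq_evalOne hσ (isGraded_quantSeries_zero _ _ G σ A)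
    (h.coeff_zero_quantSeries _ _ G) (fun F hF => quantize_eq_evalOne G hσ 0 ?_ hF) hF
  intro m n hmn
  obtain ⟨k, hk⟩ := h.supp m n hmn
  exact ⟨k, by simpa using hk⟩

theorem IsPureMulOp.expOp_tame (h : IsPureMulOp σ A Y) (hσ : σ * σ = 1) (G : Mat N) {F : Fock N}
    (hF : IsTame idxWeight σ F) : IsTame idxWeight σ (expOp (quantize G A) F) := by
  rw [h.expOp_eq hσ G hF]
  exact IsTame.evalOne hσ (isGraded_quantSeries_zero _ _ G σ A).expS hF

theorem IsPureMulOp.expOp_neg_expOp (h : IsPureMulOp σ A Y) (hσ : σ * σ = 1) (G : Mat N)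
    {F : Fock N} (hF : IsTame idxWeight σ F) :
    expOp (quantize G (-A)) (expOp (quantize G A) F) = F := by
  have g := isGraded_quantSeries_zero hbar hbar⁻¹ G σ A
  rw [h.neg.expOp_eq hσ G (h.expOp_tame hσ G hF), h.expOp_eq hσ G hF, quantSeries_neg,
    ← evalOne_mul hσ g.neg.expS g.expS hF, expS_neg_mul_expS (h.coeff_zero_quantSeries _ _ G),
    evalOne_one]

theorem IsPureMulOp.expOp_expOp_neg (h : IsPureMulOp σ A Y) (hσ : σ * σ = 1) (G : Mat N)
    {F : Fock N} (hF : IsTame idxWeight σ F) :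
    expOp (quantize G A) (expOp (quantize G (-A)) F) = F := by
  have := h.neg.expOp_neg_expOp hσ G hF
  rwa [neg_neg] at this

theorem IsPureMulOp.expOp_C_mul (h : IsPureMulOp σ A Y) (hσ : σ * σ = 1) (G : Mat N)
    {F : Fock N} (hF : IsTame idxWeight σ F) (a : Coef) :
    expOp (quantize G A) (MvPowerSeries.C a * F) =
      MvPowerSeries.C a * expOp (quantize G A) F := by
  have hF' : IsTame idxWeight σ (a • F) := by
    obtain ⟨B, hB⟩ := hF
    exact ⟨B, fun m hm => by rw [map_smul, hB m hm, smul_zero]⟩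
  rw [← MvPowerSeries.smul_eq_C_mul, ← MvPowerSeries.smul_eq_C_mul, h.expOp_eq hσ G hF,
    h.expOp_eq hσ G hF']
  exact evalOne_smul hσ (isGraded_quantSeries_zero _ _ G σ A).expS hF a

/-- Conjugation of a quantized operator by the exponential of a quantized multiplication
operator, up to a constant. -/
theorem IsPureMulOp.conj (h : IsPureMulOp σ A Y) (hσ : σ * σ = 1) {G : Mat N}
    (hG : G.transpose = G) (hG' : IsUnit G.det) {s : ℕ} {B B' : Op N}
    (hA : IsInfSymplectic G A) (hB : IsInfSymplectic G B) (hB' : IsInfSymplectic G B')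
    (hBs : ∀ m n, B m n ≠ 0 → ∃ k : ℕ, m = n + (σ * k - σ * s))
    (hBs' : ∀ m n, B' m n ≠ 0 → ∃ k : ℕ, m = n + (σ * k - σ * s))
    (hBB' : ∀ (j : ℤ) (n : ℕ), ∑ p ∈ antidiagonal n, B (j + σ * n - σ * s) (j + σ * p.2) *
      PowerSeries.coeff p.2 (expS Y) =
        PowerSeries.coeff n (expS Y * PowerSeries.mk fun b => B' (j + σ * b - σ * s) j))
    {P : Fock N} (hP : P ∈ polys N) :
    expOp (quantize G (-A)) (quantize G B (expOp (quantize G A) P)) =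
      quantize G B' P + MvPowerSeries.C (MvPowerSeries.coeff 0
          (PowerSeries.coeff s (conjDefect hbar hbar⁻¹ G σ s A B B') (1 : Fock N))) * P := by
  obtain ⟨P, rfl⟩ := hP
  have hP : IsTame idxWeight σ (P : Fock N) := isTame_coe σ P
  have hEP := h.expOp_tame hσ G hP
  have hBEP : IsTame idxWeight σ (quantize G B (expOp (quantize G A) (P : Fock N))) := by
    rw [quantize_eq_evalOne G hσ s hBs hEP]
    exact IsTame.evalOne hσ (isGraded_quantSeries _ _ G σ s B) hEP
  rw [h.neg.expOp_eq hσ G hBEP, quantize_eq_evalOne G hσ s hBs hEP, h.expOp_eq hσ G hP,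
    quantize_eq_evalOne G hσ s hBs' hP, quantSeries_neg]
  exact evalOne_conj_quantSeries hbar_mul_inv hG hG' hσ hA h.mulOp h.coeff_zero
    (h.coeff_zero_quantSeries _ _ G) hB hB' hBB' P

end Exp

/-- The weight of `q_k` is `2k + 1 ≥ 1` and each level has `N` variables. An upper bound on the
weight therefore bounds both the levels and the exponents, which leaves finitely many monomials. -/
theorem mem_polys_of_tame {F : Fock N} (hF : IsTame idxWeight 1 F) : F ∈ polys N := by
  obtain ⟨B, hB⟩ := hF
  have hfin : (Function.support fun m => MvPowerSeries.coeff m F).Finite := by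
    set M : Idx N →₀ ℕ := ∑ i ∈ range B.toNat ×ˢ (Finset.univ : Finset (Fin N)),
      Finsupp.single i B.toNat with hM
    refine (Set.finite_Iic M).subset fun m hm => ?_
    rw [Function.mem_support] at hm
    have hw : Finsupp.weight idxWeight m < B := by
      by_contra hcon
      exact hm (hB m (by omega))
    rw [Set.mem_Iic]
    intro i
    by_cases hi : m i = 0
    · rw [hi]; exact Nat.zero_le _
    have h1 : (m i : ℤ) * idxWeight i ≤ Finsupp.weight idxWeight m := by
      rw [Finsupp.weight_apply, Finsupp.sum]
      have := Finset.single_le_sum (f := fun i => m i • idxWeight i) (s := m.support)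
        (fun i _ => nsmul_nonneg (idxWeight_pos i).le _) (Finsupp.mem_support_iff.2 hi)
      simpa using this
    have h2 : 1 ≤ (m i : ℤ) := by omega
    have h3 := idxWeight_pos i
    have h4 : (m i : ℤ) ≤ m i * idxWeight i := by nlinarith
    have h5 : idxWeight i ≤ m i * idxWeight i := by nlinarith
    have h8 : idxWeight i = 2 * (i.1 : ℤ) + 1 := rfl
    have h6 : i.1 < B.toNat := by
      have h9 : idxWeight i < B := by linarith
      rw [h8] at h9
      omega
    have h7 : m i ≤ B.toNat := by
      have h9 : (m i : ℤ) < B := by linarith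
      omega
    rw [hM, Finsupp.finsetSum_apply, Finset.sum_eq_single i]
    · simpa using h7
    · intro j _ hj
      rw [Finsupp.single_eq_of_ne (Ne.symm hj)]
    · intro hcon
      exact absurd (by simp [h6]) hcon
  refine ⟨∑ m ∈ hfin.toFinset, MvPolynomial.monomial m (MvPowerSeries.coeff m F), ?_⟩
  refine MvPowerSeries.ext fun m => ?_
  rw [MvPolynomial.coeff_coe, MvPolynomial.coeff_sum]
  simp only [MvPolynomial.coeff_monomial, Finset.sum_ite_eq']
  split_ifs with h
  · rfl
  · rw [Set.Finite.mem_toFinset, Function.mem_support, not_not] at h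
    exact h.symm

theorem tame_of_mem_polys (σ : ℤ) {F : Fock N} (hF : F ∈ polys N) : IsTame idxWeight σ F := by
  obtain ⟨P, rfl⟩ := hF
  exact isTame_coe σ P

theorem tame_neg_one (F : Fock N) : IsTame idxWeight (-1) F :=
  isTame_neg_one (fun i => (idxWeight_pos i).le) F

end Laurent

/-! ### Linear changes of variables -/

section ChangeVar

open Finset

variable {N : ℕ} {K : Type*} [CommRing K] [Algebra ℂ K]

/-- The linear substitution with matrix `A`. -/
def linFam (K : Type*) [CommRing K] [Algebra ℂ K] (A : Mat N) (i : Idx N) :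
    MvPowerSeries (Idx N) K :=
  ∑ b, MvPowerSeries.C (algebraMap ℂ K (A i.2 b)) * MvPowerSeries.X (i.1, b)

theorem hasSubst_linFam (A : Mat N) : MvPowerSeries.HasSubst (linFam K A) where
  const_coeff i := by
    have : MvPowerSeries.constantCoeff (linFam K A i) = 0 := by simp [linFam]
    rw [this]; exact IsNilpotent.zero
  coeff_zero m := by
    classical
    apply ((m.support.image Prod.fst) ×ˢ (Finset.univ : Finset (Fin N))).finite_toSet.subset
    intro i hi
    rw [Set.mem_ofPred_eq, linFam, map_sum] at hi
    obtain ⟨b, -, hb⟩ := Finset.exists_ne_zero_of_sum_ne_zero hi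
    rw [MvPowerSeries.coeff_C_mul, MvPowerSeries.coeff_X] at hb
    have hm : m = Finsupp.single (i.1, b) 1 := by
      by_contra h
      rw [if_neg h, mul_zero] at hb
      exact hb rfl
    simp only [coe_product, Set.mem_prod, coe_univ, Set.mem_univ, and_true, coe_image, Set.mem_image,
      mem_coe, Finsupp.mem_support_iff]
    exact ⟨(i.1, b), by simp [hm], rfl⟩

/-- The linear change of variables as a homomorphism. -/
def linSubst (K : Type*) [CommRing K] [Algebra ℂ K] (A : Mat N) :
    MvPowerSeries (Idx N) K →ₐ[K] MvPowerSeries (Idx N) K :=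
  MvPowerSeries.substAlgHom (hasSubst_linFam A)

theorem linSubst_X (A : Mat N) (i : Idx N) : linSubst K A (MvPowerSeries.X i) = linFam K A i := by
  rw [linSubst, MvPowerSeries.substAlgHom_X]

theorem linSubst_C (A : Mat N) (a : K) :
    linSubst K A (MvPowerSeries.C a) = MvPowerSeries.C a := by
  have h : ∀ a : K, (MvPowerSeries.C a : MvPowerSeries (Idx N) K) = a • 1 := by
    intro a
    rw [MvPowerSeries.smul_eq_C_mul, mul_one]
  rw [h, map_smul, map_one]

theorem linSubst_linFam (A B : Mat N) (i : Idx N) :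
    linSubst K A (linFam K B i) = linFam K (B * A) i := by
  rw [linFam, map_sum]
  simp only [map_mul, linSubst_C, linSubst_X]
  simp only [linFam, Finset.mul_sum, Matrix.mul_apply, map_sum, Finset.sum_mul]
  rw [Finset.sum_comm]
  refine Finset.sum_congr rfl fun b _ => Finset.sum_congr rfl fun a _ => ?_
  rw [map_mul, map_mul, mul_assoc]

theorem linFam_one (i : Idx N) : linFam K (1 : Mat N) i = MvPowerSeries.X i := by
  rw [linFam, Finset.sum_eq_single i.2]
  · simp
  · intro b _ hb
    rw [Matrix.one_apply_ne (Ne.symm hb), map_zero, map_zero, zero_mul]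
  · intro h
    exact absurd (Finset.mem_univ _) h

theorem linSubst_linSubst {A B : Mat N} (h : B * A = 1) (F : MvPowerSeries (Idx N) K) :
    linSubst K A (linSubst K B F) = F := by
  rw [linSubst, linSubst, MvPowerSeries.substAlgHom_apply, MvPowerSeries.substAlgHom_apply,
    MvPowerSeries.subst_comp_subst_apply (hasSubst_linFam B) (hasSubst_linFam A)]
  have : (fun s => MvPowerSeries.subst (linFam K A) (linFam K B s)) = MvPowerSeries.X := by
    funext i
    rw [← MvPowerSeries.substAlgHom_apply (hasSubst_linFam A)]
    change linSubst K A _ = _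
    rw [linSubst_linFam, h, linFam_one]
  rw [this, MvPowerSeries.subst_self, id]

theorem linSubst_coe (A : Mat N) (P : MvPolynomial (Idx N) K) :
    ∃ Q : MvPolynomial (Idx N) K, linSubst K A P = Q := by
  induction P using MvPolynomial.induction_on with
  | C a => exact ⟨MvPolynomial.C a, by rw [MvPolynomial.coe_C, linSubst_C]⟩
  | add P P' h h' =>
    obtain ⟨Q, hQ⟩ := h
    obtain ⟨Q', hQ'⟩ := h'
    exact ⟨Q + Q', by rw [MvPolynomial.coe_add, map_add, hQ, hQ', MvPolynomial.coe_add]⟩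
  | mul_X P i h =>
    obtain ⟨Q, hQ⟩ := h
    refine ⟨Q * ∑ b, MvPolynomial.C (algebraMap ℂ K (A i.2 b)) * MvPolynomial.X (i.1, b), ?_⟩
    rw [MvPolynomial.coe_mul, map_mul, hQ, MvPolynomial.coe_mul, MvPolynomial.coe_X, linSubst_X,
      linFam]
    congr 1
    have := map_sum (MvPolynomial.coeToMvPowerSeries.ringHom (σ := Idx N) (R := K))
      (fun b => MvPolynomial.C (algebraMap ℂ K (A i.2 b)) * MvPolynomial.X (i.1, b)) Finset.univ
    refine Eq.trans (Finset.sum_congr rfl fun b _ => ?_) this.symm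
    rw [map_mul, MvPolynomial.coeToMvPowerSeries.ringHom_apply,
      MvPolynomial.coeToMvPowerSeries.ringHom_apply, MvPolynomial.coe_C, MvPolynomial.coe_X]

/-- The linear operators of negative powers of `z` are multiplications. -/
theorem linOp_of_neg (ħ : K) (G : Mat N) (k : ℕ) (v : Fin N → ℂ) :
    linOp ħ G (-1 - (k : ℤ)) v = ∑ a, algebraMap ℂ K
      ((-1) ^ (-1 - (k : ℤ)) * dotProduct v (G.mulVec (Pi.single a 1))) • mulX (k, a) := by
  classical
  rw [linOp_eq_of_subset ħ G _ v (T := (Finset.univ : Finset (Fin N)).image fun a => (k, a)),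
    Finset.sum_image, Finset.sum_image]
  · rw [add_eq_left.2]
    · refine Finset.sum_congr rfl fun a _ => ?_
      rw [qVec, symp_single_single, if_pos (by simp)]
    · refine Finset.sum_eq_zero fun a _ => ?_
      rw [pVec, symp_single_single, if_neg (by simp only; omega), map_zero, mul_zero, zero_smul]
  · intro a _ b _ h
    exact (Prod.mk.inj h).2
  · intro a _ b _ h
    exact (Prod.mk.inj h).2
  · rintro ⟨i, a⟩ h
    rw [Finset.mem_image]
    refine ⟨a, Finset.mem_univ _, ?_⟩
    simp only at h
    rw [show i = k by omega]

/-- Negative powers of `z` are represented by multiplication operators alone, which an algebra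
homomorphism transports; the relation between `G` and `G'` matches the coefficients. -/
theorem linSubst_linOp (ħ : K) {G G' B : Mat N} (hB : G' = B.transpose * G * B)
    (k : ℕ) (w : Fin N → ℂ) (F : MvPowerSeries (Idx N) K) :
    linSubst K B (linOp ħ G (-1 - (k : ℤ)) (B.mulVec w) F) =
      linOp ħ G' (-1 - (k : ℤ)) w (linSubst K B F) := by
  rw [linOp_of_neg, linOp_of_neg]
  simp only [LinearMap.sum_apply, LinearMap.smul_apply, mulX_apply, map_sum, map_smul, map_mul,
    linSubst_X, linFam]
  simp only [MvPowerSeries.smul_eq_C_mul, Finset.sum_mul, Finset.mul_sum]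
  rw [Finset.sum_comm]
  refine Finset.sum_congr rfl fun b _ => ?_
  have key : dotProduct w (G'.mulVec (Pi.single b 1)) =
      ∑ a, dotProduct (B.mulVec w) (G.mulVec (Pi.single a 1)) * B a b := by
    rw [hB, ← Matrix.mulVec_mulVec, ← Matrix.mulVec_mulVec, Matrix.dotProduct_mulVec,
      Matrix.vecMul_transpose, Matrix.mulVec_single_one]
    simp only [Matrix.mulVec_single_one, Matrix.dotProduct_mulVec]
    simp only [dotProduct, Matrix.vecMul, Matrix.col_apply]
  rw [key]
  simp only [map_sum, map_mul, Finset.mul_sum, Finset.sum_mul]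
  refine Finset.sum_congr rfl fun a _ => ?_
  ring

end ChangeVar

/-! ### Values on constants -/

section One

open Finset

variable {N : ℕ} {K : Type*} [CommRing K] [Algebra ℂ K]

/-- The matrix of the form `ham` on the constant loops. -/
def hamConst (G : Mat N) (A : Op N) : Mat N :=
  -(1 / 4 : ℂ) • ((A (-1) 0).transpose * G + G.transpose * A (-1) 0)

theorem ham_const (G : Mat N) (A : Op N) (v v' : Fin N → ℂ) :
    ham G A (Pi.single 0 v) (Pi.single 0 v') = dotProduct v ((hamConst G A).mulVec v') := by
  rw [ham_single, hamConst, Matrix.smul_mulVec, dotProduct_smul, Matrix.add_mulVec, dotProduct_add]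
  have h1 : dotProduct ((A (-1) 0).mulVec v) (G.mulVec v') =
      dotProduct v (((A (-1) 0).transpose * G).mulVec v') := by
    rw [← Matrix.mulVec_mulVec, Matrix.dotProduct_mulVec v, Matrix.vecMul_transpose]
  have h2 : dotProduct ((A (-1) 0).mulVec v') (G.mulVec v) =
      dotProduct v ((G.transpose * A (-1) 0).mulVec v') := by
    rw [← Matrix.mulVec_mulVec, Matrix.dotProduct_mulVec v, Matrix.vecMul_transpose,
      dotProduct_comm]
  norm_num
  rw [h1, h2]
  ring

theorem coefQQ_const (ħ' : K) (G : Mat N) (A : Op N) (a b : Fin N) :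
    coefQQ ħ' G A (0, a) (0, b) = algebraMap ℂ K (hamConst G A a b) * ħ' := by
  rw [coefQQ, qVec, qVec]
  simp only [Nat.cast_zero]
  rw [ham_const, Matrix.mulVec_single_one, single_one_dotProduct, Matrix.col_apply]

theorem quad_one (a b c : Idx N → Idx N → K) {T : Finset (Idx N)}
    (hT : ∀ i j, a i j ≠ 0 → i ∈ T ∧ j ∈ T) : quad a b c (1 : MvPowerSeries (Idx N) K) =
      ∑ ij ∈ T ×ˢ T, a ij.1 ij.2 • (MvPowerSeries.X ij.1 * MvPowerSeries.X ij.2) := by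
  refine MvPowerSeries.ext fun m => ?_
  rw [map_sum]
  change (∑ᶠ ij : Idx N × Idx N, a ij.1 ij.2 *
      MvPowerSeries.coeff m (MvPowerSeries.X ij.1 * MvPowerSeries.X ij.2 * 1)) +
    (∑ᶠ ij : Idx N × Idx N, b ij.1 ij.2 *
      MvPowerSeries.coeff m (MvPowerSeries.X ij.1 * MvPowerSeries.pderiv K ij.2 1)) +
    (∑ᶠ ij : Idx N × Idx N, c ij.1 ij.2 *
      MvPowerSeries.coeff m (MvPowerSeries.pderiv K ij.1 (MvPowerSeries.pderiv K ij.2 1))) = _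
  have h2 : ∀ j : Idx N, MvPowerSeries.pderiv K j (1 : MvPowerSeries (Idx N) K) = 0 :=
    fun j => Derivation.map_one_eq_zero _
  simp only [h2, mul_zero, map_zero, finsum_zero, add_zero, mul_one]
  rw [finsum_eq_sum_of_support_subset _ (s := T ×ˢ T)]
  · simp only [map_smul, smul_eq_mul]
  · rintro ⟨i, j⟩ h
    rw [Function.mem_support] at h
    have h0 : a i j ≠ 0 := fun h0 => h (by rw [h0, zero_mul])
    obtain ⟨hi, hj⟩ := hT i j h0
    simp [hi, hj]

/-- On `1` only the `q q` part of the hamiltonian survives, and nonnegative powers of `z` have no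
such part. -/
theorem qPart_one_of_nonneg (ħ ħ' : K) (G : Mat N) (A : Op N) {k : ℤ} (hk : 0 ≤ k) :
    qPart ħ ħ' G A k 1 = 0 := by
  refine (quad_one _ _ _ (T := ∅) fun i j h => ?_).trans (by simp)
  have := coefQQ_part_ne_zero h
  omega

theorem qPart_neg_one_one (ħ ħ' : K) (G : Mat N) (A : Op N) :
    qPart ħ ħ' G A (-1) 1 = ∑ a, ∑ b, (algebraMap ℂ K (hamConst G A a b) * ħ') •
      (MvPowerSeries.X (0, a) * MvPowerSeries.X (0, b)) := by
  classical
  refine (quad_one _ _ _ (T := (Finset.univ : Finset (Fin N)).image fun a => (0, a))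
    fun i j h => ?_).trans ?_
  · have h1 := coefQQ_part_ne_zero h
    have h2 : i.1 = 0 := by omega
    have h3 : j.1 = 0 := by omega
    simp only [Finset.mem_image, Finset.mem_univ, true_and]
    exact ⟨⟨i.2, by rw [← h2]⟩, ⟨j.2, by rw [← h3]⟩⟩
  · rw [Finset.sum_product, Finset.sum_image fun a _ b _ h => (Prod.mk.inj h).2]
    refine Finset.sum_congr rfl fun a _ => ?_
    rw [Finset.sum_image fun a _ b _ h => (Prod.mk.inj h).2]
    refine Finset.sum_congr rfl fun b _ => ?_
    rw [← coefQQ_const, coefQQ, coefQQ]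
    simp only [qVec]
    rw [ham_part_of_eq G A (by simp)]

theorem hamConst_conj {G G' B B' : Mat N} (hB : G' = B.transpose * G * B) (hBB : B * B' = 1)
    {T T' : Op N} (hT : T' (-1) 0 = B' * T (-1) 0 * B) :
    hamConst G' T' = B.transpose * hamConst G T * B := by
  have hBB' : B'.transpose * B.transpose = 1 := by
    rw [← Matrix.transpose_mul, hBB, Matrix.transpose_one]
  have e1 : (B' * T (-1) 0 * B).transpose * (B.transpose * G * B) =
      B.transpose * ((T (-1) 0).transpose * G) * B := by
    rw [Matrix.transpose_mul, Matrix.transpose_mul]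
    calc _ = B.transpose * (T (-1) 0).transpose * (B'.transpose * B.transpose) * G * B := by
            noncomm_ring
      _ = _ := by rw [hBB']; noncomm_ring
  have e2 : (B.transpose * G * B).transpose * (B' * T (-1) 0 * B) =
      B.transpose * (G.transpose * T (-1) 0) * B := by
    rw [Matrix.transpose_mul, Matrix.transpose_mul, Matrix.transpose_transpose]
    calc _ = B.transpose * G.transpose * (B * B') * T (-1) 0 * B := by noncomm_ring
      _ = _ := by rw [hBB]; noncomm_ring
  rw [hamConst, hamConst, hT, hB, e1, e2, Matrix.mul_smul, Matrix.smul_mul, mul_add, add_mul]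

theorem linSubst_qPart_one (ħ ħ' : K) {G G' B B' : Mat N} (hB : G' = B.transpose * G * B)
    (hBB : B * B' = 1) {T T' : Op N} (hT : ∀ m n, T' m n = B' * T m n * B) {k : ℤ}
    (hk : k = 0 ∨ k = -1) :
    linSubst K B (qPart ħ ħ' G T k 1) = qPart ħ ħ' G' T' k 1 := by
  rcases hk with rfl | rfl
  · rw [qPart_one_of_nonneg _ _ _ _ le_rfl, qPart_one_of_nonneg _ _ _ _ le_rfl, map_zero]
  · rw [qPart_neg_one_one, qPart_neg_one_one, hamConst_conj hB hBB (hT _ _)]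
    simp only [map_sum, map_mul, linSubst_X, linFam, linSubst_C,
      MvPowerSeries.smul_eq_C_mul]
    simp only [Finset.sum_mul, Finset.mul_sum, Matrix.mul_apply, Matrix.transpose_apply,
      map_sum, map_mul]
    have h1 : ∀ f : Fin N → Fin N → Fin N → Fin N → MvPowerSeries (Idx N) K,
        ∑ a, ∑ b, ∑ d, ∑ c, f a b c d = ∑ c, ∑ d, ∑ b, ∑ a, f a b c d := by
      intro f
      calc _ = ∑ a, ∑ b, ∑ c, ∑ d, f a b c d :=
            Finset.sum_congr rfl fun a _ => Finset.sum_congr rfl fun b _ => Finset.sum_comm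
        _ = ∑ a, ∑ c, ∑ b, ∑ d, f a b c d := Finset.sum_congr rfl fun a _ => Finset.sum_comm
        _ = ∑ c, ∑ a, ∑ b, ∑ d, f a b c d := Finset.sum_comm
        _ = ∑ c, ∑ a, ∑ d, ∑ b, f a b c d := Finset.sum_congr rfl fun c _ =>
            Finset.sum_congr rfl fun a _ => Finset.sum_comm
        _ = ∑ c, ∑ d, ∑ a, ∑ b, f a b c d := Finset.sum_congr rfl fun c _ => Finset.sum_comm
        _ = _ := Finset.sum_congr rfl fun c _ => Finset.sum_congr rfl fun d _ => Finset.sum_comm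
    rw [h1]
    refine Finset.sum_congr rfl fun c _ => Finset.sum_congr rfl fun d _ =>
      Finset.sum_congr rfl fun b _ => Finset.sum_congr rfl fun a _ => ?_
    ring

/-- Linear changes of variables conjugate the quantized operators. -/
theorem linSubst_qPart_linSubst {ħ ħ' : K} (hħ : ħ * ħ' = 1) {G G' B B' : Mat N}
    (hG : G.transpose = G) (hGd : IsUnit G.det) (hB : G' = B.transpose * G * B)
    (hBB : B * B' = 1) {T T' : Op N} (hT : ∀ m n, T' m n = B' * T m n * B)
    (hTs : IsInfSymplectic G T) (hTs' : IsInfSymplectic G' T') {k : ℤ} (hk : k = 0 ∨ k = -1)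
    (P : MvPolynomial (Idx N) K) :
    linSubst K B (qPart ħ ħ' G T k (linSubst K B' (P : MvPowerSeries (Idx N) K))) =
      qPart ħ ħ' G' T' k (P : MvPowerSeries (Idx N) K) := by
  have hBB' : B' * B = 1 := mul_eq_one_comm.1 hBB
  have hG' : G'.transpose = G' := by
    rw [hB, Matrix.transpose_mul, Matrix.transpose_mul, Matrix.transpose_transpose, hG, mul_assoc]
  have hGd' : IsUnit G'.det := by
    rw [hB, Matrix.det_mul, Matrix.det_mul, Matrix.det_transpose]
    have : IsUnit B.det := by
      rw [isUnit_iff_exists_inv]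
      exact ⟨B'.det, by rw [← Matrix.det_mul, hBB, Matrix.det_one]⟩
    exact (this.mul hGd).mul this
  have hB' : G = B'.transpose * G' * B' := by
    have h1 : B'.transpose * B.transpose = 1 := by
      rw [← Matrix.transpose_mul, hBB, Matrix.transpose_one]
    calc G = (B'.transpose * B.transpose) * G * (B * B') := by rw [h1, hBB, one_mul, mul_one]
      _ = _ := by rw [hB]; noncomm_ring
  induction P using MvPolynomial.induction_on with
  | C a =>
    have h : (MvPowerSeries.C a : MvPowerSeries (Idx N) K) = a • 1 := by
      rw [MvPowerSeries.smul_eq_C_mul, mul_one]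
    rw [MvPolynomial.coe_C, linSubst_C, h, map_smul, map_smul, map_smul,
      linSubst_qPart_one ħ ħ' hB hBB hT hk]
  | add P Q hP hQ =>
    rw [MvPolynomial.coe_add, map_add, map_add, map_add, map_add, hP, hQ]
  | mul_X P i hP =>
    -- Multiplication by `q_i` is written as the linear operator of `w z ^ (-1 - i)`; moving both
    -- quantized operators past it and using the claim for `P` leaves a comparison of two linear
    -- operators.
    set w : Fin N → ℂ := (-1 : ℂ) ^ (i.1 + 1) • G'⁻¹.mulVec (Pi.single i.2 1) with hw
    have hBw : w = B'.mulVec (B.mulVec w) := by rw [Matrix.mulVec_mulVec, hBB', Matrix.one_mulVec]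
    have hX : linOp ħ G' (-1 - (i.1 : ℤ)) w = mulX i := linOp_pVec ħ hG' hGd' i
    rw [MvPolynomial.coe_mul, MvPolynomial.coe_X, mul_comm, ← mulX_apply, ← hX]
    conv_lhs => rw [hBw]
    rw [linSubst_linOp ħ hB', ← Module.End.mul_apply, ← Module.End.mul_apply,
      qPart_mul_linOp hħ hG hGd hTs, qPart_mul_linOp hħ hG' hGd' hTs', LinearMap.add_apply,
      LinearMap.add_apply, map_add, Module.End.mul_apply, Module.End.mul_apply,
      linSubst_linOp ħ hB, hP]
    congr 1
    -- Parts of degree `0` and `-1` keep negative powers of `z` negative, so the new linear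
    -- operators are again multiplications.
    obtain ⟨l, hl⟩ : ∃ l : ℕ, -1 - (i.1 : ℤ) + k = -1 - (l : ℤ) := by
      rcases hk with rfl | rfl
      · exact ⟨i.1, by ring⟩
      · exact ⟨i.1 + 1, by push_cast; ring⟩
    rw [hl, hT, ← Matrix.mulVec_mulVec, ← Matrix.mulVec_mulVec]
    set y := (T (-1 - (l : ℤ)) (-1 - (i.1 : ℤ))).mulVec (B.mulVec w) with hy
    have hBy : y = B.mulVec (B'.mulVec y) := by rw [Matrix.mulVec_mulVec, hBB, Matrix.one_mulVec]
    conv_lhs => rw [hBy]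
    rw [linSubst_linOp ħ hB, linSubst_linSubst hBB']

theorem quad_eq_qPart_add (ħ ħ' : K) (G : Mat N) {T : Op N}
    (hT : ∀ m n, T m n ≠ 0 → m = n ∨ m = n - 1) {F : MvPowerSeries (Idx N) K}
    (hF : IsTame idxWeight 1 F) : quad (coefQQ ħ' G T) (coefQP K G T) (coefPP ħ G T) F =
      qPart ħ ħ' G T (-1) F + qPart ħ ħ' G T 0 F := by
  rw [quad_eq_evalOne ħ ħ' G (σ := 1) (by norm_num) 1 ?_ hF]
  · refine MvPowerSeries.ext fun m => ?_
    change ∑ᶠ n : ℕ, MvPowerSeries.coeff m (PowerSeries.coeff n (quantSeries ħ ħ' G 1 1 T) F) = _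
    rw [finsum_eq_sum_of_support_subset _ (s := Finset.range 2)]
    · rw [Finset.sum_range_succ, Finset.sum_range_one, map_add]
      simp [quantSeries]
    · intro n hn
      simp only [coe_range, Set.mem_Iio]
      by_contra hcon
      apply hn
      simp only [quantSeries, PowerSeries.coeff_mk]
      rw [qPart_eq_zero]
      · simp
      · intro i
        by_contra h0
        have := hT _ _ h0
        push_cast at this
        omega
  · intro m n h0
    rcases hT m n h0 with h | h
    · exact ⟨1, by push_cast; omega⟩
    · exact ⟨0, by push_cast; omega⟩

end One

/-! ### Linear changes of variables over `ℂ((ħ))` -/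

section Coefficients

variable {N : ℕ}

attribute [local instance 2000] coefAlgebra coefEndAlgebra

theorem changeVar_eq_linSubst (A : Mat N) (F : Fock N) : changeVar A F = linSubst Coef A F := by
  rw [linSubst, MvPowerSeries.substAlgHom_apply]
  rfl

theorem changeVar_mem_polys (A : Mat N) {F : Fock N} (hF : F ∈ polys N) :
    changeVar A F ∈ polys N := by
  obtain ⟨P, rfl⟩ := hF
  obtain ⟨Q, hQ⟩ := linSubst_coe A P
  exact ⟨Q, by rw [changeVar_eq_linSubst, hQ]⟩

theorem changeVar_changeVar {A B : Mat N} (h : B * A = 1) (F : Fock N) :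
    changeVar A (changeVar B F) = F := by
  rw [changeVar_eq_linSubst, changeVar_eq_linSubst, linSubst_linSubst h]

theorem changeVar_C_mul (A : Mat N) (a : Coef) (F : Fock N) :
    changeVar A (MvPowerSeries.C a * F) = MvPowerSeries.C a * changeVar A F := by
  rw [changeVar_eq_linSubst, changeVar_eq_linSubst, map_mul, linSubst_C]

theorem changeVar_quantize_changeVar {G G' B B' : Mat N}
    (hG : G.transpose = G) (hGd : IsUnit G.det) (hB : G' = B.transpose * G * B)
    (hBB : B * B' = 1) {T T' : Op N} (hT : ∀ m n, T' m n = B' * T m n * B)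
    (hTs : IsInfSymplectic G T) (hTs' : IsInfSymplectic G' T')
    (hTd : ∀ m n, T m n ≠ 0 → m = n ∨ m = n - 1) {F : Fock N} (hF : F ∈ polys N) :
    changeVar B (quantize G T (changeVar B' F)) = quantize G' T' F := by
  have hTd' : ∀ m n, T' m n ≠ 0 → m = n ∨ m = n - 1 := by
    intro m n h
    refine hTd m n fun h0 => h ?_
    rw [hT, h0, mul_zero, zero_mul]
  rw [quantize_eq_quad, quantize_eq_quad,
    quad_eq_qPart_add hbar hbar⁻¹ G hTd (tame_of_mem_polys 1 (changeVar_mem_polys B' hF)),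
    quad_eq_qPart_add hbar hbar⁻¹ G' hTd' (tame_of_mem_polys 1 hF),
    changeVar_eq_linSubst, changeVar_eq_linSubst, map_add]
  obtain ⟨P, rfl⟩ := hF
  rw [linSubst_qPart_linSubst hbar_mul_inv hG hGd hB hBB hT hTs hTs' (Or.inr rfl) P,
    linSubst_qPart_linSubst hbar_mul_inv hG hGd hB hBB hT hTs hTs' (Or.inl rfl) P]

end Coefficients

/-! ### Conjugation of operators by one-sided series -/

section Conjugation

open Finset

variable {N : ℕ}

theorem sum_antidiagonal_assoc {M : Type*} [AddCommMonoid M] (f : ℕ → ℕ → ℕ → M) (n : ℕ) :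
    ∑ p ∈ antidiagonal n, ∑ q ∈ antidiagonal p.1, f q.1 q.2 p.2 =
      ∑ p ∈ antidiagonal n, ∑ q ∈ antidiagonal p.2, f p.1 q.1 q.2 := by
  rw [Finset.sum_sigma', Finset.sum_sigma']
  refine Finset.sum_nbij' (fun x => ⟨(x.2.1, x.2.2 + x.1.2), (x.2.2, x.1.2)⟩)
    (fun x => ⟨(x.1.1 + x.2.1, x.2.2), (x.1.1, x.2.1)⟩) ?_ ?_ ?_ ?_ ?_
  · rintro ⟨⟨a, b⟩, ⟨c, d⟩⟩ h
    simp only [mem_sigma, HasAntidiagonal.mem_antidiagonal, and_true] at h ⊢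
    omega
  · rintro ⟨⟨a, b⟩, ⟨c, d⟩⟩ h
    simp only [mem_sigma, HasAntidiagonal.mem_antidiagonal, and_true] at h ⊢
    omega
  · rintro ⟨⟨a, b⟩, ⟨c, d⟩⟩ h
    simp only [mem_sigma, HasAntidiagonal.mem_antidiagonal] at h ⊢
    obtain ⟨h1, h2⟩ := h
    subst h2
    rfl
  · rintro ⟨⟨a, b⟩, ⟨c, d⟩⟩ h
    simp only [mem_sigma, HasAntidiagonal.mem_antidiagonal] at h ⊢
    obtain ⟨h1, h2⟩ := h
    subst h2
    rfl
  · rintro ⟨⟨a, b⟩, ⟨c, d⟩⟩ h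
    rfl

theorem exists_ne_zero_of_finsum {α M : Type*} [AddCommMonoid M] {f : α → M}
    (h : ∑ᶠ a, f a ≠ 0) : ∃ a, f a ≠ 0 := by
  by_contra hcon
  push Not at hcon
  exact h (by simp [hcon])

/-- Multiplication by a series in `z ^ σ`. -/
def mulOp (σ : ℤ) (Y : PowerSeries (Mat N)) : Op N :=
  fun m n => if 0 ≤ σ * (m - n) then PowerSeries.coeff (σ * (m - n)).toNat Y else 0

theorem opPos_eq (Y : PowerSeries (Mat N)) : opPos Y = mulOp 1 Y := by
  funext m n
  simp only [opPos, mulOp, one_mul, sub_nonneg]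

theorem opNeg_eq (Y : PowerSeries (Mat N)) : opNeg Y = mulOp (-1) Y := by
  funext m n
  simp only [opNeg, mulOp, neg_mul, one_mul, neg_sub, sub_nonneg]

theorem mulOp_apply {σ : ℤ} (hσ : σ * σ = 1) (Y : PowerSeries (Mat N)) (n : ℕ) (i : ℤ) :
    mulOp σ Y (i + σ * n) i = PowerSeries.coeff n Y := by
  have : σ * (i + σ * n - i) = n := by
    rw [add_sub_cancel_left, ← mul_assoc, hσ, one_mul]
  rw [mulOp, this, if_pos (Int.natCast_nonneg n), Int.toNat_natCast]

theorem mulOp_supp {σ : ℤ} (hσ : σ * σ = 1) {Y : PowerSeries (Mat N)} {m n : ℤ}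
    (h : mulOp σ Y m n ≠ 0) : ∃ k : ℕ, m = n + σ * k := by
  rw [mulOp] at h
  split_ifs at h with h0
  · refine ⟨(σ * (m - n)).toNat, ?_⟩
    rw [Int.toNat_of_nonneg h0, ← mul_assoc, hσ]
    ring
  · exact absurd rfl h

/-- `B` involves only the powers `z ^ (σ b - σ s)` with `b ≥ 0`. -/
def HasSupp (σ : ℤ) (s : ℕ) (B : Op N) : Prop :=
  ∀ m n, B m n ≠ 0 → ∃ k : ℕ, m = n + (σ * k - σ * s)

theorem mul_left_injective_of_sq {σ : ℤ} (hσ : σ * σ = 1) {a b : ℤ} (h : σ * a = σ * b) :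
    a = b := by
  have : (σ * σ) * a = (σ * σ) * b := by rw [mul_assoc, h, mul_assoc]
  rwa [hσ, one_mul, one_mul] at this

theorem mulOp_comp {σ : ℤ} (hσ : σ * σ = 1) {s : ℕ} (Y : PowerSeries (Mat N)) {B : Op N}
    (hB : HasSupp σ s B) (M : ℕ) (k : ℤ) :
    Op.comp (mulOp σ Y) B (k + (σ * M - σ * s)) k = ∑ p ∈ antidiagonal M,
      PowerSeries.coeff p.1 Y * B (k + (σ * p.2 - σ * s)) k := by
  classical
  rw [Op.comp, finsum_eq_sum_of_support_subset _
    (s := (antidiagonal M).image fun p => k + (σ * p.2 - σ * s)), Finset.sum_image]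
  · refine Finset.sum_congr rfl fun p hp => ?_
    rw [HasAntidiagonal.mem_antidiagonal] at hp
    rw [← hp, show k + (σ * ((p.1 + p.2 : ℕ) : ℤ) - σ * s) = k + (σ * p.2 - σ * s) + σ * p.1 by
      push_cast; ring, mulOp_apply hσ]
  · intro p hp q hq h
    have h2 : (p.2 : ℤ) = q.2 := mul_left_injective_of_sq hσ (by simpa using h)
    simp only [mem_coe, HasAntidiagonal.mem_antidiagonal] at hp hq
    exact Prod.ext (by omega) (by exact_mod_cast h2)
  · intro l hl
    rw [Function.mem_support] at hl
    obtain ⟨b, hb⟩ := hB l k (right_ne_zero_of_mul hl)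
    obtain ⟨a, ha⟩ := mulOp_supp hσ (left_ne_zero_of_mul hl)
    have : (M : ℤ) = a + b := mul_left_injective_of_sq hσ (by rw [mul_add]; linarith)
    rw [coe_image]
    exact ⟨(a, b), by simp only [mem_coe, HasAntidiagonal.mem_antidiagonal]; omega, hb.symm⟩

theorem hasSupp_mulOp_comp {σ : ℤ} (hσ : σ * σ = 1) {s : ℕ} (Y : PowerSeries (Mat N)) {B : Op N}
    (hB : HasSupp σ s B) : HasSupp σ s (Op.comp (mulOp σ Y) B) := by
  intro m n h
  obtain ⟨l, hl⟩ := exists_ne_zero_of_finsum h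
  obtain ⟨b, hb⟩ := hB l n (right_ne_zero_of_mul hl)
  obtain ⟨a, ha⟩ := mulOp_supp hσ (left_ne_zero_of_mul hl)
  exact ⟨a + b, by rw [ha, hb]; push_cast; ring⟩

theorem comp_mulOp {σ : ℤ} (hσ : σ * σ = 1) {s : ℕ} (Z : PowerSeries (Mat N)) {B : Op N}
    (hB : HasSupp σ s B) (M : ℕ) (j : ℤ) :
    Op.comp B (mulOp σ Z) (j + (σ * M - σ * s)) j = ∑ p ∈ antidiagonal M,
      B (j + (σ * M - σ * s)) (j + σ * p.2) * PowerSeries.coeff p.2 Z := by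
  classical
  rw [Op.comp, finsum_eq_sum_of_support_subset _
    (s := (antidiagonal M).image fun p => j + σ * p.2), Finset.sum_image]
  · refine Finset.sum_congr rfl fun p hp => ?_
    rw [mulOp_apply hσ]
  · intro p hp q hq h
    have h2 : (p.2 : ℤ) = q.2 := mul_left_injective_of_sq hσ (by simpa using h)
    simp only [mem_coe, HasAntidiagonal.mem_antidiagonal] at hp hq
    exact Prod.ext (by omega) (by exact_mod_cast h2)
  · intro l hl
    rw [Function.mem_support] at hl
    obtain ⟨b, hb⟩ := hB _ l (left_ne_zero_of_mul hl)
    obtain ⟨a, ha⟩ := mulOp_supp hσ (right_ne_zero_of_mul hl)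
    have : (M : ℤ) = b + a := mul_left_injective_of_sq hσ (by rw [mul_add]; linarith)
    rw [coe_image]
    exact ⟨(b, a), by simp only [mem_coe, HasAntidiagonal.mem_antidiagonal]; omega, ha.symm⟩

theorem hasSupp_comp_mulOp {σ : ℤ} (hσ : σ * σ = 1) {s : ℕ} (Z : PowerSeries (Mat N)) {B : Op N}
    (hB : HasSupp σ s B) : HasSupp σ s (Op.comp B (mulOp σ Z)) := by
  intro m n h
  obtain ⟨l, hl⟩ := exists_ne_zero_of_finsum h
  obtain ⟨b, hb⟩ := hB m l (left_ne_zero_of_mul hl)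
  obtain ⟨a, ha⟩ := mulOp_supp hσ (right_ne_zero_of_mul hl)
  exact ⟨b + a, by rw [hb, ha]; push_cast; ring⟩

/-- The relation `B Z = Z B'`. -/
def Intertwines (σ : ℤ) (s : ℕ) (Z : PowerSeries (Mat N)) (B B' : Op N) : Prop :=
  ∀ (j : ℤ) (n : ℕ), ∑ p ∈ antidiagonal n, B (j + σ * n - σ * s) (j + σ * p.2) *
    PowerSeries.coeff p.2 Z =
      PowerSeries.coeff n (Z * PowerSeries.mk fun b => B' (j + σ * b - σ * s) j)

/-- Multiplying `B Z = Z B'` on the left by `Y = Z⁻¹`. One-sided supports make each entry a finite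
sum over an antidiagonal, so the triple product may be reassociated; outside the support both sides
are zero. -/
theorem Intertwines.comp_eq {σ : ℤ} (hσ : σ * σ = 1) {s : ℕ} {Y Z : PowerSeries (Mat N)}
    (hYZ : Y * Z = 1) {B B' : Op N} (hB : HasSupp σ s B) (hB' : HasSupp σ s B')
    (h : Intertwines σ s Z B B') :
    Op.comp (Op.comp (mulOp σ Y) B) (mulOp σ Z) = B' := by
  have h1 := hasSupp_mulOp_comp hσ Y hB
  have h2 := hasSupp_comp_mulOp hσ Z h1
  funext m j
  by_cases hm : ∃ M : ℕ, m = j + (σ * M - σ * s)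
  · obtain ⟨M, rfl⟩ := hm
    rw [comp_mulOp hσ Z h1]
    have e1 : ∀ p ∈ antidiagonal M, Op.comp (mulOp σ Y) B (j + (σ * M - σ * s)) (j + σ * p.2) *
        PowerSeries.coeff p.2 Z = ∑ q ∈ antidiagonal p.1, PowerSeries.coeff q.1 Y *
          (B (j + σ * (q.2 + p.2 : ℕ) - σ * s) (j + σ * p.2) * PowerSeries.coeff p.2 Z) := by
      intro p hp
      rw [HasAntidiagonal.mem_antidiagonal] at hp
      rw [← hp, show j + (σ * ((p.1 + p.2 : ℕ) : ℤ) - σ * s) = j + σ * p.2 + (σ * p.1 - σ * s) by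
        push_cast; ring, mulOp_comp hσ Y hB, Finset.sum_mul]
      refine Finset.sum_congr rfl fun q _ => ?_
      rw [mul_assoc]
      congr 3
      push_cast; ring
    rw [Finset.sum_congr rfl e1, sum_antidiagonal_assoc fun a b c => PowerSeries.coeff a Y *
      (B (j + σ * (b + c : ℕ) - σ * s) (j + σ * c) * PowerSeries.coeff c Z)]
    have e2 : ∀ p ∈ antidiagonal M, ∑ q ∈ antidiagonal p.2, PowerSeries.coeff p.1 Y *
        (B (j + σ * (q.1 + q.2 : ℕ) - σ * s) (j + σ * q.2) * PowerSeries.coeff q.2 Z) =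
        PowerSeries.coeff p.1 Y * PowerSeries.coeff p.2
          (Z * PowerSeries.mk fun b => B' (j + σ * b - σ * s) j) := by
      intro p _
      rw [← h j p.2, Finset.mul_sum]
      refine Finset.sum_congr rfl fun q hq => ?_
      rw [HasAntidiagonal.mem_antidiagonal] at hq
      rw [hq]
    rw [Finset.sum_congr rfl e2, ← PowerSeries.coeff_mul, ← mul_assoc, hYZ, one_mul,
      PowerSeries.coeff_mk, add_sub_assoc]
  · have ha : Op.comp (Op.comp (mulOp σ Y) B) (mulOp σ Z) m j = 0 := by
      by_contra hne
      exact hm (h2 m j hne)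
    have hb : B' m j = 0 := by
      by_contra hne
      exact hm (hB' m j hne)
    rw [ha, hb]

theorem opConst_comp (A : Mat N) (B : Op N) (m n : ℤ) :
    Op.comp (opConst A) B m n = A * B m n := by
  rw [Op.comp, finsum_eq_single _ m]
  · rw [opConst, if_pos rfl]
  · intro k hk
    rw [opConst, if_neg (Ne.symm hk), zero_mul]

theorem comp_opConst (A : Mat N) (B : Op N) (m n : ℤ) :
    Op.comp B (opConst A) m n = B m n * A := by
  rw [Op.comp, finsum_eq_single _ n]
  · rw [opConst, if_pos rfl]
  · intro k hk
    rw [opConst, if_neg hk, mul_zero]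

/-! ### The operators `z ∂ + 1/2 - μ + 𝓔/z` -/

/-- The operator `z ∂ + 1/2 - μ + 𝓔/z`. -/
def shiftOp (μ 𝓔 : Mat N) : Op N := fun m n =>
  if m = n then ((n : ℂ) + 1 / 2) • (1 : Mat N) - μ else if m = n - 1 then 𝓔 else 0

theorem shiftOp_self (μ 𝓔 : Mat N) (n : ℤ) :
    shiftOp μ 𝓔 n n = ((n : ℂ) + 1 / 2) • (1 : Mat N) - μ := by
  rw [shiftOp, if_pos rfl]

theorem shiftOp_sub_one (μ 𝓔 : Mat N) {m n : ℤ} (h : m = n - 1) : shiftOp μ 𝓔 m n = 𝓔 := by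
  rw [shiftOp, if_neg (by omega), if_pos h]

theorem shiftOp_of_ne (μ 𝓔 : Mat N) {m n : ℤ} (h : m ≠ n) (h' : m ≠ n - 1) :
    shiftOp μ 𝓔 m n = 0 := by
  rw [shiftOp, if_neg h, if_neg h']

theorem shiftOp_ne_zero {μ 𝓔 : Mat N} {m n : ℤ} (h : shiftOp μ 𝓔 m n ≠ 0) :
    m = n ∨ m = n - 1 := by
  by_contra hcon
  push Not at hcon
  exact h (shiftOp_of_ne μ 𝓔 hcon.1 hcon.2)

theorem virasoro_eq_shiftOp (μ : Mat N) : virasoro μ = shiftOp μ 0 := by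
  funext m n
  rw [virasoro, shiftOp]
  split_ifs <;> rfl

theorem hasSupp_shiftOp_neg (μ 𝓔 : Mat N) : HasSupp (-1) 0 (shiftOp μ 𝓔) := by
  intro m n h
  rcases shiftOp_ne_zero h with h | h
  · exact ⟨0, by push_cast; omega⟩
  · exact ⟨1, by push_cast; omega⟩

theorem hasSupp_shiftOp_pos (μ 𝓔 : Mat N) : HasSupp 1 1 (shiftOp μ 𝓔) := by
  intro m n h
  rcases shiftOp_ne_zero h with h | h
  · exact ⟨1, by push_cast; omega⟩
  · exact ⟨0, by push_cast; omega⟩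

/-- The residue pairing exchanges `z^n` and `z^{-1-n}`, which sends `n + 1/2` to its negative: this
is what the summand `1/2` in `l₀` is for. In the pole term the sign comes from `z ↦ -z`, so `𝓔` has
to be self-adjoint while `μ` is anti-self-adjoint. -/
theorem isInfSymplectic_shiftOp {G μ 𝓔 : Mat N} (hμ : μ.transpose * G = -(G * μ))
    (h𝓔 : 𝓔.transpose * G = G * 𝓔) : IsInfSymplectic G (shiftOp μ 𝓔) := by
  intro p n
  by_cases h1 : p = n
  · subst h1
    rw [shiftOp_self, shiftOp_self, ← smul_neg]
    congr 1
    rw [Matrix.transpose_sub, Matrix.transpose_smul, Matrix.transpose_one, sub_mul, hμ, mul_sub,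
      Matrix.smul_mul, Matrix.mul_smul, one_mul, mul_one]
    push_cast
    module
  · by_cases h2 : p = n - 1
    · rw [shiftOp_sub_one _ _ h2, shiftOp_sub_one _ _ (by omega), h𝓔, h2,
        zpow_sub_one₀ (by norm_num)]
      norm_num
    · rw [shiftOp_of_ne _ _ h1 h2, shiftOp_of_ne _ _ (by omega) (by omega)]
      simp

theorem isInfSymplectic_mulOp {σ : ℤ} (hσ : σ * σ = 1) {G : Mat N} {Y : PowerSeries (Mat N)}
    (h : ∀ k, (PowerSeries.coeff k Y).transpose * G =
      -((-1 : ℂ) ^ k • (G * PowerSeries.coeff k Y))) : IsInfSymplectic G (mulOp σ Y) := by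
  intro p n
  by_cases hp : ∃ k : ℕ, p = n + σ * k
  · obtain ⟨k, rfl⟩ := hp
    have e : (-1 : ℤ) - n = -1 - (n + σ * k) + σ * k := by ring
    rw [e, mulOp_apply hσ, mulOp_apply hσ, h, smul_neg, smul_smul]
    congr 2
    have hs : (-1 : ℂ) ^ (σ * (k : ℤ)) = (-1) ^ k := by
      have : σ = 1 ∨ σ = -1 := by
        rcases Int.eq_one_or_neg_one_of_mul_eq_one hσ with h | h <;> simp [h]
      rcases this with rfl | rfl
      · rw [one_mul, zpow_natCast]
      · rw [neg_one_mul, zpow_neg, zpow_natCast, ← inv_pow]; norm_num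
    rw [zpow_add₀ (by norm_num), hs, mul_assoc, ← pow_add, ← two_mul, pow_mul]
    norm_num
  · have h1 : mulOp σ Y p n = 0 := by
      by_contra hne
      exact hp (mulOp_supp hσ hne)
    have h2 : mulOp σ Y (-1 - n) (-1 - p) = 0 := by
      by_contra hne
      obtain ⟨k, hk⟩ := mulOp_supp hσ hne
      exact hp ⟨k, by linarith⟩
    rw [h1, h2]
    simp

theorem IsInfSymplectic.neg {G : Mat N} {A : Op N} (h : IsInfSymplectic G A) :
    IsInfSymplectic G (-A) := by
  intro p n
  have := h p n
  change (-1 : ℂ) ^ p • ((-(A p n)).transpose * G) = -((-1 : ℂ) ^ n • (G * -(A (-1 - n) (-1 - p))))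
  rw [Matrix.transpose_neg, neg_mul, mul_neg, smul_neg, smul_neg, this]

/-- The hypotheses are the coefficients of `z^0` and `z^{-n-1}` in the intertwining relation; `-(n +
1)` is produced by `z ∂` acting on `z^{-n-1}`, and the summand `1/2` cancels. -/
theorem intertwines_shiftOp_neg {Z : PowerSeries (Mat N)} {μ μ' 𝓔 𝓔' : Mat N}
    (h0 : μ * PowerSeries.coeff 0 Z = PowerSeries.coeff 0 Z * μ')
    (h : ∀ n : ℕ, -((n : ℂ) + 1) • PowerSeries.coeff (n + 1) Z - μ * PowerSeries.coeff (n + 1) Z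
      + PowerSeries.coeff (n + 1) Z * μ' + 𝓔 * PowerSeries.coeff n Z
      - PowerSeries.coeff n Z * 𝓔' = 0) :
    Intertwines (-1) 0 Z (shiftOp μ 𝓔) (shiftOp μ' 𝓔') := by
  intro j n
  rw [PowerSeries.coeff_mul]
  simp only [PowerSeries.coeff_mk]
  rcases n with _ | n
  · simp only [Finset.Nat.antidiagonal_zero, Finset.sum_singleton, Nat.cast_zero, mul_zero, add_zero,
      sub_zero, shiftOp_self, sub_mul, mul_sub, h0, Matrix.smul_mul, Matrix.mul_smul, one_mul,
      mul_one]
  · rw [Finset.sum_eq_add_of_mem (0, n + 1) (1, n) (by simp) (by simp [add_comm]) (by simp),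
      Finset.sum_eq_add_of_mem (n + 1, 0) (n, 1) (by simp) (by simp) (by simp)]
    · simp only [Nat.cast_zero, mul_zero, add_zero, sub_zero, shiftOp_self]
      rw [shiftOp_sub_one μ 𝓔 (by push_cast; ring), shiftOp_sub_one μ' 𝓔' (by push_cast; ring),
        sub_mul, mul_sub, Matrix.smul_mul, Matrix.mul_smul, one_mul, mul_one, ← sub_eq_zero,
        ← h n]
      push_cast
      module
    · rintro ⟨a, b⟩ hab ⟨hc, hc'⟩
      simp only [HasAntidiagonal.mem_antidiagonal] at hab
      rw [shiftOp_of_ne, mul_zero]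
      · intro h1; apply hc; simp only [Prod.mk.injEq]; push_cast at h1; omega
      · intro h1; apply hc'; simp only [Prod.mk.injEq]; push_cast at h1; omega
    · rintro ⟨a, b⟩ hab ⟨hc, hc'⟩
      simp only [HasAntidiagonal.mem_antidiagonal] at hab
      rw [shiftOp_of_ne, zero_mul]
      · intro h1; apply hc; simp only [Prod.mk.injEq]; push_cast at h1; omega
      · intro h1; apply hc'; simp only [Prod.mk.injEq]; push_cast at h1; omega

/-- Here the pole gives the lowest power: `h0` is the coefficient of `z^{-1}` and `h n` that of
`z^n`. -/
theorem intertwines_shiftOp_pos {Z : PowerSeries (Mat N)} {μ μ' 𝓔 𝓔' : Mat N}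
    (h0 : 𝓔 * PowerSeries.coeff 0 Z = PowerSeries.coeff 0 Z * 𝓔')
    (h : ∀ n : ℕ, (n : ℂ) • PowerSeries.coeff n Z - μ * PowerSeries.coeff n Z
      + PowerSeries.coeff n Z * μ' + 𝓔 * PowerSeries.coeff (n + 1) Z
      - PowerSeries.coeff (n + 1) Z * 𝓔' = 0) :
    Intertwines 1 1 Z (shiftOp μ 𝓔) (shiftOp μ' 𝓔') := by
  intro j n
  rw [PowerSeries.coeff_mul]
  simp only [PowerSeries.coeff_mk]
  rcases n with _ | n
  · simp only [Finset.Nat.antidiagonal_zero, Finset.sum_singleton, Nat.cast_zero, mul_zero, add_zero]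
    rw [shiftOp_sub_one _ _ (by ring), shiftOp_sub_one _ _ (by ring), h0]
  · rw [Finset.sum_eq_add_of_mem (0, n + 1) (1, n) (by simp) (by simp [add_comm]) (by simp),
      Finset.sum_eq_add_of_mem (n + 1, 0) (n, 1) (by simp) (by simp) (by simp)]
    · simp only [one_mul, Nat.cast_zero, Nat.cast_one, add_zero, add_sub_cancel_right,
        shiftOp_self]
      rw [shiftOp_sub_one μ 𝓔 (by push_cast; ring), shiftOp_sub_one μ' 𝓔' (by push_cast; ring),
        show j + ((n + 1 : ℕ) : ℤ) - 1 = j + (n : ℤ) by push_cast; ring, shiftOp_self,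
        sub_mul, mul_sub, Matrix.smul_mul, Matrix.mul_smul, one_mul, mul_one, ← sub_eq_zero,
        ← h n]
      push_cast
      module
    · rintro ⟨a, b⟩ hab ⟨hc, hc'⟩
      simp only [HasAntidiagonal.mem_antidiagonal] at hab
      rw [shiftOp_of_ne, mul_zero]
      · intro h1; apply hc'; simp only [Prod.mk.injEq]; push_cast at h1; omega
      · intro h1; apply hc; simp only [Prod.mk.injEq]; push_cast at h1; omega
    · rintro ⟨a, b⟩ hab ⟨hc, hc'⟩
      simp only [HasAntidiagonal.mem_antidiagonal] at hab
      rw [shiftOp_of_ne, zero_mul]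
      · intro h1; apply hc'; simp only [Prod.mk.injEq]; push_cast at h1; omega
      · intro h1; apply hc; simp only [Prod.mk.injEq]; push_cast at h1; omega

/-- Multiplication by `z⁻¹ ∑ W_k z^k`. -/
def poleOp (W : PowerSeries (Mat N)) : Op N := fun m n => mulOp 1 W (m + 1) n

theorem hasSupp_poleOp (W : PowerSeries (Mat N)) : HasSupp 1 1 (poleOp W) := by
  intro m n h
  obtain ⟨k, hk⟩ := mulOp_supp (by norm_num) h
  exact ⟨k, by push_cast; linarith⟩

theorem poleOp_apply (W : PowerSeries (Mat N)) (j : ℤ) (b : ℕ) :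
    poleOp W (j + 1 * b - 1 * (1 : ℕ)) j = PowerSeries.coeff b W := by
  rw [poleOp, ← mulOp_apply (σ := 1) (by norm_num) W b j]
  congr 1
  push_cast; ring

/-- For conjugation by `R` the operator `U/z` must be regarded as a series in `z` with a simple pole
rather than as a series in `z⁻¹`. -/
theorem opNeg_linSeries (U : Mat N) : opNeg (linSeries U) = poleOp (PowerSeries.C U) := by
  funext m n
  rw [opNeg_eq, poleOp, mulOp, mulOp]
  simp only [linSeries, PowerSeries.coeff_mk, PowerSeries.coeff_C]
  split_ifs <;> first | rfl | omega

theorem intertwines_poleOp {Z W W' : PowerSeries (Mat N)} (h : W * Z = Z * W') :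
    Intertwines 1 1 Z (poleOp W) (poleOp W') := by
  intro j n
  have : (PowerSeries.mk fun b : ℕ => poleOp W' (j + 1 * b - 1 * (1 : ℕ)) j) = W' := by
    ext1 b
    rw [PowerSeries.coeff_mk, poleOp_apply]
  rw [this, ← h, PowerSeries.coeff_mul]
  refine Finset.sum_congr rfl fun p hp => ?_
  rw [HasAntidiagonal.mem_antidiagonal] at hp
  congr 1
  rw [← poleOp_apply W (j + 1 * p.2) p.1, ← hp]
  congr 1
  push_cast; ring

theorem isInfSymplectic_poleOp {G : Mat N} {W : PowerSeries (Mat N)}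
    (h : ∀ k, (PowerSeries.coeff k W).transpose * G =
      (-1 : ℂ) ^ k • (G * PowerSeries.coeff k W)) : IsInfSymplectic G (poleOp W) := by
  intro p n
  by_cases hp : ∃ k : ℕ, p + 1 = n + 1 * k
  · obtain ⟨k, hk⟩ := hp
    have h1 : poleOp W p n = PowerSeries.coeff k W := by
      rw [poleOp, hk, mulOp_apply (by norm_num)]
    have h2 : poleOp W (-1 - n) (-1 - p) = PowerSeries.coeff k W := by
      rw [poleOp, show (-1 : ℤ) - n + 1 = -1 - p + 1 * k by linarith, mulOp_apply (by norm_num)]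
    rw [h1, h2, h, smul_smul, ← neg_smul]
    congr 1
    rw [show p = n + k - 1 by linarith, zpow_sub_one₀ (by norm_num), zpow_add₀ (by norm_num),
      zpow_natCast]
    have : (-1 : ℂ) ^ k * (-1) ^ k = 1 := by rw [← pow_add, ← two_mul, pow_mul]; norm_num
    linear_combination (-(-1 : ℂ) ^ n) * this
  · have h1 : poleOp W p n = 0 := by
      by_contra hne
      exact hp (mulOp_supp (by norm_num) hne)
    have h2 : poleOp W (-1 - n) (-1 - p) = 0 := by
      by_contra hne
      obtain ⟨k, hk⟩ := mulOp_supp (σ := 1) (by norm_num) hne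
      exact hp ⟨k, by linarith⟩
    rw [h1, h2]
    simp

end Conjugation

/-! ### The central constants -/

section Constants

open Finset

variable {N : ℕ} {K : Type*} [CommRing K] [Algebra ℂ K]

theorem coeff_zero_mul' {𝓡 : Type*} [Semiring 𝓡] (A B : PowerSeries 𝓡) :
    PowerSeries.coeff 0 (A * B) = PowerSeries.coeff 0 A * PowerSeries.coeff 0 B := by
  simp [PowerSeries.coeff_mul]

theorem coeff_one_mul' {𝓡 : Type*} [Semiring 𝓡] (A B : PowerSeries 𝓡) :
    PowerSeries.coeff 1 (A * B) = PowerSeries.coeff 0 A * PowerSeries.coeff 1 B +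
      PowerSeries.coeff 1 A * PowerSeries.coeff 0 B := by
  rw [PowerSeries.coeff_mul, Finset.Nat.antidiagonal_succ]
  simp

/-- For `s = 0` the relevant part of the defect is the difference of the parts of degree zero of `B`
and `B'`, and both annihilate `1`. Conjugation by `S` or `e^{U/z}` thus has no central term. -/
theorem conjDefect_zero_one (ħ ħ' : K) (G : Mat N) {σ : ℤ} {A : Op N} (B B' : Op N)
    (hT0 : PowerSeries.coeff 0 (quantSeries ħ ħ' G σ 0 A) = 0) :
    PowerSeries.coeff 0 (conjDefect ħ ħ' G σ 0 A B B') 1 = 0 := by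
  have hT0' : PowerSeries.coeff 0 (-quantSeries ħ ħ' G σ 0 A) = 0 := by rw [map_neg, hT0, neg_zero]
  have h : PowerSeries.coeff 0 (conjDefect ħ ħ' G σ 0 A B B') =
      qPart ħ ħ' G B 0 - qPart ħ ħ' G B' 0 := by
    rw [conjDefect, map_sub, coeff_zero_mul', coeff_zero_mul',
      coeff_zero_expS hT0, coeff_zero_expS hT0', one_mul, mul_one, quantSeries, quantSeries,
      PowerSeries.coeff_mk, PowerSeries.coeff_mk]
    simp
  rw [h, LinearMap.sub_apply, qPart_one_of_nonneg _ _ _ _ le_rfl,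
    qPart_one_of_nonneg _ _ _ _ le_rfl, sub_zero]

/-- To this order the defect is `[B̂₋₁, Â₁] + B̂₀ - B̂'₀`, the subscripts being powers of `z`. As
`Â₁`, `B̂₀` and `B̂'₀` annihilate `1`, one half of the commutator survives. -/
theorem conjDefect_one_one (ħ ħ' : K) (G : Mat N) {A : Op N} (B B' : Op N)
    (hT0 : PowerSeries.coeff 0 (quantSeries ħ ħ' G 1 0 A) = 0) :
    PowerSeries.coeff 1 (conjDefect ħ ħ' G 1 1 A B B') 1 =
      -(qPart ħ ħ' G A 1 (qPart ħ ħ' G B (-1) 1)) := by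
  have hT0' : PowerSeries.coeff 0 (-quantSeries ħ ħ' G 1 0 A) = 0 := by rw [map_neg, hT0, neg_zero]
  have h : PowerSeries.coeff 1 (conjDefect ħ ħ' G 1 1 A B B') =
      qPart ħ ħ' G B (-1) * qPart ħ ħ' G A 1 + (qPart ħ ħ' G B 0 -
        qPart ħ ħ' G A 1 * qPart ħ ħ' G B (-1)) - qPart ħ ħ' G B' 0 := by
    rw [conjDefect, map_sub, coeff_one_mul', coeff_one_mul', coeff_zero_mul',
      coeff_zero_expS hT0, coeff_zero_expS hT0', coeff_one_expS hT0, coeff_one_expS hT0', one_mul,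
      mul_one, map_neg]
    simp only [quantSeries, PowerSeries.coeff_mk]
    norm_num
    refine LinearMap.ext fun F => ?_
    simp only [Module.End.mul_apply, LinearMap.add_apply, LinearMap.neg_apply, LinearMap.sub_apply]
    abel
  rw [h]
  simp only [LinearMap.sub_apply, LinearMap.add_apply, Module.End.mul_apply]
  rw [qPart_one_of_nonneg _ _ _ _ le_rfl, qPart_one_of_nonneg _ _ _ _ le_rfl,
    qPart_one_of_nonneg _ _ _ _ zero_le_one]
  simp

theorem coeff_zero_pderiv_pderiv (i j k l : Idx N) :
    MvPowerSeries.coeff 0 (MvPowerSeries.pderiv K i (MvPowerSeries.pderiv K j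
      (MvPowerSeries.X k * MvPowerSeries.X l : MvPowerSeries (Idx N) K))) =
        (if i = k ∧ j = l then 1 else 0) + if i = l ∧ j = k then 1 else 0 := by
  classical
  have hX : ∀ a b : Idx N, MvPowerSeries.pderiv K a (MvPowerSeries.X b : MvPowerSeries (Idx N) K) =
      if a = b then 1 else 0 := by
    intro a b
    have := LinearMap.congr_fun (derX_mul_mulX (K := K) a b) 1
    simp only [Module.End.mul_apply, LinearMap.add_apply, mulX_apply, derX_apply, mul_one] at this
    rw [this, Derivation.map_one_eq_zero, mul_zero, zero_add]
    split_ifs <;> simp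
  rw [Derivation.leibniz, hX, hX, smul_eq_mul, smul_eq_mul, map_add, Derivation.leibniz,
    Derivation.leibniz, hX, hX]
  have h0 : ∀ (p : Prop) [Decidable p], MvPowerSeries.pderiv K i
      (if p then 1 else 0 : MvPowerSeries (Idx N) K) = 0 := by
    intro p _
    split_ifs
    · exact Derivation.map_one_eq_zero _
    · exact map_zero _
  rw [h0, h0, smul_zero, smul_zero, zero_add, zero_add, smul_eq_mul, smul_eq_mul, map_add]
  have h1 : ∀ p q : Prop, ∀ [Decidable p] [Decidable q], MvPowerSeries.coeff 0
      ((if p then 1 else 0 : MvPowerSeries (Idx N) K) * if q then 1 else 0) =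
        if q ∧ p then 1 else 0 := by
    intro p q _ _
    by_cases hp : p <;> by_cases hq : q <;> simp [hp, hq]
  rw [h1, h1, add_comm]

theorem coeff_zero_qPart_one (ħ ħ' : K) (G : Mat N) (A : Op N) (F : MvPowerSeries (Idx N) K) :
    MvPowerSeries.coeff 0 (qPart ħ ħ' G A 1 F) = ∑ a, ∑ b,
      algebraMap ℂ K (ham G A (pVec G (0, a)) (pVec G (0, b))) * ħ *
        MvPowerSeries.coeff 0 (MvPowerSeries.pderiv K (0, a) (MvPowerSeries.pderiv K (0, b) F)) := by
  classical
  change (∑ᶠ ij : Idx N × Idx N, coefQQ ħ' G (A.part 1) ij.1 ij.2 *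
      MvPowerSeries.coeff 0 (MvPowerSeries.X ij.1 * MvPowerSeries.X ij.2 * F)) +
    (∑ᶠ ij : Idx N × Idx N, coefQP K G (A.part 1) ij.1 ij.2 *
      MvPowerSeries.coeff 0 (MvPowerSeries.X ij.1 * MvPowerSeries.pderiv K ij.2 F)) +
    (∑ᶠ ij : Idx N × Idx N, coefPP ħ G (A.part 1) ij.1 ij.2 *
      MvPowerSeries.coeff 0 (MvPowerSeries.pderiv K ij.1 (MvPowerSeries.pderiv K ij.2 F))) = _
  have h0 : ∀ (i : Idx N) (F : MvPowerSeries (Idx N) K),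
      MvPowerSeries.coeff 0 (MvPowerSeries.X i * F) = 0 :=
    fun i F => coeff_X_mul_eq_zero (by simp) F
  simp only [mul_assoc, h0, mul_zero, finsum_zero, zero_add]
  rw [finsum_eq_sum_of_support_subset _ (s := ((Finset.univ : Finset (Fin N)).image
    fun a => ((0, a) : Idx N)) ×ˢ (Finset.univ : Finset (Fin N)).image fun a => (0, a)),
    Finset.sum_product, Finset.sum_image fun a _ b _ h => (Prod.mk.inj h).2]
  · refine Finset.sum_congr rfl fun a _ => ?_
    rw [Finset.sum_image fun a _ b _ h => (Prod.mk.inj h).2]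
    refine Finset.sum_congr rfl fun b _ => ?_
    rw [coefPP, ← mul_assoc]
    simp only [pVec]
    rw [ham_part_of_eq G A (by simp)]
  · rintro ⟨i, j⟩ h
    rw [Function.mem_support] at h
    have := coefPP_part_ne_zero (left_ne_zero_of_mul h)
    simp only at this
    have hi : i = (0, i.2) := Prod.ext (by simp only; omega) rfl
    have hj : j = (0, j.2) := Prod.ext (by simp only; omega) rfl
    rw [coe_product, Set.mem_prod]
    simp only [coe_image, coe_univ, Set.image_univ, Set.mem_range]
    exact ⟨⟨i.2, hi.symm⟩, ⟨j.2, hj.symm⟩⟩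

/-- The constant term of `Â₁ B̂₋₁ 1` pairs the `ħ ∂∂` terms of `A` with the `q₀ q₀/ħ` terms of `B`;
each monomial is hit by the two orderings of the derivatives, and `ħ` cancels. -/
theorem coeff_zero_qPart_qPart {ħ ħ' : K} (hħ : ħ * ħ' = 1) (G : Mat N) (A B : Op N) :
    MvPowerSeries.coeff 0 (qPart ħ ħ' G A 1 (qPart ħ ħ' G B (-1) 1)) =
      algebraMap ℂ K (∑ a, ∑ b, ham G A (pVec G (0, a)) (pVec G (0, b)) *
        (hamConst G B a b + hamConst G B b a)) := by
  rw [coeff_zero_qPart_one, map_sum]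
  refine Finset.sum_congr rfl fun c _ => ?_
  rw [map_sum]
  refine Finset.sum_congr rfl fun d _ => ?_
  have key : MvPowerSeries.coeff 0 (MvPowerSeries.pderiv K (0, c) (MvPowerSeries.pderiv K (0, d)
      (qPart ħ ħ' G B (-1) 1))) =
        algebraMap ℂ K (hamConst G B c d + hamConst G B d c) * ħ' := by
    rw [qPart_neg_one_one]
    simp only [map_sum, Derivation.map_smul, map_smul, coeff_zero_pderiv_pderiv, smul_eq_mul,
      mul_add, Finset.sum_add_distrib, map_add, add_mul]
    congr 1
    · rw [Finset.sum_eq_single c, Finset.sum_eq_single d]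
      · simp
      · intro b _ hb
        rw [if_neg, mul_zero]
        rintro ⟨-, h⟩
        exact hb (Prod.mk.inj h).2.symm
      · intro h; exact absurd (Finset.mem_univ _) h
      · intro b _ hb
        refine Finset.sum_eq_zero fun a _ => ?_
        rw [if_neg, mul_zero]
        rintro ⟨h, -⟩
        exact hb (Prod.mk.inj h).2.symm
      · intro h; exact absurd (Finset.mem_univ _) h
    · rw [Finset.sum_eq_single d, Finset.sum_eq_single c]
      · simp
      · intro b _ hb
        rw [if_neg, mul_zero]
        rintro ⟨h, -⟩
        exact hb (Prod.mk.inj h).2.symm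
      · intro h; exact absurd (Finset.mem_univ _) h
      · intro b _ hb
        refine Finset.sum_eq_zero fun a _ => ?_
        rw [if_neg, mul_zero]
        rintro ⟨-, h⟩
        exact hb (Prod.mk.inj h).2.symm
      · intro h; exact absurd (Finset.mem_univ _) h
  rw [key, map_mul]
  linear_combination (algebraMap ℂ K (ham G A (pVec G (0, c)) (pVec G (0, d))) *
    algebraMap ℂ K (hamConst G B c d + hamConst G B d c)) * hħ

theorem hamConst_of_pole (B : Op N) {U : Fin N → ℂ} (hB : B (-1) 0 = Matrix.diagonal U) :
    hamConst 1 B = -(1 / 2 : ℂ) • Matrix.diagonal U := by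
  rw [hamConst, hB, Matrix.diagonal_transpose, Matrix.transpose_one, mul_one, one_mul, ← two_smul ℂ,
    smul_smul]
  norm_num

theorem ham_pVec_zero (A : Op N) (a b : Fin N) : ham 1 A (pVec 1 (0, a)) (pVec 1 (0, b)) =
    (1 / 4) * (A 0 (-1) a b + A 0 (-1) b a) := by
  rw [pVec, pVec, ham_single]
  simp only [CharP.cast_eq_zero, sub_zero, inv_one, Matrix.one_mulVec, zero_add, pow_one, neg_smul,
    one_smul, Matrix.mulVec_neg, neg_dotProduct, dotProduct_neg, neg_neg, sub_neg_eq_add]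
  norm_num
  ring

/-- The cocycle of a diagonal simple pole and a non-negative operator. -/
def poleCocycle (U : Fin N → ℂ) (A : Op N) : ℂ := (1 / 2) * ∑ a, U a * A 0 (-1) a a

theorem sum_ham_hamConst (A : Op N) (B : Op N) {U : Fin N → ℂ}
    (hB : B (-1) 0 = Matrix.diagonal U) :
    ∑ a, ∑ b, ham 1 A (pVec 1 (0, a)) (pVec 1 (0, b)) * (hamConst 1 B a b + hamConst 1 B b a) =
      -poleCocycle U A := by
  rw [poleCocycle, Finset.mul_sum, ← Finset.sum_neg_distrib]
  refine Finset.sum_congr rfl fun a _ => ?_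
  rw [Finset.sum_eq_single a]
  · rw [ham_pVec_zero, hamConst_of_pole B hB]
    simp only [Matrix.smul_apply, Matrix.diagonal_apply_eq, smul_eq_mul]
    ring
  · intro b _ hb
    rw [hamConst_of_pole B hB]
    simp [Matrix.diagonal_apply_ne _ hb, Matrix.diagonal_apply_ne _ (Ne.symm hb)]
  · intro h; exact absurd (Finset.mem_univ _) h

theorem conjDefect_coeff {ħ ħ' : K} (hħ : ħ * ħ' = 1) {A : Op N} (B B' : Op N)
    (hT0 : PowerSeries.coeff 0 (quantSeries ħ ħ' (1 : Mat N) 1 0 A) = 0) {U : Fin N → ℂ}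
    (hB : B (-1) 0 = Matrix.diagonal U) :
    MvPowerSeries.coeff 0 (PowerSeries.coeff 1 (conjDefect ħ ħ' 1 1 1 A B B')
      (1 : MvPowerSeries (Idx N) K)) = algebraMap ℂ K (poleCocycle U A) := by
  rw [conjDefect_one_one ħ ħ' 1 B B' hT0, map_neg, coeff_zero_qPart_qPart hħ,
    sum_ham_hamConst A B hB, map_neg, neg_neg]

/-- The hamiltonian of `U/z` has no `p p` monomials, and its `q q` monomials involve only `q₀`. The
infinite sum thus reduces to the finite one that arose from the conjugation. -/
theorem cocycle_eq (U : Fin N → ℂ) (L : PowerSeries (Mat N)) :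
    cocycle 1 (opNeg (linSeries (Matrix.diagonal U))) (opPos L) = poleCocycle U (opPos L) := by
  classical
  set A : Op N := opNeg (linSeries (Matrix.diagonal U)) with hA
  have hA1 : A (-1) 0 = Matrix.diagonal U := by simp [hA, opNeg, linSeries]
  have hA0 : ∀ m n : ℤ, m ≠ n - 1 → A m n = 0 := by
    intro m n h
    rw [hA, opNeg]
    split_ifs with h1
    · rw [linSeries, PowerSeries.coeff_mk, if_neg (by omega)]
    · rfl
  have hp : ∀ i j : Idx N, ham 1 A (pVec 1 i) (pVec 1 j) = 0 := by
    intro i j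
    rw [pVec, pVec, ham_single, hA0 _ _ (by omega), hA0 _ _ (by omega)]
    simp
  have hq : ∀ i j : Idx N, ham 1 A (qVec i) (qVec j) ≠ 0 → i.1 = 0 ∧ j.1 = 0 := by
    intro i j h
    by_contra hcon
    apply h
    rw [qVec, qVec, ham_single, hA0 _ _ (by omega), hA0 _ _ (by omega)]
    rw [Matrix.zero_mulVec, Matrix.zero_mulVec, zero_dotProduct, zero_dotProduct]
    simp
  rw [cocycle]
  simp only [hp, zero_mul, zero_sub]
  rw [finsum_eq_sum_of_support_subset _ (s := ((Finset.univ : Finset (Fin N)).image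
    fun a => ((0, a) : Idx N)) ×ˢ (Finset.univ : Finset (Fin N)).image fun a => (0, a)),
    Finset.sum_product, Finset.sum_image fun a _ b _ h => (Prod.mk.inj h).2]
  · rw [← neg_neg (poleCocycle U (opPos L)), ← sum_ham_hamConst (opPos L) A hA1, Finset.mul_sum,
      ← Finset.sum_neg_distrib]
    refine Finset.sum_congr rfl fun a _ => ?_
    rw [Finset.sum_image fun a _ b _ h => (Prod.mk.inj h).2, Finset.mul_sum,
      ← Finset.sum_neg_distrib]
    refine Finset.sum_congr rfl fun b _ => ?_
    have h1 : ham 1 A (qVec (0, a)) (qVec (0, b)) = hamConst 1 A a b := by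
      rw [qVec, qVec]
      simp only [Nat.cast_zero]
      rw [ham_const, Matrix.mulVec_single_one, single_one_dotProduct, Matrix.col_apply]
    have h2 : hamConst 1 A b a = hamConst 1 A a b := by
      rw [← Matrix.transpose_apply (hamConst 1 A), hamConst_of_pole A hA1, Matrix.transpose_smul,
        Matrix.diagonal_transpose]
    rw [h1, h2]
    ring
  · rintro ⟨i, j⟩ h
    rw [Function.mem_support] at h
    obtain ⟨h1, h2⟩ := hq i j (left_ne_zero_of_mul (neg_ne_zero.1 h))
    have hi : i = (0, i.2) := Prod.ext h1 rfl
    have hj : j = (0, j.2) := Prod.ext h2 rfl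
    rw [coe_product, Set.mem_prod]
    simp only [coe_image, coe_univ, Set.image_univ, Set.mem_range]
    exact ⟨⟨i.2, hi.symm⟩, ⟨j.2, hj.symm⟩⟩

end Constants

/-! ### Symplectic series -/

section Symplectic

open Finset

variable {N : ℕ}

/-- An orthonormal frame carries all the information about the pairing: `G = (Ψ Ψᵀ)⁻¹` is forced,
hence nondegenerate and, in the next lemma, symmetric. -/
theorem isUnit_det_of_frame {G Ψ : Mat N} (h : Ψ.transpose * G * Ψ = 1) :
    IsUnit Ψ.det ∧ IsUnit G.det ∧ Ψ⁻¹ = Ψ.transpose * G := by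
  have h1 : IsUnit Ψ := IsUnit.of_mul_eq_one_right _ h
  have h2 : IsUnit Ψ.det := (Matrix.isUnit_iff_isUnit_det _).1 h1
  refine ⟨h2, ?_, Matrix.inv_eq_left_inv h⟩
  have h3 := congrArg Matrix.det h
  rw [Matrix.det_mul, Matrix.det_mul, Matrix.det_one] at h3
  exact isUnit_iff_exists_inv.2 ⟨Ψ.transpose.det * Ψ.det, by rw [← h3]; ring⟩

theorem transpose_eq_of_frame {G Ψ : Mat N} (h : Ψ.transpose * G * Ψ = 1) : G.transpose = G := by
  obtain ⟨h1, -, -⟩ := isUnit_det_of_frame h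
  have h2 : Ψ.transpose * G.transpose * Ψ = 1 := by
    have := congrArg Matrix.transpose h
    rwa [Matrix.transpose_mul, Matrix.transpose_mul, Matrix.transpose_transpose,
      Matrix.transpose_one, ← mul_assoc] at this
  have h3 : Ψ.transpose * G.transpose = Ψ.transpose * G := by
    calc _ = Ψ.transpose * G.transpose * (Ψ * Ψ⁻¹) := by
            rw [Matrix.mul_nonsing_inv _ h1, mul_one]
      _ = Ψ.transpose * G * (Ψ * Ψ⁻¹) := by rw [← mul_assoc, h2, ← mul_assoc, h]
      _ = _ := by rw [Matrix.mul_nonsing_inv _ h1, mul_one]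
  have hT : IsUnit Ψ.transpose.det := by rwa [Matrix.det_transpose]
  calc G.transpose = Ψ.transpose⁻¹ * (Ψ.transpose * G.transpose) := by
        rw [← mul_assoc, Matrix.nonsing_inv_mul _ hT, one_mul]
    _ = G := by rw [h3, ← mul_assoc, Matrix.nonsing_inv_mul _ hT, one_mul]

/-- The adjoint as a linear map. -/
def adjLin (G : Mat N) : Mat N →ₗ[ℂ] Mat N where
  toFun := adj G
  map_add' A B := by simp [adj, mul_add, add_mul]
  map_smul' a A := by simp [adj]

theorem adjLin_apply (G A : Mat N) : adjLin G A = adj G A := rfl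

theorem adj_one {G : Mat N} (hG : IsUnit G.det) : adj G 1 = 1 := by
  rw [adj, Matrix.transpose_one, mul_one, Matrix.nonsing_inv_mul _ hG]

theorem adj_mul {G : Mat N} (hG : IsUnit G.det) (A B : Mat N) :
    adj G (A * B) = adj G B * adj G A := by
  have : G * G⁻¹ = 1 := Matrix.mul_nonsing_inv _ hG
  rw [adj, adj, adj, Matrix.transpose_mul]
  calc _ = G⁻¹ * B.transpose * 1 * A.transpose * G := by noncomm_ring
    _ = _ := by rw [← this]; noncomm_ring

theorem adj_eq_iff {G : Mat N} (hG : IsUnit G.det) (A B : Mat N) :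
    adj G A = B ↔ A.transpose * G = G * B := by
  constructor
  · rintro rfl
    rw [adj, ← mul_assoc, ← mul_assoc, Matrix.mul_nonsing_inv _ hG, one_mul]
  · intro h
    rw [adj, mul_assoc, h, ← mul_assoc, Matrix.nonsing_inv_mul _ hG, one_mul]

/-- The logarithm of a symplectic series is infinitesimally symplectic; this makes its quantization
meaningful. -/
theorem logSeries_transpose {G : Mat N} (hG : IsUnit G.det) {F : PowerSeries (Mat N)}
    (hF : PowerSeries.coeff 0 F = 1) (hs : IsSymplecticSeries G F) (k : ℕ) :
    (PowerSeries.coeff k (logSeries F)).transpose * G =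
      -((-1 : ℂ) ^ k • (G * PowerSeries.coeff k (logSeries F))) := by
  have h := logS_anti (adjLin G) (adj_one hG) (adj_mul hG) hF hs k
  rw [← logSeries_eq_logS, adjLin_apply] at h
  have h2 : adj G (PowerSeries.coeff k (logSeries F)) =
      -((-1 : ℂ) ^ k • PowerSeries.coeff k (logSeries F)) := by
    have hk : (-1 : ℂ) ^ k * (-1) ^ k = 1 := by rw [← pow_add, ← two_mul, pow_mul]; norm_num
    calc _ = ((-1 : ℂ) ^ k * (-1) ^ k) • adj G (PowerSeries.coeff k (logSeries F)) := by
            rw [hk, one_smul]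
      _ = _ := by rw [mul_smul, h, smul_neg]
  rw [(adj_eq_iff hG _ _).1 h2, mul_neg, Matrix.mul_smul]

/-- The inverse of a series with constant term `1`. -/
def invS (F : PowerSeries (Mat N)) : PowerSeries (Mat N) := expS (-logSeries F)

theorem invS_mul {F : PowerSeries (Mat N)} (hF : PowerSeries.coeff 0 F = 1) : invS F * F = 1 := by
  rw [invS, logSeries_eq_logS]
  conv_lhs => rw [← expS_logS hF]
  rw [expS_logS hF]
  have := expS_neg_mul_expS (A := logS F) (coeff_zero_logS F)
  rwa [expS_logS hF] at this

theorem mul_invS {F : PowerSeries (Mat N)} (hF : PowerSeries.coeff 0 F = 1) : F * invS F = 1 := by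
  rw [invS, logSeries_eq_logS]
  have := expS_mul_expS_neg (A := logS F) (coeff_zero_logS F)
  rwa [expS_logS hF] at this

theorem ringInverse_eq {F : PowerSeries (Mat N)} (hF : PowerSeries.coeff 0 F = 1) :
    Ring.inverse F = invS F :=
  Ring.inverse_unit (⟨F, invS F, mul_invS hF, invS_mul hF⟩ : (PowerSeries (Mat N))ˣ)

theorem coeff_invS {G : Mat N} {F : PowerSeries (Mat N)} (hF : PowerSeries.coeff 0 F = 1)
    (hs : IsSymplecticSeries G F) (k : ℕ) :
    PowerSeries.coeff k (invS F) = (-1 : ℂ) ^ k • adj G (PowerSeries.coeff k F) := by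
  have h : (PowerSeries.mk fun k => (-1 : ℂ) ^ k • adj G (PowerSeries.coeff k F)) = invS F :=
    left_inv_eq_right_inv hs (mul_invS hF)
  rw [← h, PowerSeries.coeff_mk]

theorem coeff_zero_logSeries (F : PowerSeries (Mat N)) :
    PowerSeries.coeff 0 (logSeries F) = 0 := by
  rw [logSeries_eq_logS, coeff_zero_logS]

theorem coeff_one_logSeries (F : PowerSeries (Mat N)) :
    PowerSeries.coeff 1 (logSeries F) = PowerSeries.coeff 1 F := by
  rw [logSeries_eq_logS, coeff_one_logS]

theorem expS_logSeries {F : PowerSeries (Mat N)} (hF : PowerSeries.coeff 0 F = 1) :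
    expS (logSeries F) = F := by
  rw [logSeries_eq_logS, expS_logS hF]

theorem linSeries_neg (A : Mat N) : linSeries (-A) = -linSeries A := by
  ext1 k
  rw [map_neg, linSeries, linSeries, PowerSeries.coeff_mk, PowerSeries.coeff_mk]
  split_ifs <;> simp

theorem coeff_linSeries (A : Mat N) (k : ℕ) :
    PowerSeries.coeff k (linSeries A) = if k = 1 then A else 0 := by
  rw [linSeries, PowerSeries.coeff_mk]

theorem coeff_zero_linSeries (A : Mat N) : PowerSeries.coeff 0 (linSeries A) = 0 := by
  rw [coeff_linSeries, if_neg (by norm_num)]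

theorem coeff_linSeries_pow (A : Mat N) (i k : ℕ) :
    PowerSeries.coeff k (linSeries A ^ i) = if k = i then A ^ i else 0 := by
  induction i generalizing k with
  | zero => simp [PowerSeries.coeff_one]
  | succ i ih =>
    rw [pow_succ, PowerSeries.coeff_mul]
    simp only [ih, coeff_linSeries]
    split_ifs with h
    · subst h
      rw [Finset.sum_eq_single (i, 1)]
      · simp [pow_succ]
      · rintro ⟨a, b⟩ hab hne
        rw [HasAntidiagonal.mem_antidiagonal] at hab
        simp only [ne_eq, Prod.mk.injEq] at hab hne ⊢
        by_cases ha : a = i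
        · rw [if_neg (by omega : ¬ b = 1), mul_zero]
        · rw [if_neg ha, zero_mul]
      · intro hcon
        exact absurd (by simp) hcon
    · refine Finset.sum_eq_zero ?_
      rintro ⟨a, b⟩ hab
      rw [HasAntidiagonal.mem_antidiagonal] at hab
      simp only at hab ⊢
      by_cases ha : a = i
      · rw [if_neg (by omega : ¬ b = 1), mul_zero]
      · rw [if_neg ha, zero_mul]

theorem expSeries_eq_expS (A : Mat N) : expSeries A = expS (linSeries A) := by
  ext1 k
  rw [coeff_expS (coeff_zero_linSeries A) (Nat.lt_succ_self k), expSeries, PowerSeries.coeff_mk,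
    Finset.sum_eq_single k]
  · rw [coeff_linSeries_pow, if_pos rfl]
  · intro i _ hi
    rw [coeff_linSeries_pow, if_neg (Ne.symm hi), smul_zero]
  · intro h
    exact absurd (by simp) h

theorem expSeries_mul_neg (A : Mat N) : expSeries (-A) * expSeries A = 1 := by
  rw [expSeries_eq_expS, expSeries_eq_expS, linSeries_neg,
    expS_neg_mul_expS (coeff_zero_linSeries A)]

theorem expSeries_succ (A : Mat N) (n : ℕ) :
    ((n : ℂ) + 1) • PowerSeries.coeff (n + 1) (expSeries A) =
      PowerSeries.coeff n (expSeries A) * A := by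
  rw [expSeries, PowerSeries.coeff_mk, PowerSeries.coeff_mk, smul_smul, Matrix.smul_mul, ← pow_succ]
  congr 1
  rw [Nat.factorial_succ]
  have h1 : ((n : ℂ) + 1) ≠ 0 := by exact_mod_cast Nat.succ_ne_zero n
  have h2 : ((n.factorial : ℕ) : ℂ) ≠ 0 := by exact_mod_cast Nat.factorial_ne_zero n
  push_cast
  field_simp

theorem expSeries_comm (A : Mat N) (n : ℕ) :
    PowerSeries.coeff n (expSeries A) * A = A * PowerSeries.coeff n (expSeries A) := by
  rw [expSeries, PowerSeries.coeff_mk, Matrix.smul_mul, Matrix.mul_smul, ← pow_succ, ← pow_succ']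

end Symplectic

/-! ### The gauge transformations -/

section Gauge

open Finset

variable {N : ℕ}

/-- The calibration intertwines by `S`, whereas the conjugation requires the relation for `S⁻¹`. As
`S⁻¹(z) = S*(-z)`, it is the adjoint of the given equation, with `μ* = -μ` and `𝓔* = 𝓔`. -/
theorem IsCalibration.intertwines {G μ 𝓔 : Mat N} {S : PowerSeries (Mat N)}
    (hS : IsCalibration G μ 𝓔 S) (hG : IsUnit G.det) (hμ : μ.transpose * G = -(G * μ))
    (h𝓔 : 𝓔.transpose * G = G * 𝓔) :
    Intertwines (-1) 0 (invS S) (shiftOp μ 0) (shiftOp μ 𝓔) := by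
  have aμ : adj G μ = -μ := (adj_eq_iff hG _ _).2 (by rw [hμ, mul_neg])
  have a𝓔 : adj G 𝓔 = 𝓔 := (adj_eq_iff hG _ _).2 h𝓔
  have hc := coeff_invS hS.1 hS.2.2
  apply intertwines_shiftOp_neg
  · rw [hc, hS.1, adj_one hG]; simp
  · intro n
    rw [hc, hc]
    have h := congrArg (adjLin G) (hS.2.1 n)
    rw [map_add, map_add, map_sub, map_smul, map_zero] at h
    simp only [adjLin_apply, adj_mul hG, aμ, a𝓔] at h
    calc _ = (-1 : ℂ) ^ (n + 1) • (-((n : ℂ) + 1) • adj G (PowerSeries.coeff (n + 1) S) -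
          adj G (PowerSeries.coeff (n + 1) S) * -μ + -μ * adj G (PowerSeries.coeff (n + 1) S) +
            adj G (PowerSeries.coeff n S) * 𝓔) := by
          simp only [Matrix.mul_smul, Matrix.smul_mul, zero_mul, pow_succ, mul_neg, neg_mul]
          module
      _ = 0 := by rw [h, smul_zero]

/-- Cancelling `Ψ` leaves an equation between matrices in the canonical frame, with `V = Ψ⁻¹ μ Ψ`.
All later information on `R` comes from it: the full series gives the intertwining relation, the
cases `n = 0, 1` give the trace formula. -/
theorem IsAsymptoticSolution.conj_eq {μ 𝓔 Ψ U : Mat N} {R : PowerSeries (Mat N)}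
    (hR : IsAsymptoticSolution μ 𝓔 Ψ U R) (hΨ : IsUnit Ψ.det) (h𝓔 : 𝓔 * Ψ = Ψ * U) (n : ℕ) :
    (n : ℂ) • PowerSeries.coeff n R - Ψ⁻¹ * μ * Ψ * PowerSeries.coeff n R
      + U * PowerSeries.coeff (n + 1) R - PowerSeries.coeff (n + 1) R * U = 0 := by
  have h := congrArg (Ψ⁻¹ * ·) (hR.2.1 n)
  have hi : Ψ⁻¹ * Ψ = 1 := Matrix.nonsing_inv_mul _ hΨ
  simp only [mul_zero] at h
  rw [h𝓔] at h
  calc _ = (n : ℂ) • (Ψ⁻¹ * Ψ * PowerSeries.coeff n R) - Ψ⁻¹ * μ * Ψ * PowerSeries.coeff n R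
      + Ψ⁻¹ * Ψ * U * PowerSeries.coeff (n + 1) R - Ψ⁻¹ * Ψ * PowerSeries.coeff (n + 1) R * U := by
        rw [hi, one_mul, one_mul, one_mul]
    _ = Ψ⁻¹ * ((n : ℂ) • (Ψ * PowerSeries.coeff n R) - μ * Ψ * PowerSeries.coeff n R
    - Ψ * PowerSeries.coeff (n + 1) R * U + Ψ * U * PowerSeries.coeff (n + 1) R) := by
        rw [mul_add, mul_sub, mul_sub, Matrix.mul_smul]
        simp only [← mul_assoc]
        abel
    _ = 0 := h

theorem IsAsymptoticSolution.intertwines {μ 𝓔 Ψ U : Mat N} {R : PowerSeries (Mat N)}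
    (hR : IsAsymptoticSolution μ 𝓔 Ψ U R) (hΨ : IsUnit Ψ.det) (h𝓔 : 𝓔 * Ψ = Ψ * U) :
    Intertwines 1 1 R (shiftOp (Ψ⁻¹ * μ * Ψ) U) (shiftOp 0 U) := by
  apply intertwines_shiftOp_pos
  · rw [hR.1, one_mul, mul_one]
  · intro n
    rw [mul_zero, add_zero]
    exact hR.conj_eq hΨ h𝓔 n

/-- Differentiating `e^{U/z}` by `z ∂` produces `-U/z`, which cancels the pole. -/
theorem intertwines_expSeries (U : Mat N) :
    Intertwines (-1) 0 (expSeries U) (shiftOp 0 U) (shiftOp 0 0) := by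
  apply intertwines_shiftOp_neg
  · simp
  · intro n
    rw [neg_smul, expSeries_succ, expSeries_comm]
    simp

theorem intertwines_expSeries_neg (U : Mat N) :
    Intertwines (-1) 0 (expSeries (-U)) (shiftOp 0 0) (shiftOp 0 U) := by
  apply intertwines_shiftOp_neg
  · simp
  · intro n
    rw [neg_smul, expSeries_succ]
    simp

/-- Since `R⁻¹(z) = Rᵗ(-z)`, transposition turns `R⁻¹ U R` into itself with `z` replaced by `-z`. -/
theorem isInfSymplectic_conj_pole {u : Fin N → ℂ} {R : PowerSeries (Mat N)}
    (hR0 : PowerSeries.coeff 0 R = 1) (hs : IsSymplecticSeries 1 R) :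
    IsInfSymplectic 1 (poleOp (invS R * PowerSeries.C (Matrix.diagonal u) * R)) := by
  apply isInfSymplectic_poleOp
  intro k
  rw [mul_one, one_mul]
  have hc : ∀ k, PowerSeries.coeff k (invS R) =
      (-1 : ℂ) ^ k • (PowerSeries.coeff k R).transpose := by
    intro k
    rw [coeff_invS hR0 hs, adj, inv_one, one_mul, mul_one]
  conv_lhs => rw [PowerSeries.coeff_mul, ← Finset.Nat.sum_antidiagonal_swap, Matrix.transpose_sum]
  rw [PowerSeries.coeff_mul, Finset.smul_sum]
  refine Finset.sum_congr rfl fun p hp => ?_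
  rw [HasAntidiagonal.mem_antidiagonal] at hp
  have h1 : (-1 : ℂ) ^ (p.1 + p.2) * (-1) ^ p.1 = (-1) ^ p.2 := by
    rw [pow_add, mul_right_comm, ← pow_add, ← two_mul, pow_mul]; norm_num
  rw [PowerSeries.coeff_mul_C, PowerSeries.coeff_mul_C, Matrix.transpose_mul, Matrix.transpose_mul,
    Matrix.diagonal_transpose, hc, hc, ← hp, Matrix.smul_mul, Matrix.smul_mul, smul_smul,
    Prod.snd_swap, Prod.fst_swap, h1, Matrix.transpose_smul, Matrix.transpose_transpose,
    Matrix.mul_smul, Matrix.mul_smul, mul_assoc]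

theorem conj_shiftOp {μ 𝓔 Ψ U : Mat N} (hΨ : IsUnit Ψ.det) (h : 𝓔 * Ψ = Ψ * U) (m n : ℤ) :
    Ψ⁻¹ * shiftOp μ 𝓔 m n * Ψ = shiftOp (Ψ⁻¹ * μ * Ψ) U m n := by
  have hi : Ψ⁻¹ * Ψ = 1 := Matrix.nonsing_inv_mul _ hΨ
  rw [shiftOp, shiftOp]
  split_ifs
  · rw [mul_sub, sub_mul, Matrix.mul_smul, Matrix.smul_mul, mul_one, hi]
  · rw [mul_assoc, h, ← mul_assoc, hi, one_mul]
  · rw [mul_zero, zero_mul]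

/-- The four conjugations successively introduce `𝓔/z`, pass to the canonical frame, remove `V`, and
remove `U/z`; what is left is `z ∂ + 1/2`. -/
theorem conjM_virasoro {G μ 𝓔 Ψ : Mat N} {u : Fin N → ℂ} {S R : PowerSeries (Mat N)}
    (hΨ : Ψ.transpose * G * Ψ = 1) (hμ : μ.transpose * G = -(G * μ))
    (h𝓔 : 𝓔.transpose * G = G * 𝓔) (h𝓔Ψ : 𝓔 * Ψ = Ψ * Matrix.diagonal u)
    (hS : IsCalibration G μ 𝓔 S) (hR : IsAsymptoticSolution μ 𝓔 Ψ (Matrix.diagonal u) R) :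
    conjM Ψ (Matrix.diagonal u) S R (virasoro μ) = shiftOp 0 0 := by
  obtain ⟨h1, h2, h3⟩ := isUnit_det_of_frame hΨ
  rw [conjM, ringInverse_eq hS.1, ringInverse_eq hR.1, virasoro_eq_shiftOp]
  simp only [opNeg_eq, opPos_eq]
  rw [(hS.intertwines h2 hμ h𝓔).comp_eq (by norm_num) (mul_invS hS.1) (hasSupp_shiftOp_neg _ _)
      (hasSupp_shiftOp_neg _ _)]
  have hT : Op.comp (Op.comp (opConst Ψ⁻¹) (shiftOp μ 𝓔)) (opConst Ψ) =
      shiftOp (Ψ⁻¹ * μ * Ψ) (Matrix.diagonal u) := by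
    funext m n
    rw [comp_opConst, opConst_comp, conj_shiftOp h1 h𝓔Ψ]
  rw [hT, (hR.intertwines h1 h𝓔Ψ).comp_eq (by norm_num) (invS_mul hR.1)
    (hasSupp_shiftOp_pos _ _) (hasSupp_shiftOp_pos _ _),
    (intertwines_expSeries _).comp_eq (by norm_num) (expSeries_mul_neg _)
    (hasSupp_shiftOp_neg _ _) (hasSupp_shiftOp_neg _ _)]

/-! ### The trace -/

/-- Write `A = R₁`. Then `∑ A_ii u_i = ∑ u_i V_ij A_ij`; exchanging `i` and `j`, with `V`
antisymmetric and `A` symmetric, and averaging gives `½ ∑ (u_i - u_j) A_ij V_ij = ½ ∑ V_ij²`.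
Finally `∑ V_ij² = -tr V² = tr(μ μ*)`. -/
theorem trace_formula {G μ 𝓔 Ψ : Mat N} {u : Fin N → ℂ} {R : PowerSeries (Mat N)}
    (hΨ : Ψ.transpose * G * Ψ = 1) (hμ : μ.transpose * G = -(G * μ))
    (h𝓔Ψ : 𝓔 * Ψ = Ψ * Matrix.diagonal u)
    (hR : IsAsymptoticSolution μ 𝓔 Ψ (Matrix.diagonal u) R) :
    ∑ i, PowerSeries.coeff 1 R i i * u i / 2 = (μ * adj G μ).trace / 4 := by
  obtain ⟨h1, h2, h3⟩ := isUnit_det_of_frame hΨ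
  have hGs := transpose_eq_of_frame hΨ
  set V := Ψ⁻¹ * μ * Ψ with hV
  have hVt : V.transpose = -V := by
    rw [hV, h3, Matrix.transpose_mul, Matrix.transpose_mul, Matrix.transpose_mul,
      Matrix.transpose_transpose, hGs, ← mul_assoc μ.transpose, hμ]
    noncomm_ring
  set A := PowerSeries.coeff 1 R with hA
  have e0 := hR.conj_eq h1 h𝓔Ψ 0
  have e1 := hR.conj_eq h1 h𝓔Ψ 1
  rw [← hV, hR.1, zero_add, ← hA] at e0
  rw [← hV, ← hA] at e1
  have hAt : A.transpose = A := by
    have := congrArg (PowerSeries.coeff 1) hR.2.2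
    rw [coeff_one_mul', PowerSeries.coeff_mk, PowerSeries.coeff_mk, hR.1, adj, adj, ← hA,
      PowerSeries.coeff_one] at this
    simp only [inv_one, Matrix.transpose_one, mul_one, one_mul, pow_zero, pow_one, one_smul,
      neg_smul, one_ne_zero, if_false] at this
    exact (add_neg_eq_zero.1 this).symm
  -- The equation in degree zero, `V = [U, A]`.
  have hVij : ∀ i j, V i j = (u i - u j) * A i j := by
    intro i j
    have := congrFun (congrFun e0 i) j
    simp only [Nat.cast_zero, zero_smul, mul_one, Matrix.sub_apply, Matrix.add_apply,
      Matrix.zero_apply, Matrix.diagonal_mul, Matrix.mul_diagonal] at this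
    linear_combination -this
  -- The next equation contains the unknown `R₂` only in `[U, R₂]`, whose diagonal vanishes because
  -- `U` is diagonal.
  have hAii : ∀ i, A i i = ∑ j, V i j * A j i := by
    intro i
    have := congrFun (congrFun e1 i) i
    simp only [Nat.cast_one, one_smul, Matrix.sub_apply, Matrix.add_apply,
      Matrix.zero_apply, Matrix.diagonal_mul, Matrix.mul_diagonal] at this
    rw [← Matrix.mul_apply]
    linear_combination this
  have hAs : ∀ i j, A i j = A j i := fun i j => by
    conv_lhs => rw [← hAt, Matrix.transpose_apply]
  have hVs : ∀ i j, V j i = -V i j := fun i j => by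
    have := congrFun (congrFun hVt i) j
    rwa [Matrix.transpose_apply, Matrix.neg_apply] at this
  have hadj : adj G μ = -μ := (adj_eq_iff h2 _ _).2 (by rw [hμ, mul_neg])
  have htr : (μ * adj G μ).trace = ∑ i, ∑ j, V i j * V i j := by
    have : (μ * μ).trace = (V * V).trace := by
      rw [hV]
      have hi : Ψ * Ψ⁻¹ = 1 := Matrix.mul_nonsing_inv _ h1
      calc (μ * μ).trace = (Ψ * (Ψ⁻¹ * (μ * μ))).trace := by rw [← mul_assoc, hi, one_mul]
        _ = (Ψ⁻¹ * (μ * μ) * Ψ).trace := Matrix.trace_mul_comm _ _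
        _ = (Ψ⁻¹ * μ * (Ψ * Ψ⁻¹) * μ * Ψ).trace := by
            rw [hi]; congr 1; noncomm_ring
        _ = _ := by congr 1; noncomm_ring
    rw [hadj, mul_neg, Matrix.trace_neg, this, Matrix.trace, ← Finset.sum_neg_distrib]
    refine Finset.sum_congr rfl fun i _ => ?_
    rw [Matrix.diag_apply, Matrix.mul_apply, ← Finset.sum_neg_distrib]
    refine Finset.sum_congr rfl fun j _ => ?_
    rw [hVs i j]; ring
  have k1 : ∑ i, A i i * u i = ∑ i, ∑ j, u i * V i j * A i j := by
    refine Finset.sum_congr rfl fun i _ => ?_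
    rw [hAii i, Finset.sum_mul]
    refine Finset.sum_congr rfl fun j _ => ?_
    rw [hAs j i]; ring
  have k2 : ∑ i, A i i * u i = -∑ i, ∑ j, u j * V i j * A i j := by
    rw [k1, Finset.sum_comm, ← Finset.sum_neg_distrib]
    refine Finset.sum_congr rfl fun i _ => ?_
    rw [← Finset.sum_neg_distrib]
    refine Finset.sum_congr rfl fun j _ => ?_
    rw [hVs i j, hAs j i]; ring
  have k3 : 2 * ∑ i, A i i * u i = ∑ i, ∑ j, V i j * V i j := by
    have : ∑ i, ∑ j, V i j * V i j =
        ∑ i, ∑ j, u i * V i j * A i j - ∑ i, ∑ j, u j * V i j * A i j := by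
      rw [← Finset.sum_sub_distrib]
      refine Finset.sum_congr rfl fun i _ => ?_
      rw [← Finset.sum_sub_distrib]
      refine Finset.sum_congr rfl fun j _ => ?_
      conv_lhs => rw [hVij i j]
      rw [hVij i j]; ring
    rw [this, ← k1]
    linear_combination k2
  rw [htr, ← k3, ← Finset.sum_div]
  ring

end Gauge

/-! ### The conjugation formula for abstract frames -/

section Abstract

open Finset

variable {N : ℕ}

attribute [local instance 2000] coefAlgebra coefEndAlgebra

theorem evalOne_map_add {ι K : Type*} [CommRing K] {w : ι → ℤ} {σ c : ℤ} (hσ : σ * σ = 1)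
    {W : PowerSeries (Module.End K (MvPowerSeries ι K))} (hW : IsGraded w σ c W)
    {F F' : MvPowerSeries ι K} (hF : IsTame w σ F) (hF' : IsTame w σ F') (hFF' : IsTame w σ (F + F')) :
    evalOne W (F + F') = evalOne W F + evalOne W F' := by
  refine MvPowerSeries.ext fun m => ?_
  obtain ⟨n₁, h₁⟩ := hW.exists_coeff_evalOne hσ hF m
  obtain ⟨n₂, h₂⟩ := hW.exists_coeff_evalOne hσ hF' m
  obtain ⟨n₃, h₃⟩ := hW.exists_coeff_evalOne hσ hFF' m
  rw [map_add, h₁ (n₁ + n₂ + n₃) (by omega), h₂ (n₁ + n₂ + n₃) (by omega),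
    h₃ (n₁ + n₂ + n₃) (by omega), ← Finset.sum_add_distrib]
  refine Finset.sum_congr rfl fun k _ => ?_
  rw [map_add, map_add]

theorem expOp_neg_add {A : Op N} {Y : PowerSeries (Mat N)} (h : IsPureMulOp (-1) A Y) (G : Mat N)
    (F F' : Fock N) : expOp (quantize G A) (F + F') =
      expOp (quantize G A) F + expOp (quantize G A) F' := by
  have hσ : (-1 : ℤ) * -1 = 1 := by norm_num
  rw [h.expOp_eq hσ G (tame_neg_one F), h.expOp_eq hσ G (tame_neg_one F'),
    h.expOp_eq hσ G (tame_neg_one _)]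
  exact evalOne_map_add hσ (isGraded_quantSeries_zero _ _ G _ A).expS (tame_neg_one F)
    (tame_neg_one F') (tame_neg_one _)

theorem quantize_C_mul (G : Mat N) {B : Op N} (hB : HasSupp (-1) 0 B) (a : Coef) (F : Fock N) :
    quantize G B (MvPowerSeries.C a * F) = MvPowerSeries.C a * quantize G B F := by
  have hσ : (-1 : ℤ) * -1 = 1 := by norm_num
  rw [quantize_eq_evalOne G hσ 0 hB (tame_neg_one F),
    quantize_eq_evalOne G hσ 0 hB (tame_neg_one _), ← MvPowerSeries.smul_eq_C_mul,
    ← MvPowerSeries.smul_eq_C_mul]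
  exact evalOne_smul hσ (isGraded_quantSeries _ _ G _ _ B) (tame_neg_one F) a

theorem quantize_mem_polys (G : Mat N) {B : Op N} {s : ℕ} (hB : HasSupp 1 s B) {F : Fock N}
    (hF : F ∈ polys N) : quantize G B F ∈ polys N := by
  have hσ : (1 : ℤ) * 1 = 1 := by norm_num
  have hF' := tame_of_mem_polys 1 hF
  rw [quantize_eq_evalOne G hσ s hB hF']
  exact mem_polys_of_tame (IsTame.evalOne hσ (isGraded_quantSeries _ _ G _ _ B) hF')

theorem C_mul_mem_polys (a : Coef) {F : Fock N} (hF : F ∈ polys N) :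
    MvPowerSeries.C a * F ∈ polys N := by
  obtain ⟨P, rfl⟩ := hF
  exact ⟨MvPolynomial.C a * P, by simp only [MvPolynomial.coe_mul, MvPolynomial.coe_C]⟩

theorem expOp_mem_polys {A : Op N} {Y : PowerSeries (Mat N)} (h : IsPureMulOp 1 A Y) (G : Mat N)
    {F : Fock N} (hF : F ∈ polys N) : expOp (quantize G A) F ∈ polys N :=
  mem_polys_of_tame (h.expOp_tame (by norm_num) G (tame_of_mem_polys 1 hF))

/-- Conjugation by series in `z⁻¹` has no central term. -/
theorem IsPureMulOp.conj_neg {A : Op N} {Y : PowerSeries (Mat N)} (h : IsPureMulOp (-1) A Y)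
    {G : Mat N} (hG : G.transpose = G) (hG' : IsUnit G.det) {B B' : Op N}
    (hA : IsInfSymplectic G A) (hB : IsInfSymplectic G B) (hB' : IsInfSymplectic G B')
    (hBs : HasSupp (-1) 0 B) (hBs' : HasSupp (-1) 0 B')
    (hBB' : Intertwines (-1) 0 (expS Y) B B') {P : Fock N} (hP : P ∈ polys N) :
    expOp (quantize G (-A)) (quantize G B (expOp (quantize G A) P)) = quantize G B' P := by
  rw [h.conj (by norm_num) hG hG' hA hB hB' hBs hBs' hBB' hP,
    conjDefect_zero_one _ _ _ _ _ (h.coeff_zero_quantSeries _ _ G), map_zero, map_zero, zero_mul,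
    add_zero]

/-- Conjugation by series in `z` of an operator with a diagonal pole. -/
theorem IsPureMulOp.conj_pos {A : Op N} {Y : PowerSeries (Mat N)} (h : IsPureMulOp 1 A Y)
    {B B' : Op N} (hA : IsInfSymplectic 1 A) (hB : IsInfSymplectic 1 B)
    (hB' : IsInfSymplectic 1 B') (hBs : HasSupp 1 1 B) (hBs' : HasSupp 1 1 B')
    (hBB' : Intertwines 1 1 (expS Y) B B') {u : Fin N → ℂ} (hu : B (-1) 0 = Matrix.diagonal u)
    {P : Fock N} (hP : P ∈ polys N) :
    expOp (quantize 1 (-A)) (quantize 1 B (expOp (quantize 1 A) P)) =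
      quantize 1 B' P + MvPowerSeries.C (HahnSeries.C (poleCocycle u A)) * P := by
  rw [h.conj (by norm_num) Matrix.transpose_one (by simp) hA hB hB' hBs hBs' hBB' hP,
    conjDefect_coeff hbar_mul_inv _ _ (h.coeff_zero_quantSeries _ _ 1) hu, algebraMap_coef]

/-- The data entering the conjugation formula. -/
structure IsFrame (G μ 𝓔 Ψ : Mat N) (u : Fin N → ℂ) (S R : PowerSeries (Mat N)) : Prop where
  orthonormal : Ψ.transpose * G * Ψ = 1
  mu_anti : μ.transpose * G = -(G * μ)
  euler_eigen : 𝓔 * Ψ = Ψ * Matrix.diagonal u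
  calibration : IsCalibration G μ 𝓔 S
  asymptotic : IsAsymptoticSolution μ 𝓔 Ψ (Matrix.diagonal u) R

/-! ### Conjugation by the four factors in a frame -/

namespace IsFrame

variable {G μ 𝓔 Ψ : Mat N} {u : Fin N → ℂ} {S R : PowerSeries (Mat N)}

theorem transpose_gram (h : IsFrame G μ 𝓔 Ψ u S R) :
    G.transpose = G :=
  transpose_eq_of_frame h.orthonormal

theorem isUnit_frame (h : IsFrame G μ 𝓔 Ψ u S R) :
    IsUnit Ψ.det :=
  (isUnit_det_of_frame h.orthonormal).1

theorem isUnit_gram (h : IsFrame G μ 𝓔 Ψ u S R) :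
    IsUnit G.det :=
  (isUnit_det_of_frame h.orthonormal).2.1

theorem inv_frame (h : IsFrame G μ 𝓔 Ψ u S R) :
    Ψ⁻¹ = Ψ.transpose * G :=
  (isUnit_det_of_frame h.orthonormal).2.2

/-- `𝓔` is diagonal in an orthonormal frame, `𝓔 = Ψ U Ψᵀ G`, hence self-adjoint. -/
theorem euler_symm (h : IsFrame G μ 𝓔 Ψ u S R) : 𝓔.transpose * G = G * 𝓔 := by
  have hi : Ψ * Ψ⁻¹ = 1 := Matrix.mul_nonsing_inv _ h.isUnit_frame
  have e1 : 𝓔 = Ψ * Matrix.diagonal u * Ψ.transpose * G := by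
    rw [← h.euler_eigen, mul_assoc, ← h.inv_frame, mul_assoc, hi, mul_one]
  rw [e1]
  simp only [Matrix.transpose_mul, Matrix.transpose_transpose, Matrix.diagonal_transpose,
    h.transpose_gram]
  noncomm_ring

theorem conj_mu_anti (h : IsFrame G μ 𝓔 Ψ u S R) :
    (Ψ⁻¹ * μ * Ψ).transpose * 1 = -(1 * (Ψ⁻¹ * μ * Ψ)) := by
  rw [h.inv_frame, mul_one, one_mul, Matrix.transpose_mul, Matrix.transpose_mul,
    Matrix.transpose_mul, Matrix.transpose_transpose, h.transpose_gram, ← mul_assoc μ.transpose,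
    h.mu_anti]
  noncomm_ring

theorem pure_S (S : PowerSeries (Mat N)) : IsPureMulOp (-1) (opNeg (logSeries S)) (logSeries S) :=
  isPureMulOp_opNeg (coeff_zero_logSeries S)

theorem symp_S (h : IsFrame G μ 𝓔 Ψ u S R) : IsInfSymplectic G (opNeg (logSeries S)) := by
  rw [opNeg_eq]
  exact isInfSymplectic_mulOp (by norm_num)
    (logSeries_transpose h.isUnit_gram h.calibration.1 h.calibration.2.2)

theorem pure_R (R : PowerSeries (Mat N)) : IsPureMulOp 1 (opPos (logSeries R)) (logSeries R) :=
  isPureMulOp_opPos (coeff_zero_logSeries R)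

theorem symp_R (h : IsFrame G μ 𝓔 Ψ u S R) : IsInfSymplectic 1 (opPos (logSeries R)) := by
  rw [opPos_eq]
  exact isInfSymplectic_mulOp (by norm_num)
    (logSeries_transpose (by simp) h.asymptotic.1 h.asymptotic.2.2)

theorem symp_shift (h : IsFrame G μ 𝓔 Ψ u S R) :
    IsInfSymplectic G (shiftOp μ 𝓔) :=
  isInfSymplectic_shiftOp h.mu_anti h.euler_symm

theorem symp_virasoro (h : IsFrame G μ 𝓔 Ψ u S R) : IsInfSymplectic G (shiftOp μ 0) :=
  isInfSymplectic_shiftOp h.mu_anti (by simp)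

theorem symp_shift_conj (h : IsFrame G μ 𝓔 Ψ u S R) :
    IsInfSymplectic 1 (shiftOp (Ψ⁻¹ * μ * Ψ) (Matrix.diagonal u)) :=
  isInfSymplectic_shiftOp h.conj_mu_anti (by rw [Matrix.diagonal_transpose, mul_one, one_mul])

/-- `Ŝ l̂₀ Ŝ⁻¹`. -/
theorem conj_S (h : IsFrame G μ 𝓔 Ψ u S R) {P : Fock N} (hP : P ∈ polys N) :
    expOp (quantize G (opNeg (logSeries S))) (quantize G (virasoro μ)
      (expOp (quantize G (-opNeg (logSeries S))) P)) = quantize G (shiftOp μ 𝓔) P := by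
  have := (pure_S S).neg.conj_neg h.transpose_gram h.isUnit_gram h.symp_S.neg h.symp_virasoro
    h.symp_shift (hasSupp_shiftOp_neg _ _) (hasSupp_shiftOp_neg _ _)
    (h.calibration.intertwines h.isUnit_gram h.mu_anti h.euler_symm) hP
  rwa [neg_neg, ← virasoro_eq_shiftOp] at this

theorem virasoro_apply (h : IsFrame G μ 𝓔 Ψ u S R) {P : Fock N} (hP : P ∈ polys N) :
    quantize G (virasoro μ) (expOp (quantize G (-opNeg (logSeries S))) P) =
      expOp (quantize G (-opNeg (logSeries S))) (quantize G (shiftOp μ 𝓔) P) := by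
  rw [← h.conj_S hP, (pure_S S).expOp_neg_expOp (by norm_num) G (tame_neg_one _)]

/-- `Ψ̂⁻¹ (l₀ + 𝓔/z)^ Ψ̂`. -/
theorem conj_frame (h : IsFrame G μ 𝓔 Ψ u S R) {P : Fock N} (hP : P ∈ polys N) :
    changeVar Ψ (quantize G (shiftOp μ 𝓔) (changeVar Ψ⁻¹ P)) =
      quantize 1 (shiftOp (Ψ⁻¹ * μ * Ψ) (Matrix.diagonal u)) P :=
  changeVar_quantize_changeVar h.transpose_gram h.isUnit_gram h.orthonormal.symm
    (Matrix.mul_nonsing_inv _ h.isUnit_frame)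
    (fun m n => (conj_shiftOp h.isUnit_frame h.euler_eigen m n).symm) h.symp_shift
    h.symp_shift_conj (fun _ _ => shiftOp_ne_zero) hP

/-- `R̂⁻¹ (z ∂ + 1/2 - V + U/z)^ R̂`. -/
theorem conj_R (h : IsFrame G μ 𝓔 Ψ u S R) {P : Fock N} (hP : P ∈ polys N) :
    expOp (quantize 1 (-opPos (logSeries R))) (quantize 1
      (shiftOp (Ψ⁻¹ * μ * Ψ) (Matrix.diagonal u)) (expOp (quantize 1 (opPos (logSeries R))) P)) =
      quantize 1 (shiftOp 0 (Matrix.diagonal u)) P +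
        MvPowerSeries.C (HahnSeries.C (poleCocycle u (opPos (logSeries R)))) * P := by
  refine (pure_R R).conj_pos h.symp_R h.symp_shift_conj
    (isInfSymplectic_shiftOp (by simp) (by rw [Matrix.diagonal_transpose, mul_one, one_mul]))
    (hasSupp_shiftOp_pos _ _) (hasSupp_shiftOp_pos _ _) ?_ (shiftOp_sub_one _ _ (by norm_num)) hP
  rw [expS_logSeries h.asymptotic.1]
  exact h.asymptotic.intertwines h.isUnit_frame h.euler_eigen

theorem pure_U (U : Mat N) : IsPureMulOp (-1) (opNeg (linSeries U)) (linSeries U) :=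
  isPureMulOp_opNeg (coeff_zero_linSeries U)

theorem symp_U (u : Fin N → ℂ) : IsInfSymplectic 1 (opNeg (linSeries (Matrix.diagonal u))) := by
  rw [opNeg_eq]
  refine isInfSymplectic_mulOp (by norm_num) fun k => ?_
  rw [coeff_linSeries]
  split_ifs with hk
  · rw [hk, Matrix.diagonal_transpose]; simp
  · simp

/-- `e^{(U/z)^} (z ∂ + 1/2)^ e^{-(U/z)^}`. -/
theorem conj_U (u : Fin N → ℂ) {P : Fock N} (hP : P ∈ polys N) :
    expOp (quantize 1 (opNeg (linSeries (Matrix.diagonal u)))) (quantize 1 (shiftOp 0 0)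
      (expOp (quantize 1 (-opNeg (linSeries (Matrix.diagonal u)))) P)) =
      quantize 1 (shiftOp 0 (Matrix.diagonal u)) P := by
  have := (pure_U (Matrix.diagonal u)).neg.conj_neg (G := 1) Matrix.transpose_one (by simp)
    (symp_U u).neg (isInfSymplectic_shiftOp (by simp) (by simp))
    (isInfSymplectic_shiftOp (μ := 0) (by simp)
      (by rw [Matrix.diagonal_transpose, mul_one, one_mul]))
    (hasSupp_shiftOp_neg 0 0) (hasSupp_shiftOp_neg 0 (Matrix.diagonal u)) (by
      rw [← linSeries_neg, ← expSeries_eq_expS]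
      exact intertwines_expSeries_neg _) hP
  rwa [neg_neg] at this

/-- On the domain the factor `e^{(U/z)^}` cancels and a polynomial remains, on which `R̂` is
defined. The scalar `e^c` is carried along inside the polynomial. -/
theorem quantM_apply (c : ℂ) {P : Fock N} (hP : P ∈ polys N) :
    quantM G Ψ (Matrix.diagonal u) S R c
      (expOp (quantize 1 (-opNeg (linSeries (Matrix.diagonal u)))) P) =
      expOp (quantize G (-opNeg (logSeries S))) (changeVar Ψ⁻¹ (expOp
        (quantize 1 (opPos (logSeries R)))
          (MvPowerSeries.C (HahnSeries.C (Complex.exp c)) * P))) := by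
  rw [quantM, (pure_U (Matrix.diagonal u)).expOp_expOp_neg (by norm_num) 1 (tame_neg_one P),
    (pure_R R).expOp_C_mul (by norm_num) 1 (tame_of_mem_polys 1 hP), changeVar_C_mul,
    (pure_S S).neg.expOp_C_mul (by norm_num) G (tame_neg_one _)]

theorem quantMInv_apply (c : ℂ) (P : Fock N) :
    quantMInv G Ψ (Matrix.diagonal u) S R c (expOp (quantize G (-opNeg (logSeries S))) P) =
      expOp (quantize 1 (-opNeg (linSeries (Matrix.diagonal u))))
        (MvPowerSeries.C (HahnSeries.C (Complex.exp (-c))) *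
          expOp (quantize 1 (-opPos (logSeries R))) (changeVar Ψ P)) := by
  rw [quantMInv, (pure_S S).expOp_expOp_neg (by norm_num) G (tame_neg_one P),
    (pure_U (Matrix.diagonal u)).neg.expOp_C_mul (by norm_num) 1 (tame_neg_one _)]

theorem mem_polys_forward (a : Coef) {P : Fock N} (hP : P ∈ polys N) :
    changeVar Ψ⁻¹ (expOp (quantize 1 (opPos (logSeries R))) (MvPowerSeries.C a * P)) ∈ polys N :=
  changeVar_mem_polys _ (expOp_mem_polys (pure_R R) 1 (C_mul_mem_polys a hP))

theorem mem_polys_backward (a : Coef) {P : Fock N} (hP : P ∈ polys N) :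
    MvPowerSeries.C a * expOp (quantize 1 (-opPos (logSeries R))) (changeVar Ψ P) ∈ polys N :=
  C_mul_mem_polys a (expOp_mem_polys (pure_R R).neg 1 (changeVar_mem_polys _ hP))

theorem C_exp_mul (c c' : ℂ) (hc : c + c' = 0) (F : Fock N) :
    MvPowerSeries.C (HahnSeries.C (Complex.exp c)) *
      (MvPowerSeries.C (HahnSeries.C (Complex.exp c')) * F) = F := by
  rw [← mul_assoc, ← map_mul, ← map_mul, ← Complex.exp_add, hc, Complex.exp_zero, map_one, map_one,
    one_mul]

theorem mapsTo_quantM (c : ℂ) :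
    Set.MapsTo (quantM G Ψ (Matrix.diagonal u) S R c)
    (domM (Matrix.diagonal u)) (ranM G S) := by
  rintro _ ⟨P, hP, rfl⟩
  exact ⟨_, mem_polys_forward _ hP, (quantM_apply c hP).symm⟩

theorem mapsTo_quantMInv (c : ℂ) :
    Set.MapsTo (quantMInv G Ψ (Matrix.diagonal u) S R c)
    (ranM G S) (domM (Matrix.diagonal u)) := by
  rintro _ ⟨P, hP, rfl⟩
  exact ⟨_, mem_polys_backward _ hP, (quantMInv_apply c P).symm⟩

theorem invOn_quantM (h : IsFrame G μ 𝓔 Ψ u S R) (c : ℂ) :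
    Set.InvOn (quantMInv G Ψ (Matrix.diagonal u) S R c)
    (quantM G Ψ (Matrix.diagonal u) S R c) (domM (Matrix.diagonal u)) (ranM G S) := by
  constructor
  · rintro _ ⟨P, hP, rfl⟩
    rw [quantM_apply c hP, quantMInv_apply, changeVar_changeVar
      (Matrix.nonsing_inv_mul _ h.isUnit_frame), (pure_R R).expOp_neg_expOp (by norm_num) 1
      (tame_of_mem_polys 1 (C_mul_mem_polys _ hP)), C_exp_mul _ _ (by ring)]
  · rintro _ ⟨P, hP, rfl⟩
    rw [quantMInv_apply c P, quantM_apply c (mem_polys_backward _ hP),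
      C_exp_mul _ _ (by ring), (pure_R R).expOp_expOp_neg (by norm_num) 1
      (tame_of_mem_polys 1 (changeVar_mem_polys _ hP)),
      changeVar_changeVar (Matrix.mul_nonsing_inv _ h.isUnit_frame)]

theorem mapsTo_virasoro (h : IsFrame G μ 𝓔 Ψ u S R) :
    Set.MapsTo (quantize G (virasoro μ)) (ranM G S) (ranM G S) := by
  rintro _ ⟨P, hP, rfl⟩
  exact ⟨_, quantize_mem_polys G (hasSupp_shiftOp_pos _ _) hP, (h.virasoro_apply hP).symm⟩

/-- On `F = e^{-(U/z)^} P` the operator is moved past `Ŝ⁻¹`, `Ψ̂` and `R̂` in turn, always applied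
to polynomials. The step for `R̂` adds the scalar, and `conj_U` read backwards restores
`e^{-(U/z)^}`; the factors `e^c` and `e^{-c}` cancel. -/
theorem conj_quantM (h : IsFrame G μ 𝓔 Ψ u S R) (c : ℂ) {F : Fock N}
    (hF : F ∈ domM (Matrix.diagonal u)) :
    quantMInv G Ψ (Matrix.diagonal u) S R c (quantize G (virasoro μ)
      (quantM G Ψ (Matrix.diagonal u) S R c F)) =
      quantize 1 (conjM Ψ (Matrix.diagonal u) S R (virasoro μ)) F +
        MvPowerSeries.C (HahnSeries.C (poleCocycle u (opPos (logSeries R)))) * F := by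
  rw [conjM_virasoro h.orthonormal h.mu_anti h.euler_symm h.euler_eigen h.calibration h.asymptotic]
  obtain ⟨P, hP, rfl⟩ := hF
  have hP' : MvPowerSeries.C (HahnSeries.C (Complex.exp c)) * P ∈ polys N := C_mul_mem_polys _ hP
  have pU := (pure_U (Matrix.diagonal u)).neg
  rw [quantM_apply c hP, h.virasoro_apply (mem_polys_forward _ hP), quantMInv_apply c,
    h.conj_frame (expOp_mem_polys (pure_R R) 1 hP'), h.conj_R hP', ← conj_U u hP',
    pU.expOp_C_mul (by norm_num) 1 (tame_neg_one _), expOp_neg_add pU,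
    (pure_U (Matrix.diagonal u)).expOp_neg_expOp (by norm_num) 1 (tame_neg_one _),
    pU.expOp_C_mul (by norm_num) 1 (tame_neg_one _),
    pU.expOp_C_mul (by norm_num) 1 (tame_neg_one _),
    pU.expOp_C_mul (by norm_num) 1 (tame_neg_one _), quantize_C_mul 1 (hasSupp_shiftOp_neg _ _),
    mul_left_comm (MvPowerSeries.C (HahnSeries.C (poleCocycle u _))), ← mul_add, C_exp_mul _ _ (by ring)]

theorem conj_U_R (h : IsFrame G μ 𝓔 Ψ u S R) {F : Fock N} (hF : F ∈ polys N) :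
    expOp (quantize 1 (-opPos (logSeries R))) (quantize 1 (opNeg (linSeries (Matrix.diagonal u)))
      (expOp (quantize 1 (opPos (logSeries R))) F)) =
      quantize 1 (Op.comp (Op.comp (opPos (Ring.inverse R)) (opNeg (linSeries (Matrix.diagonal u))))
        (opPos R)) F + MvPowerSeries.C (HahnSeries.C (cocycle 1
          (opNeg (linSeries (Matrix.diagonal u))) (opPos (logSeries R)))) * F := by
  have hint : Intertwines 1 1 R (poleOp (PowerSeries.C (Matrix.diagonal u)))
      (poleOp (invS R * PowerSeries.C (Matrix.diagonal u) * R)) := by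
    apply intertwines_poleOp
    rw [← mul_assoc, ← mul_assoc, mul_invS h.asymptotic.1, one_mul]
  have hcomp : Op.comp (Op.comp (opPos (Ring.inverse R))
      (opNeg (linSeries (Matrix.diagonal u)))) (opPos R) =
      poleOp (invS R * PowerSeries.C (Matrix.diagonal u) * R) := by
    rw [ringInverse_eq h.asymptotic.1, opNeg_linSeries, opPos_eq, opPos_eq]
    exact hint.comp_eq (by norm_num) (invS_mul h.asymptotic.1) (hasSupp_poleOp _) (hasSupp_poleOp _)
  rw [hcomp, cocycle_eq]
  refine (pure_R R).conj_pos h.symp_R (symp_U u)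
    (isInfSymplectic_conj_pole h.asymptotic.1 h.asymptotic.2.2) ?_ (hasSupp_poleOp _) ?_ ?_ hF
  · rw [opNeg_linSeries]; exact hasSupp_poleOp _
  · rw [expS_logSeries h.asymptotic.1, opNeg_linSeries]
    exact hint
  · simp [opNeg, linSeries]

/-- Only the coefficient of `z` in `ln R` can pair with the simple pole, and that coefficient is
`R₁`. -/
theorem cocycle_pole (u : Fin N → ℂ) (R : PowerSeries (Mat N)) :
    cocycle 1 (opNeg (linSeries (Matrix.diagonal u))) (opPos (logSeries R)) =
    ∑ i, PowerSeries.coeff 1 R i i * u i / 2 := by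
  rw [cocycle_eq, poleCocycle, Finset.mul_sum]
  refine Finset.sum_congr rfl fun i _ => ?_
  have : opPos (logSeries R) 0 (-1) = PowerSeries.coeff 1 R := by
    rw [← coeff_one_logSeries]; simp [opPos]
  rw [this]; ring

theorem trace_eq (h : IsFrame G μ 𝓔 Ψ u S R) :
    ∑ i, PowerSeries.coeff 1 R i i * u i / 2 = (μ * adj G μ).trace / 4 :=
  trace_formula h.orthonormal h.mu_anti h.euler_eigen h.asymptotic

theorem poleCocycle_eq (h : IsFrame G μ 𝓔 Ψ u S R) :
    poleCocycle u (opPos (logSeries R)) = (μ * adj G μ).trace / 4 := by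
  rw [← h.trace_eq, ← cocycle_pole, cocycle_eq]

end IsFrame

end Abstract

/-! ### Residues at simple zeros -/

section Residue

open MvPolynomial

/-- Evaluation of a function of two points. -/
def evalPair (p q : Fin 3 → ℂ) : Poly3 ⊗[ℂ] Poly3 →ₐ[ℂ] ℂ :=
  Algebra.TensorProduct.productMap (aeval p) (aeval q)

theorem evalPair_tmul (p q : Fin 3 → ℂ) (a b : Poly3) :
    evalPair p q (a ⊗ₜ[ℂ] b) = eval p a * eval q b := by
  rw [evalPair, Algebra.TensorProduct.productMap_apply_tmul, aeval_eq_eval, aeval_eq_eval]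

/-- The matrices whose determinants are the Bezoutians of `g`. -/
def IsBezoutian (g : Fin 3 → Poly3) (B : Matrix (Fin 3) (Fin 3) (Poly3 ⊗[ℂ] Poly3)) : Prop :=
  ∀ i, g i ⊗ₜ[ℂ] (1 : Poly3) - (1 : Poly3) ⊗ₜ[ℂ] g i =
    ∑ j, B i j * ((X j : Poly3) ⊗ₜ[ℂ] (1 : Poly3) - (1 : Poly3) ⊗ₜ[ℂ] (X j : Poly3))

/-- Induction on `p`. For a product with `X k` the difference is `p(x) x_k - p(y) y_k = (p(x) -
p(y)) x_k + p(y) (x_k - y_k)`. -/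
theorem exists_difference_quotients (p : Poly3) : ∃ c : Fin 3 → Poly3 ⊗[ℂ] Poly3,
    p ⊗ₜ[ℂ] (1 : Poly3) - (1 : Poly3) ⊗ₜ[ℂ] p =
      ∑ j, c j * ((X j : Poly3) ⊗ₜ[ℂ] (1 : Poly3) - (1 : Poly3) ⊗ₜ[ℂ] (X j : Poly3)) := by
  classical
  induction p using MvPolynomial.induction_on with
  | C a =>
    refine ⟨0, ?_⟩
    have : (C a : Poly3) = a • 1 := by rw [smul_eq_C_mul, mul_one]
    rw [this, TensorProduct.smul_tmul, sub_self]
    simp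
  | add p q hp hq =>
    obtain ⟨c, hc⟩ := hp
    obtain ⟨c', hc'⟩ := hq
    refine ⟨c + c', ?_⟩
    simp only [Pi.add_apply, add_mul, Finset.sum_add_distrib, ← hc, ← hc', TensorProduct.add_tmul,
      TensorProduct.tmul_add]
    abel
  | mul_X p k hp =>
    obtain ⟨c, hc⟩ := hp
    refine ⟨fun j => c j * (X k : Poly3) ⊗ₜ[ℂ] (1 : Poly3) +
      if j = k then (1 : Poly3) ⊗ₜ[ℂ] p else 0, ?_⟩
    simp only [add_mul, Finset.sum_add_distrib, ite_mul, zero_mul, Finset.sum_ite_eq',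
      Finset.mem_univ, if_true]
    have h1 : ∑ j, c j * (X k : Poly3) ⊗ₜ[ℂ] (1 : Poly3) *
        ((X j : Poly3) ⊗ₜ[ℂ] (1 : Poly3) - (1 : Poly3) ⊗ₜ[ℂ] (X j : Poly3)) =
        (p ⊗ₜ[ℂ] (1 : Poly3) - (1 : Poly3) ⊗ₜ[ℂ] p) * (X k : Poly3) ⊗ₜ[ℂ] (1 : Poly3) := by
      rw [hc, Finset.sum_mul]
      exact Finset.sum_congr rfl fun j _ => by ring
    rw [h1, sub_mul, mul_sub]
    simp only [Algebra.TensorProduct.tmul_mul_tmul, one_mul, mul_one]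
    abel

theorem exists_isBezoutian (g : Fin 3 → Poly3) : ∃ B, IsBezoutian g B := by
  choose c hc using fun i => exists_difference_quotients (g i)
  exact ⟨Matrix.of c, hc⟩

/-- At two zeros `p ≠ q` the Bezout relation reads `B(p, q) (p - q) = 0`, so the matrix is singular.
-/
theorem evalPair_det_of_ne {g : Fin 3 → Poly3} {B : Matrix (Fin 3) (Fin 3) (Poly3 ⊗[ℂ] Poly3)}
    (hB : IsBezoutian g B) {p q : Fin 3 → ℂ} (hpq : p ≠ q) (hp : ∀ i, eval p (g i) = 0)
    (hq : ∀ i, eval q (g i) = 0) : evalPair p q B.det = 0 := by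
  rw [AlgHom.map_det]
  refine Matrix.exists_mulVec_eq_zero_iff.1 ⟨p - q, sub_ne_zero.2 hpq, ?_⟩
  funext i
  have := congrArg (evalPair p q) (hB i)
  simp only [map_sub, map_sum, map_mul, evalPair_tmul, map_one, mul_one, one_mul, hp, hq, sub_zero,
    eval_X] at this
  simpa [Matrix.mulVec, dotProduct] using this.symm

/-- The partial derivative in the first variable, on the diagonal. -/
def diagDeriv (l : Fin 3) (p : Fin 3 → ℂ) : Poly3 ⊗[ℂ] Poly3 →ₗ[ℂ] ℂ :=
  TensorProduct.lift ((LinearMap.mul ℂ ℂ).compl₁₂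
    ((aeval p : Poly3 →ₐ[ℂ] ℂ).toLinearMap ∘ₗ (pderiv l : Derivation ℂ Poly3 Poly3).toLinearMap)
    (aeval p : Poly3 →ₐ[ℂ] ℂ).toLinearMap)

theorem diagDeriv_tmul (l : Fin 3) (p : Fin 3 → ℂ) (a b : Poly3) :
    diagDeriv l p (a ⊗ₜ[ℂ] b) = eval p (pderiv l a) * eval p b := by
  rw [diagDeriv, TensorProduct.lift.tmul]
  simp [aeval_eq_eval]

theorem diagDeriv_mul_diff (l k : Fin 3) (p : Fin 3 → ℂ) (T : Poly3 ⊗[ℂ] Poly3) :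
    diagDeriv l p (T * ((X k : Poly3) ⊗ₜ[ℂ] (1 : Poly3) - (1 : Poly3) ⊗ₜ[ℂ] (X k : Poly3))) =
      if k = l then evalPair p p T else 0 := by
  classical
  induction T using TensorProduct.induction_on with
  | zero => simp
  | add T T' h h' =>
    rw [add_mul, map_add, h, h', map_add]
    split_ifs <;> simp
  | tmul a b =>
    rw [mul_sub, Algebra.TensorProduct.tmul_mul_tmul, Algebra.TensorProduct.tmul_mul_tmul, map_sub,
      diagDeriv_tmul, diagDeriv_tmul, evalPair_tmul, Derivation.leibniz, pderiv_X]
    by_cases h : k = l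
    · subst h
      simp
      ring
    · rw [if_neg h, Pi.single_eq_of_ne h]
      simp
      ring

/-- Differentiating the Bezout relation in the first variable on the diagonal removes every term in
which `X j - Y j` is not differentiated, and identifies `B(p, p)` with the Jacobian matrix. -/
theorem evalPair_det_self {g : Fin 3 → Poly3} {B : Matrix (Fin 3) (Fin 3) (Poly3 ⊗[ℂ] Poly3)}
    (hB : IsBezoutian g B) (p : Fin 3 → ℂ) :
    evalPair p p B.det = (Matrix.of fun k l => eval p (pderiv l (g k))).det := by
  rw [AlgHom.map_det]
  congr 1
  ext k l
  have := congrArg (diagDeriv l p) (hB k)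
  simp only [map_sum, diagDeriv_mul_diff, Finset.sum_ite_eq', Finset.mem_univ, if_true, map_sub,
    diagDeriv_tmul, map_one, mul_one, pderiv_one, map_zero, zero_mul, sub_zero] at this
  exact this.symm

theorem eval_lid_rTensor {n : ℕ} {x : Fin n → Fin 3 → ℂ} {c : Fin n → ℂ} {ρ : Poly3 →ₗ[ℂ] ℂ}
    (hρ : ∀ φ, ρ φ = ∑ i, c i * eval (x i) φ) (y : Fin 3 → ℂ) (T : Poly3 ⊗[ℂ] Poly3) :
    eval y (TensorProduct.lid ℂ Poly3 (ρ.rTensor Poly3 T)) =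
      ∑ i, c i * evalPair (x i) y T := by
  induction T using TensorProduct.induction_on with
  | zero => simp
  | add T T' h h' => simp only [map_add, h, h', mul_add, Finset.sum_add_distrib]
  | tmul a b =>
    rw [LinearMap.rTensor_tmul, TensorProduct.lid_tmul, hρ, smul_eval, Finset.sum_mul]
    exact Finset.sum_congr rfl fun i _ => by rw [evalPair_tmul, mul_assoc]

theorem exists_interpolation {n : ℕ} {x : Fin n → Fin 3 → ℂ} (hx : Function.Injective x) :
    ∃ L : Fin n → Poly3, ∀ i j, eval (x j) (L i) = if i = j then 1 else 0 := by
  classical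
  have h : ∀ i j, ∃ q : Poly3, eval (x i) q = 1 ∧ (i ≠ j → eval (x j) q = 0) := by
    intro i j
    by_cases hij : i = j
    · exact ⟨1, by simp, fun h => absurd hij h⟩
    · obtain ⟨k, hk⟩ := Function.ne_iff.1 (fun h => hij (hx h) : x i ≠ x j)
      refine ⟨C ((x i k - x j k)⁻¹) * (X k - C (x j k)), ?_, fun _ => ?_⟩
      · simp [inv_mul_cancel₀ (sub_ne_zero.2 hk)]
      · simp
  choose q hq hq' using h
  refine ⟨fun i => ∏ j, q i j, fun i j => ?_⟩
  rw [map_prod]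
  split_ifs with hij
  · subst hij
    exact Finset.prod_eq_one fun j _ => hq i j
  · exact Finset.prod_eq_zero (Finset.mem_univ j) (hq' i j hij)

/-- The residue functional of a system with simple zeros is the sum of the residues at them. -/
theorem residue_apply_of_simple_zeros {g : Fin 3 → Poly3} {n : ℕ} {x : Fin n → Fin 3 → ℂ}
    (hx : Function.Injective x) (hv : ∀ i k, eval (x i) (g k) = 0)
    (hI : ∀ φ : Poly3, (∀ i, eval (x i) φ = 0) → φ ∈ Ideal.span (Set.range g))
    {Δ : Fin n → ℂ} (hΔ : ∀ i, Δ i = (Matrix.of fun k l => eval (x i) (pderiv l (g k))).det)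
    (hΔ0 : ∀ i, Δ i ≠ 0) (φ : Poly3) :
    residue g φ = ∑ i, (Δ i)⁻¹ * eval (x i) φ := by
  classical
  have hv' : ∀ φ ∈ Ideal.span (Set.range g), ∀ i, eval (x i) φ = 0 := by
    intro φ hφ i
    have hle : Ideal.span (Set.range g) ≤ RingHom.ker (eval (x i)) := by
      rw [Ideal.span_le]
      rintro _ ⟨k, rfl⟩
      exact hv i k
    exact hle hφ
  have hdet : ∀ B : Matrix (Fin 3) (Fin 3) (Poly3 ⊗[ℂ] Poly3), IsBezoutian g B → ∀ i j,
      evalPair (x i) (x j) B.det = if i = j then Δ i else 0 := by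
    intro B hB i j
    split_ifs with hij
    · rw [← hij, evalPair_det_self hB, ← hΔ]
    · exact evalPair_det_of_ne hB (fun h => hij (hx h)) (hv i) (hv j)
  -- The choice in `residue` is meaningful once some functional has the characteristic property; the
  -- sum of the point residues is a witness.
  have hex : IsResidue g (residue g) := by
    refine Classical.epsilon_spec (p := IsResidue g) ⟨∑ i, (Δ i)⁻¹ •
      (aeval (x i) : Poly3 →ₐ[ℂ] ℂ).toLinearMap, ?_, ?_⟩
    · intro φ hφ
      simp [aeval_eq_eval, hv' φ hφ]
    · intro B hB
      refine hI _ fun j => ?_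
      rw [map_sub, map_one, eval_lid_rTensor (x := x) (c := fun i => (Δ i)⁻¹)
        (fun φ => by simp [aeval_eq_eval])]
      simp [hdet B hB, inv_mul_cancel₀ (hΔ0 _)]
  obtain ⟨L, hL⟩ := exists_interpolation hx
  -- Subtracting its Lagrange interpolation puts `φ` into the ideal, so a residue functional is a
  -- combination of evaluations at the zeros.
  have hρ : ∀ φ, residue g φ = ∑ i, residue g (L i) * eval (x i) φ := by
    intro φ
    have h0 : residue g (φ - ∑ i, C (eval (x i) φ) * L i) = 0 := by
      refine hex.1 _ (hI _ fun j => ?_)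
      simp [hL]
    rw [map_sub, sub_eq_zero, map_sum] at h0
    rw [h0]
    refine Finset.sum_congr rfl fun i _ => ?_
    rw [← smul_eq_C_mul, map_smul, smul_eq_mul, mul_comm]
  obtain ⟨B, hB⟩ := exists_isBezoutian g
  -- On pairs of zeros the Bezoutian is diagonal with entries `Δ j`, so its normalization at `x j`
  -- forces the weight to be `(Δ j)⁻¹`.
  have hc : ∀ j, residue g (L j) = (Δ j)⁻¹ := by
    intro j
    have := hv' _ (hex.2 B hB) j
    rw [map_sub, map_one, eval_lid_rTensor hρ] at this
    simp only [hdet B hB, mul_ite, mul_zero, Finset.sum_ite_eq', Finset.mem_univ, if_true,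
      sub_eq_zero] at this
    exact eq_inv_of_mul_eq_one_left this
  rw [hρ]
  exact Finset.sum_congr rfl fun i _ => by rw [hc]

end Residue

/-! ### Monomials of large degree lie in the jacobian ideals of the simple singularities -/

section Monomials

open MvPolynomial

theorem grad_mem_jacIdeal (f : Poly3) (j : Fin 3) : pderiv j f ∈ jacIdeal f :=
  Ideal.subset_span ⟨j, rfl⟩

theorem monomial_mem_of_le {I : Ideal Poly3} {m : Fin 3 →₀ ℕ} {a b c : ℕ}
    (h : (X 0 ^ a * X 1 ^ b * X 2 ^ c : Poly3) ∈ I) (ha : a ≤ m 0) (hb : b ≤ m 1) (hc : c ≤ m 2) :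
    monomial m (1 : ℂ) ∈ I := by
  obtain ⟨a', ha'⟩ := Nat.exists_eq_add_of_le ha
  obtain ⟨b', hb'⟩ := Nat.exists_eq_add_of_le hb
  obtain ⟨c', hc'⟩ := Nat.exists_eq_add_of_le hc
  have : monomial m (1 : ℂ) =
      X 0 ^ a' * X 1 ^ b' * X 2 ^ c' * (X 0 ^ a * X 1 ^ b * X 2 ^ c : Poly3) := by
    rw [monomial_eq, Finsupp.prod_fintype _ _ (fun _ => pow_zero _), Fin.prod_univ_three, ha', hb',
      hc', map_one]
    ring
  rw [this]
  exact I.mul_mem_left _ h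

theorem mem_of_C_mul_mem {I : Ideal Poly3} {p : Poly3} {a : ℂ} (ha : a ≠ 0) (h : C a * p ∈ I) :
    p ∈ I := by
  have : p = C a⁻¹ * (C a * p) := by
    rw [← mul_assoc, ← map_mul, inv_mul_cancel₀ ha, map_one, one_mul]
  rw [this]
  exact I.mul_mem_left _ h

theorem weight_fin_three (w : Fin 3 → ℚ) (m : Fin 3 →₀ ℕ) :
    Finsupp.weight w m = m 0 * w 0 + m 1 * w 1 + m 2 * w 2 := by
  rw [Finsupp.weight_apply, Finsupp.sum_fintype _ _ (by simp), Fin.sum_univ_three]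
  simp

/-- The pattern for all five types: the partial derivatives yield a few monomials in the ideal, and
a monomial divisible by none of them has weight less than `1`. -/
theorem monomial_mem_A (N : ℕ) (hN : 1 ≤ N) (m : Fin 3 →₀ ℕ)
    (h : 1 ≤ Finsupp.weight (SimpleSing.A N hN).weight m) :
    monomial m (1 : ℂ) ∈ jacIdeal (SimpleSing.A N hN).poly := by
  have hN0 : ((N : ℂ) + 1) ≠ 0 := by exact_mod_cast Nat.succ_ne_zero N
  have c1 : (C ((N : ℂ) + 1)⁻¹ : Poly3) * ((N : Poly3) + 1) = 1 := by
    rw [show ((N : Poly3) + 1) = C ((N : ℂ) + 1) by simp, ← map_mul, inv_mul_cancel₀ hN0, map_one]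
  have c2 : (C (2 : ℂ)⁻¹ : Poly3) * 2 = 1 := by
    rw [show (2 : Poly3) = C (2 : ℂ) from (map_ofNat C 2).symm, ← map_mul]; norm_num
  have g0 : (X 0 ^ N * X 1 ^ 0 * X 2 ^ 0 : Poly3) ∈ jacIdeal (SimpleSing.A N hN).poly := by
    convert! grad_mem_jacIdeal (SimpleSing.A N hN).poly 0 using 1
    simp only [SimpleSing.poly, map_add, Derivation.leibniz, Derivation.leibniz_pow, pderiv_C,
      pderiv_X, smul_eq_mul, nsmul_eq_mul]
    simp
    linear_combination (-X 0 ^ N) * c1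
  have g1 : (X 0 ^ 0 * X 1 ^ 1 * X 2 ^ 0 : Poly3) ∈ jacIdeal (SimpleSing.A N hN).poly := by
    convert! grad_mem_jacIdeal (SimpleSing.A N hN).poly 1 using 1
    simp only [SimpleSing.poly, map_add, Derivation.leibniz, Derivation.leibniz_pow, pderiv_C,
      pderiv_X, smul_eq_mul, nsmul_eq_mul]
    simp
    linear_combination (-X 1) * c2
  have g2 : (X 0 ^ 0 * X 1 ^ 0 * X 2 ^ 1 : Poly3) ∈ jacIdeal (SimpleSing.A N hN).poly := by
    convert! grad_mem_jacIdeal (SimpleSing.A N hN).poly 2 using 1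
    simp only [SimpleSing.poly, map_add, Derivation.leibniz, Derivation.leibniz_pow, pderiv_C,
      pderiv_X, smul_eq_mul, nsmul_eq_mul]
    simp
    linear_combination (-X 2) * c2
  by_cases h0 : N ≤ m 0
  · exact monomial_mem_of_le g0 h0 (Nat.zero_le _) (Nat.zero_le _)
  by_cases h1 : 1 ≤ m 1
  · exact monomial_mem_of_le g1 (Nat.zero_le _) h1 (Nat.zero_le _)
  by_cases h2 : 1 ≤ m 2
  · exact monomial_mem_of_le g2 (Nat.zero_le _) (Nat.zero_le _) h2
  exfalso
  have e1 : m 1 = 0 := by omega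
  have e2 : m 2 = 0 := by omega
  rw [weight_fin_three, e1, e2] at h
  simp only [SimpleSing.weight, Matrix.cons_val_zero, Nat.cast_zero, zero_mul, add_zero] at h
  have hn : (0 : ℚ) < (N : ℚ) + 1 := by positivity
  rw [mul_one_div, le_div_iff₀ hn] at h
  have : (m 0 : ℚ) < N := by exact_mod_cast not_le.1 h0
  linarith

theorem monomial_mem_D (N : ℕ) (hN : 4 ≤ N) (m : Fin 3 →₀ ℕ)
    (h : 1 ≤ Finsupp.weight (SimpleSing.D N hN).weight m) :
    monomial m (1 : ℂ) ∈ jacIdeal (SimpleSing.D N hN).poly := by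
  obtain ⟨k, rfl⟩ := Nat.exists_eq_add_of_le' hN
  set I := jacIdeal (SimpleSing.D (k + 4) hN).poly with hI
  have d0 : (2 * X 0 * X 1 : Poly3) ∈ I := by
    convert! grad_mem_jacIdeal (SimpleSing.D (k + 4) hN).poly 0 using 1
    simp only [SimpleSing.poly, map_add, map_sub, Derivation.leibniz, Derivation.leibniz_pow,
      pderiv_X, smul_eq_mul, nsmul_eq_mul]
    simp
    ring
  have d1 : (X 0 ^ 2 - ((k : Poly3) + 3) * X 1 ^ (k + 2) : Poly3) ∈ I := by
    convert! grad_mem_jacIdeal (SimpleSing.D (k + 4) hN).poly 1 using 1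
    simp only [SimpleSing.poly, map_add, map_sub, Derivation.leibniz, Derivation.leibniz_pow,
      pderiv_X, smul_eq_mul, nsmul_eq_mul, show k + 4 - 1 = k + 3 by omega,
      show k + 3 - 1 = k + 2 by omega]
    simp
  have d2 : (2 * X 2 : Poly3) ∈ I := by
    convert! grad_mem_jacIdeal (SimpleSing.D (k + 4) hN).poly 2 using 1
    simp only [SimpleSing.poly, map_add, map_sub, Derivation.leibniz, Derivation.leibniz_pow,
      pderiv_X, smul_eq_mul, nsmul_eq_mul]
    simp
  have two : (2 : Poly3) = C (2 : ℂ) := (map_ofNat C 2).symm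
  have gxy : (X 0 ^ 1 * X 1 ^ 1 * X 2 ^ 0 : Poly3) ∈ I := by
    refine mem_of_C_mul_mem (two_ne_zero : (2 : ℂ) ≠ 0) ?_
    rw [← two]
    convert! d0 using 1
    ring
  have gz : (X 0 ^ 0 * X 1 ^ 0 * X 2 ^ 1 : Poly3) ∈ I := by
    refine mem_of_C_mul_mem (two_ne_zero : (2 : ℂ) ≠ 0) ?_
    rw [← two]
    convert! d2 using 1
    ring
  -- `x³ = x (x² - (k+3) y^{k+2}) + (k+3) y^{k+1} · x y`; similarly, `y^{k+3}` is obtained from `x ·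
  -- x y` and `y` times the second derivative.
  have gx : (X 0 ^ 3 * X 1 ^ 0 * X 2 ^ 0 : Poly3) ∈ I := by
    have := I.add_mem (I.mul_mem_left (X 0) d1)
      (I.mul_mem_left (((k : Poly3) + 3) * X 1 ^ (k + 1)) gxy)
    convert! this using 1
    ring
  have gy : (X 0 ^ 0 * X 1 ^ (k + 3) * X 2 ^ 0 : Poly3) ∈ I := by
    have hk : ((k : ℂ) + 3) ≠ 0 := by exact_mod_cast (by omega : k + 3 ≠ 0)
    refine mem_of_C_mul_mem hk ?_
    have := I.sub_mem (I.mul_mem_left (X 0) gxy) (I.mul_mem_left (X 1) d1)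
    convert! this using 1
    rw [show (C ((k : ℂ) + 3) : Poly3) = (k : Poly3) + 3 by
      rw [map_add, map_natCast, map_ofNat]]
    ring
  by_cases h2 : 1 ≤ m 2
  · exact monomial_mem_of_le gz (Nat.zero_le _) (Nat.zero_le _) h2
  by_cases hxy : 1 ≤ m 0 ∧ 1 ≤ m 1
  · exact monomial_mem_of_le gxy hxy.1 hxy.2 (Nat.zero_le _)
  by_cases hx : 3 ≤ m 0
  · exact monomial_mem_of_le gx hx (Nat.zero_le _) (Nat.zero_le _)
  by_cases hy : k + 3 ≤ m 1
  · exact monomial_mem_of_le gy (Nat.zero_le _) hy (Nat.zero_le _)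
  exfalso
  have e2 : m 2 = 0 := by omega
  have hn : (0 : ℚ) < (k : ℚ) + 3 := by positivity
  rw [weight_fin_three, e2] at h
  simp only [SimpleSing.weight, Matrix.cons_val_zero, Matrix.cons_val_one, Nat.cast_zero, zero_mul,
    add_zero, Nat.cast_add, Nat.cast_ofNat] at h
  rw [show (k : ℚ) + 4 - 2 = k + 2 by ring, show (k : ℚ) + 4 - 1 = k + 3 by ring] at h
  by_cases h0 : m 0 = 0
  · rw [h0, Nat.cast_zero, zero_mul, zero_add, mul_one_div, le_div_iff₀ hn] at h
    have : (m 1 : ℚ) < (k : ℚ) + 3 := by exact_mod_cast not_le.1 hy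
    linarith
  · have e1 : m 1 = 0 := by omega
    rw [e1, Nat.cast_zero, zero_mul, add_zero, mul_div_assoc', le_div_iff₀ (by positivity)] at h
    have : (m 0 : ℚ) ≤ 2 := by exact_mod_cast (by omega : m 0 ≤ 2)
    nlinarith [(Nat.cast_nonneg k : (0 : ℚ) ≤ k)]

theorem monomial_mem_E6 (m : Fin 3 →₀ ℕ) (h : 1 ≤ Finsupp.weight SimpleSing.E6.weight m) :
    monomial m (1 : ℂ) ∈ jacIdeal SimpleSing.E6.poly := by
  set I := jacIdeal SimpleSing.E6.poly with hI
  have g0 : (X 0 ^ 2 * X 1 ^ 0 * X 2 ^ 0 : Poly3) ∈ I := by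
    refine mem_of_C_mul_mem (three_ne_zero : (3 : ℂ) ≠ 0) ?_
    convert! grad_mem_jacIdeal SimpleSing.E6.poly 0 using 1
    simp only [SimpleSing.poly, map_add, Derivation.leibniz_pow, pderiv_X, smul_eq_mul,
      nsmul_eq_mul, map_ofNat]
    simp
  have g1 : (X 0 ^ 0 * X 1 ^ 3 * X 2 ^ 0 : Poly3) ∈ I := by
    refine mem_of_C_mul_mem (by norm_num : (4 : ℂ) ≠ 0) ?_
    convert! grad_mem_jacIdeal SimpleSing.E6.poly 1 using 1
    simp only [SimpleSing.poly, map_add, Derivation.leibniz_pow, pderiv_X, smul_eq_mul,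
      nsmul_eq_mul, map_ofNat]
    simp
  have g2 : (X 0 ^ 0 * X 1 ^ 0 * X 2 ^ 1 : Poly3) ∈ I := by
    refine mem_of_C_mul_mem (two_ne_zero : (2 : ℂ) ≠ 0) ?_
    convert! grad_mem_jacIdeal SimpleSing.E6.poly 2 using 1
    simp only [SimpleSing.poly, map_add, Derivation.leibniz_pow, pderiv_X, smul_eq_mul,
      nsmul_eq_mul, map_ofNat]
    simp
  by_cases h0 : 2 ≤ m 0
  · exact monomial_mem_of_le g0 h0 (Nat.zero_le _) (Nat.zero_le _)
  by_cases h1 : 3 ≤ m 1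
  · exact monomial_mem_of_le g1 (Nat.zero_le _) h1 (Nat.zero_le _)
  by_cases h2 : 1 ≤ m 2
  · exact monomial_mem_of_le g2 (Nat.zero_le _) (Nat.zero_le _) h2
  exfalso
  have e0 : (m 0 : ℚ) ≤ 1 := by exact_mod_cast (by omega : m 0 ≤ 1)
  have e1 : (m 1 : ℚ) ≤ 2 := by exact_mod_cast (by omega : m 1 ≤ 2)
  have e2 : m 2 = 0 := by omega
  rw [weight_fin_three, e2] at h
  simp only [SimpleSing.weight, Matrix.cons_val_zero, Matrix.cons_val_one, Nat.cast_zero, zero_mul,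
    add_zero] at h
  linarith

theorem monomial_mem_E8 (m : Fin 3 →₀ ℕ) (h : 1 ≤ Finsupp.weight SimpleSing.E8.weight m) :
    monomial m (1 : ℂ) ∈ jacIdeal SimpleSing.E8.poly := by
  set I := jacIdeal SimpleSing.E8.poly with hI
  have g0 : (X 0 ^ 2 * X 1 ^ 0 * X 2 ^ 0 : Poly3) ∈ I := by
    refine mem_of_C_mul_mem (three_ne_zero : (3 : ℂ) ≠ 0) ?_
    convert! grad_mem_jacIdeal SimpleSing.E8.poly 0 using 1
    simp only [SimpleSing.poly, map_add, Derivation.leibniz_pow, pderiv_X, smul_eq_mul,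
      nsmul_eq_mul, map_ofNat]
    simp
  have g1 : (X 0 ^ 0 * X 1 ^ 4 * X 2 ^ 0 : Poly3) ∈ I := by
    refine mem_of_C_mul_mem (by norm_num : (5 : ℂ) ≠ 0) ?_
    convert! grad_mem_jacIdeal SimpleSing.E8.poly 1 using 1
    simp only [SimpleSing.poly, map_add, Derivation.leibniz_pow, pderiv_X, smul_eq_mul,
      nsmul_eq_mul, map_ofNat]
    simp
  have g2 : (X 0 ^ 0 * X 1 ^ 0 * X 2 ^ 1 : Poly3) ∈ I := by
    refine mem_of_C_mul_mem (two_ne_zero : (2 : ℂ) ≠ 0) ?_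
    convert! grad_mem_jacIdeal SimpleSing.E8.poly 2 using 1
    simp only [SimpleSing.poly, map_add, Derivation.leibniz_pow, pderiv_X, smul_eq_mul,
      nsmul_eq_mul, map_ofNat]
    simp
  by_cases h0 : 2 ≤ m 0
  · exact monomial_mem_of_le g0 h0 (Nat.zero_le _) (Nat.zero_le _)
  by_cases h1 : 4 ≤ m 1
  · exact monomial_mem_of_le g1 (Nat.zero_le _) h1 (Nat.zero_le _)
  by_cases h2 : 1 ≤ m 2
  · exact monomial_mem_of_le g2 (Nat.zero_le _) (Nat.zero_le _) h2
  exfalso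
  have e0 : (m 0 : ℚ) ≤ 1 := by exact_mod_cast (by omega : m 0 ≤ 1)
  have e1 : (m 1 : ℚ) ≤ 3 := by exact_mod_cast (by omega : m 1 ≤ 3)
  have e2 : m 2 = 0 := by omega
  rw [weight_fin_three, e2] at h
  simp only [SimpleSing.weight, Matrix.cons_val_zero, Matrix.cons_val_one, Nat.cast_zero, zero_mul,
    add_zero] at h
  linarith

theorem monomial_mem_E7 (m : Fin 3 →₀ ℕ) (h : 1 ≤ Finsupp.weight SimpleSing.E7.weight m) :
    monomial m (1 : ℂ) ∈ jacIdeal SimpleSing.E7.poly := by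
  set I := jacIdeal SimpleSing.E7.poly with hI
  have d0 : (3 * X 0 ^ 2 + X 1 ^ 3 : Poly3) ∈ I := by
    convert! grad_mem_jacIdeal SimpleSing.E7.poly 0 using 1
    simp only [SimpleSing.poly, map_add, Derivation.leibniz, Derivation.leibniz_pow, pderiv_X,
      smul_eq_mul, nsmul_eq_mul]
    simp
  have gxyy : (X 0 ^ 1 * X 1 ^ 2 * X 2 ^ 0 : Poly3) ∈ I := by
    refine mem_of_C_mul_mem (three_ne_zero : (3 : ℂ) ≠ 0) ?_
    convert! grad_mem_jacIdeal SimpleSing.E7.poly 1 using 1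
    simp only [SimpleSing.poly, map_add, Derivation.leibniz, Derivation.leibniz_pow, pderiv_X,
      smul_eq_mul, nsmul_eq_mul, map_ofNat]
    simp
    ring
  have gz : (X 0 ^ 0 * X 1 ^ 0 * X 2 ^ 1 : Poly3) ∈ I := by
    refine mem_of_C_mul_mem (two_ne_zero : (2 : ℂ) ≠ 0) ?_
    convert! grad_mem_jacIdeal SimpleSing.E7.poly 2 using 1
    simp only [SimpleSing.poly, map_add, Derivation.leibniz, Derivation.leibniz_pow, pderiv_X,
      smul_eq_mul, nsmul_eq_mul, map_ofNat]
    simp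
  -- `3 x³ = x (3 x² + y³) - y · x y²`, and in the next step `y⁵ = y² (3 x² + y³) - 3 x · x y²`.
  have gx : (X 0 ^ 3 * X 1 ^ 0 * X 2 ^ 0 : Poly3) ∈ I := by
    refine mem_of_C_mul_mem (three_ne_zero : (3 : ℂ) ≠ 0) ?_
    have := I.sub_mem (I.mul_mem_left (X 0) d0) (I.mul_mem_left (X 1) gxyy)
    convert! this using 1
    rw [map_ofNat]
    ring
  have gy : (X 0 ^ 0 * X 1 ^ 5 * X 2 ^ 0 : Poly3) ∈ I := by
    have := I.sub_mem (I.mul_mem_left (X 1 ^ 2) d0) (I.mul_mem_left (3 * X 0) gxyy)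
    convert! this using 1
    ring
  by_cases h2 : 1 ≤ m 2
  · exact monomial_mem_of_le gz (Nat.zero_le _) (Nat.zero_le _) h2
  by_cases hxyy : 1 ≤ m 0 ∧ 2 ≤ m 1
  · exact monomial_mem_of_le gxyy hxyy.1 hxyy.2 (Nat.zero_le _)
  by_cases hx : 3 ≤ m 0
  · exact monomial_mem_of_le gx hx (Nat.zero_le _) (Nat.zero_le _)
  by_cases hy : 5 ≤ m 1
  · exact monomial_mem_of_le gy (Nat.zero_le _) hy (Nat.zero_le _)
  exfalso
  have e2 : m 2 = 0 := by omega
  rw [weight_fin_three, e2] at h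
  simp only [SimpleSing.weight, Matrix.cons_val_zero, Matrix.cons_val_one, Nat.cast_zero, zero_mul,
    add_zero] at h
  by_cases h0 : m 0 = 0
  · have e1 : (m 1 : ℚ) ≤ 4 := by exact_mod_cast (by omega : m 1 ≤ 4)
    rw [h0, Nat.cast_zero] at h
    linarith
  · have e0 : (m 0 : ℚ) ≤ 2 := by exact_mod_cast (by omega : m 0 ≤ 2)
    have e1 : (m 1 : ℚ) ≤ 1 := by exact_mod_cast (by omega : m 1 ≤ 1)
    linarith

theorem monomial_mem_jacIdeal (S : SimpleSing) (m : Fin 3 →₀ ℕ)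
    (h : 1 ≤ Finsupp.weight S.weight m) : monomial m (1 : ℂ) ∈ jacIdeal S.poly := by
  cases S with
  | A N hN => exact monomial_mem_A N hN m h
  | D N hN => exact monomial_mem_D N hN m h
  | E6 => exact monomial_mem_E6 m h
  | E7 => exact monomial_mem_E7 m h
  | E8 => exact monomial_mem_E8 m h

theorem SimpleSing.weight_nonneg (S : SimpleSing) (j : Fin 3) : 0 ≤ S.weight j := by
  cases S with
  | A N hN => fin_cases j <;> simp [SimpleSing.weight] <;> positivity
  | D N hN =>
    have : (4 : ℚ) ≤ N := by exact_mod_cast hN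
    fin_cases j
    · exact div_nonneg (by linarith) (by linarith)
    · exact div_nonneg zero_le_one (by linarith)
    · norm_num [SimpleSing.weight]
  | E6 => fin_cases j <;> norm_num [SimpleSing.weight]
  | E7 => fin_cases j <;> norm_num [SimpleSing.weight]
  | E8 => fin_cases j <;> norm_num [SimpleSing.weight]

theorem SimpleSing.coxeter_ne_zero (S : SimpleSing) : (S.coxeter : ℚ) ≠ 0 := by
  have : S.coxeter ≠ 0 := by
    cases S with
    | A N hN => exact Nat.succ_ne_zero N
    | D N hN => change 2 * N - 2 ≠ 0; omega
    | E6 => decide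
    | E7 => decide
    | E8 => decide
  exact_mod_cast this

theorem SimpleSing.isWeightedHomogeneous_poly (S : SimpleSing) :
    IsWeightedHomogeneous S.weight S.poly 1 := by
  have hX : ∀ (w : Fin 3 → ℚ) (j : Fin 3) (n : ℕ) (q : ℚ), (n : ℚ) * w j = q →
      IsWeightedHomogeneous w (X j ^ n : Poly3) q := by
    intro w j n q h
    rw [← h, ← nsmul_eq_mul]
    exact (isWeightedHomogeneous_X ℂ w j).pow n
  have half : ∀ q : ℚ, q = 1 / 2 → ((2 : ℕ) : ℚ) * q = 1 := by
    rintro q rfl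
    norm_num
  cases S with
  | A N hN =>
    have hn : ((N : ℚ) + 1) ≠ 0 := by positivity
    refine ((IsWeightedHomogeneous.C_mul (hX _ _ _ _ ?_) _).add
      (IsWeightedHomogeneous.C_mul (hX _ _ _ _ ?_) _)).add
      (IsWeightedHomogeneous.C_mul (hX _ _ _ _ ?_) _)
    · simp only [SimpleSing.weight, Matrix.cons_val_zero]; push_cast; field_simp
    · exact half _ rfl
    · exact half _ rfl
  | D N hN =>
    obtain ⟨k, rfl⟩ := Nat.exists_eq_add_of_le' hN
    have hn : ((k : ℚ) + 3) ≠ 0 := by positivity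
    have e : (k : ℚ) + 4 - 1 = k + 3 := by ring
    refine (IsWeightedHomogeneous.sub ?_ (hX _ _ _ _ ?_)).add (hX _ _ _ _ ?_)
    · have := (hX (SimpleSing.D (k + 4) hN).weight 0 2 (((k : ℚ) + 2) / (k + 3)) ?_).mul
        (hX (SimpleSing.D (k + 4) hN).weight 1 1 (1 / ((k : ℚ) + 3)) ?_)
      · rw [pow_one] at this
        convert! this using 1
        field_simp
        ring
      · simp only [SimpleSing.weight, Matrix.cons_val_zero]
        push_cast
        rw [e]
        field_simp
        ring
      · simp only [SimpleSing.weight, Matrix.cons_val_one]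
        push_cast
        rw [e, one_mul]
    · simp only [SimpleSing.weight, Matrix.cons_val_one, show k + 4 - 1 = k + 3 by omega]
      push_cast
      rw [e]
      field_simp
    · exact half _ rfl
  | E6 =>
    refine ((hX _ _ _ _ ?_).add (hX _ _ _ _ ?_)).add (hX _ _ _ _ (half _ rfl)) <;>
      norm_num [SimpleSing.weight]
  | E7 =>
    refine ((hX _ _ _ _ ?_).add ?_).add (hX _ _ _ _ ?_)
    · norm_num [SimpleSing.weight]
    · have := (hX SimpleSing.E7.weight 0 1 (1 / 3) (by norm_num [SimpleSing.weight])).mul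
        (hX SimpleSing.E7.weight 1 3 (2 / 3) (by norm_num [SimpleSing.weight]))
      rw [pow_one] at this
      convert! this using 1
      norm_num
    · exact half _ rfl
  | E8 =>
    refine ((hX _ _ _ _ ?_).add (hX _ _ _ _ ?_)).add (hX _ _ _ _ (half _ rfl)) <;>
      norm_num [SimpleSing.weight]

end Monomials

/-! ### Weighted homogeneous polynomials -/

section Weighted

open MvPolynomial

/-- Euler's identity, checked on monomials. -/
theorem sum_weight_mul_X_mul_pderiv {w : Fin 3 → ℚ} {φ : Poly3} {e : ℚ}
    (h : IsWeightedHomogeneous w φ e) :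
    ∑ j, C ((w j : ℚ) : ℂ) * (X j * pderiv j φ) = C (e : ℂ) * φ := by
  have key : ∀ j, X j * pderiv j φ = ∑ m ∈ φ.support, m j • monomial m (coeff m φ) := by
    intro j
    conv_lhs => rw [φ.as_sum, map_sum, Finset.mul_sum]
    exact Finset.sum_congr rfl fun m _ => X_mul_pderiv_monomial
  simp only [key, Finset.mul_sum]
  rw [Finset.sum_comm]
  conv_rhs => rw [φ.as_sum, Finset.mul_sum]
  refine Finset.sum_congr rfl fun m hm => ?_
  rw [← h (mem_support_iff.1 hm), weight_fin_three, Fin.sum_univ_three]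
  simp only [C_mul_monomial, ← map_nsmul, ← map_add]
  congr 1
  push_cast
  simp only [nsmul_eq_mul]
  ring

theorem weightedHomogeneousComponent_mul {w : Fin 3 → ℚ} {g : Poly3} {e : ℚ}
    (hg : IsWeightedHomogeneous w g e) (q : Poly3) (n : ℚ) :
    weightedHomogeneousComponent w n (q * g) =
      weightedHomogeneousComponent w (n - e) q * g := by
  induction q using MvPolynomial.induction_on' with
  | monomial m c =>
    have hm := isWeightedHomogeneous_monomial w m c rfl
    by_cases hn : Finsupp.weight w m = n - e
    · rw [hn] at hm
      rw [hm.weightedHomogeneousComponent_same]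
      have := (hm.mul hg).weightedHomogeneousComponent_same
      rwa [sub_add_cancel] at this
    · rw [hm.weightedHomogeneousComponent_ne _ (Ne.symm hn), zero_mul,
        (hm.mul hg).weightedHomogeneousComponent_ne]
      intro h
      exact hn (by rw [h]; ring)
  | add p q hp hq => rw [add_mul, map_add, map_add, hp, hq, add_mul]

theorem mem_jacIdeal_of_one_le (Y : SimpleSing) {φ : Poly3} {e : ℚ}
    (h : IsWeightedHomogeneous Y.weight φ e) (he : 1 ≤ e) : φ ∈ jacIdeal Y.poly := by
  rw [φ.as_sum]
  refine Ideal.sum_mem _ fun m hm => ?_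
  rw [← mul_one (coeff m φ), ← C_mul_monomial]
  exact Ideal.mul_mem_left _ _ (monomial_mem_jacIdeal Y m (by rwa [h (mem_support_iff.1 hm)]))

theorem SimpleSing.finsupp_weight_nonneg (Y : SimpleSing) (m : Fin 3 →₀ ℕ) :
    0 ≤ Finsupp.weight Y.weight m := by
  rw [weight_fin_three]
  have := Y.weight_nonneg
  have h0 := this 0
  have h1 := this 1
  have h2 := this 2
  positivity

end Weighted

/-! ### The algebra of functions on the critical set -/

section Deformation

open MvPolynomial

variable {Y : SimpleSing} {ψ : Fin Y.rank → Poly3} {d : Fin Y.rank → ℚ}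

/-- A member of degree at least `1` would vanish in `H`. This makes the degree `1 - d a` of every
deformation parameter positive, which is the essential property of simple singularities here. -/
theorem IsHomogeneousBasis.lt_one (hψ : IsHomogeneousBasis Y ψ d) (a : Fin Y.rank) : d a < 1 := by
  by_contra h
  exact hψ.2.2.1.ne_zero a
    (Ideal.Quotient.eq_zero_iff_mem.2 (mem_jacIdeal_of_one_le Y (hψ.1 a) (not_lt.1 h)))

theorem IsHomogeneousBasis.exists_gap (hψ : IsHomogeneousBasis Y ψ d) :
    ∃ ε : ℚ, 0 < ε ∧ ∀ a, d a + ε ≤ 1 := by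
  obtain ⟨a₀, -⟩ := hψ.2.1
  have : Nonempty (Fin Y.rank) := ⟨a₀⟩
  obtain ⟨b, hb⟩ := Finite.exists_max d
  exact ⟨1 - d b, sub_pos.2 (hψ.lt_one b), fun a => by linarith [hb a]⟩

theorem IsHomogeneousBasis.exists_jacIdeal_rep (hψ : IsHomogeneousBasis Y ψ d) (p : Poly3) :
    ∃ (v : Fin Y.rank → ℂ) (q : Fin 3 → Poly3),
      p = ∑ a, C (v a) * ψ a + ∑ j, q j * pderiv j Y.poly := by
  have h : Ideal.Quotient.mk (jacIdeal Y.poly) p ∈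
      Submodule.span ℂ (Set.range fun a => Ideal.Quotient.mk (jacIdeal Y.poly) (ψ a)) := by
    rw [hψ.2.2.2]; trivial
  obtain ⟨v, hv⟩ := (Submodule.mem_span_range_iff_exists_fun ℂ).1 h
  have hm : p - ∑ a, C (v a) * ψ a ∈ jacIdeal Y.poly := by
    rw [← Ideal.Quotient.mk_eq_mk_iff_sub_mem, ← hv, map_sum]
    refine Finset.sum_congr rfl fun a _ => ?_
    rw [← smul_eq_C_mul]
    rfl
  obtain ⟨q, hq⟩ := Ideal.mem_span_range_iff_exists_fun.1 hm
  refine ⟨v, q, ?_⟩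
  change ∑ j, q j * pderiv j Y.poly = _ at hq
  rw [hq]; ring

theorem grad_deform (τ : Fin Y.rank → ℂ) (j : Fin 3) :
    grad (deform Y ψ τ) j = pderiv j Y.poly + ∑ b, C (τ b) * pderiv j (ψ b) := by
  simp only [grad, deform, map_add, map_sum, pderiv_C_mul]

/-- Polynomials equivalent to linear combinations of the `ψ a` modulo the gradient of the
deformation. -/
def tangentSpan (Y : SimpleSing) (ψ : Fin Y.rank → Poly3) (τ : Fin Y.rank → ℂ) :
    Submodule ℂ Poly3 :=
  Submodule.span ℂ (Set.range ψ) ⊔ (jacIdeal (deform Y ψ τ)).restrictScalars ℂ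

theorem mem_tangentSpan_of_mem (τ : Fin Y.rank → ℂ) {p : Poly3}
    (hp : p ∈ jacIdeal (deform Y ψ τ)) : p ∈ tangentSpan Y ψ τ :=
  Submodule.mem_sup_right hp

theorem C_mul_mem_tangentSpan (τ : Fin Y.rank → ℂ) (c : ℂ) {p : Poly3}
    (hp : p ∈ tangentSpan Y ψ τ) : C c * p ∈ tangentSpan Y ψ τ := by
  rw [← smul_eq_C_mul]; exact Submodule.smul_mem _ _ hp

/-- Modulo the gradient of `f_τ`, each `∂_j f` can be traded for `-∑ τ^b ∂_j ψ_b`, whose terms have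
weight lower by `1 - d_b ≥ ε`. Reduction in `H` followed by this exchange lowers the weight by a
fixed amount; weights are nonnegative, so the process ends. -/
theorem IsHomogeneousBasis.mem_tangentSpan_of_homogeneous (hψ : IsHomogeneousBasis Y ψ d)
    (τ : Fin Y.rank → ℂ) {ε : ℚ} (hε : ∀ a, d a + ε ≤ 1) (n : ℕ) :
    ∀ (e : ℚ), e < n * ε → ∀ p, IsWeightedHomogeneous Y.weight p e → p ∈ tangentSpan Y ψ τ := by
  induction n with
  | zero =>
    intro e he p hp
    have : p = 0 := hp.eq_zero_of_no_monomials fun m hm => by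
      have := Y.finsupp_weight_nonneg m
      rw [Nat.cast_zero, zero_mul] at he
      linarith
    rw [this]; exact zero_mem _
  | succ n ih =>
    intro e he p hp
    push_cast at he
    obtain ⟨v, q, hpq⟩ := hψ.exists_jacIdeal_rep p
    have hf : ∀ j, IsWeightedHomogeneous Y.weight (pderiv j Y.poly) (1 - Y.weight j) := fun j =>
      Y.isWeightedHomogeneous_poly.pderiv (by ring)
    -- The representation modulo the gradient of `f` need not be homogeneous; its component of
    -- degree `e` is extracted.
    rw [← hp.weightedHomogeneousComponent_same, hpq, map_add, map_sum, map_sum]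
    refine add_mem (sum_mem fun a _ => ?_) (sum_mem fun j _ => ?_)
    · rw [weightedHomogeneousComponent_C_mul]
      refine C_mul_mem_tangentSpan τ _ ?_
      by_cases ha : e = d a
      · rw [ha, (hψ.1 a).weightedHomogeneousComponent_same]
        exact Submodule.mem_sup_left (Submodule.subset_span ⟨a, rfl⟩)
      · rw [(hψ.1 a).weightedHomogeneousComponent_ne _ ha]
        exact zero_mem _
    · rw [weightedHomogeneousComponent_mul (hf j)]
      set q' := weightedHomogeneousComponent Y.weight (e - (1 - Y.weight j)) (q j) with hq'
      have hq : IsWeightedHomogeneous Y.weight q' (e - (1 - Y.weight j)) :=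
        weightedHomogeneousComponent_isWeightedHomogeneous _ _
      have : q' * pderiv j Y.poly = q' * grad (deform Y ψ τ) j -
          ∑ b, C (τ b) * (q' * pderiv j (ψ b)) := by
        rw [grad_deform, mul_add, Finset.mul_sum]
        simp only [mul_left_comm q']
        ring
      rw [this]
      refine sub_mem (mem_tangentSpan_of_mem τ (Ideal.mul_mem_left _ _
        (grad_mem_jacIdeal _ j))) (sum_mem fun b _ => C_mul_mem_tangentSpan τ _ ?_)
      refine ih (e - (1 - Y.weight j) + (d b - Y.weight j)) ?_ _
        (hq.mul ((hψ.1 b).pderiv (by ring)))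
      linarith [hε b]

theorem IsHomogeneousBasis.tangentSpan_eq_top (hψ : IsHomogeneousBasis Y ψ d)
    (τ : Fin Y.rank → ℂ) (p : Poly3) : p ∈ tangentSpan Y ψ τ := by
  obtain ⟨ε, h0, hε⟩ := hψ.exists_gap
  rw [p.as_sum]
  refine sum_mem fun m _ => ?_
  obtain ⟨n, hn⟩ := exists_nat_gt (Finsupp.weight Y.weight m / ε)
  exact hψ.mem_tangentSpan_of_homogeneous τ hε n _ ((div_lt_iff₀ h0).1 hn) _
    (isWeightedHomogeneous_monomial _ _ _ rfl)

theorem IsHomogeneousBasis.exists_rep (hψ : IsHomogeneousBasis Y ψ d) (τ : Fin Y.rank → ℂ)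
    (p : Poly3) : ∃ v : Fin Y.rank → ℂ, p - ∑ a, C (v a) * ψ a ∈ jacIdeal (deform Y ψ τ) := by
  obtain ⟨y, hy, z, hz, hp⟩ := Submodule.mem_sup.1 (hψ.tangentSpan_eq_top τ p)
  obtain ⟨v, hv⟩ := (Submodule.mem_span_range_iff_exists_fun ℂ).1 hy
  refine ⟨v, ?_⟩
  simp only [smul_eq_C_mul] at hv
  rw [← hp, hv, add_sub_cancel_left]
  exact hz

theorem IsHomogeneousBasis.surjective_tangentMap (hψ : IsHomogeneousBasis Y ψ d)
    (τ : Fin Y.rank → ℂ) : Function.Surjective (tangentMap Y ψ τ) := by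
  intro y
  obtain ⟨p, rfl⟩ := Ideal.Quotient.mk_surjective y
  obtain ⟨v, hv⟩ := hψ.exists_rep τ p
  exact ⟨v, (Ideal.Quotient.mk_eq_mk_iff_sub_mem _ _).2 hv |>.symm⟩

theorem critDiff_mulVec (x : Fin Y.rank → Fin 3 → ℂ) (v : Fin Y.rank → ℂ) (i : Fin Y.rank) :
    (critDiff Y ψ x).mulVec v i = eval (x i) (∑ a, C (v a) * ψ a) := by
  simp [critDiff, Matrix.mulVec, dotProduct, mul_comm]

theorem IsCritEnum.eval_grad {τ : Fin Y.rank → ℂ} {x : Fin Y.rank → Fin 3 → ℂ}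
    (hx : IsCritEnum Y ψ τ x) (i : Fin Y.rank) (j : Fin 3) :
    eval (x i) (grad (deform Y ψ τ) j) = 0 :=
  (hx.2.1 (x i)).2 ⟨i, rfl⟩ j

theorem IsCritEnum.eval_eq_zero {τ : Fin Y.rank → ℂ} {x : Fin Y.rank → Fin 3 → ℂ}
    (hx : IsCritEnum Y ψ τ x) {φ : Poly3} (hφ : φ ∈ jacIdeal (deform Y ψ τ)) (i : Fin Y.rank) :
    eval (x i) φ = 0 := by
  have : jacIdeal (deform Y ψ τ) ≤ RingHom.ker (eval (x i)) := by
    rw [jacIdeal, Ideal.span_le]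
    rintro _ ⟨j, rfl⟩
    exact hx.eval_grad i j
  exact this hφ

theorem IsCritEnum.eval_eq_mulVec {τ : Fin Y.rank → ℂ} {x : Fin Y.rank → Fin 3 → ℂ}
    (hx : IsCritEnum Y ψ τ x) {φ : Poly3} {v : Fin Y.rank → ℂ}
    (hv : φ - ∑ a, C (v a) * ψ a ∈ jacIdeal (deform Y ψ τ)) (i : Fin Y.rank) :
    eval (x i) φ = (critDiff Y ψ x).mulVec v i := by
  rw [critDiff_mulVec, ← sub_eq_zero, ← map_sub]
  exact hx.eval_eq_zero hv i

/-- Arbitrary values at the critical points are interpolated by a polynomial, which reduces to a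
combination of the `ψ_a` with the same values. The square matrix is therefore surjective. -/
theorem IsHomogeneousBasis.isUnit_critDiff (hψ : IsHomogeneousBasis Y ψ d)
    {τ : Fin Y.rank → ℂ} {x : Fin Y.rank → Fin 3 → ℂ} (hx : IsCritEnum Y ψ τ x) :
    IsUnit (critDiff Y ψ x).det := by
  rw [← Matrix.isUnit_iff_isUnit_det, ← Matrix.mulVec_surjective_iff_isUnit]
  intro y
  obtain ⟨L, hL⟩ := exists_interpolation hx.1
  obtain ⟨v, hv⟩ := hψ.exists_rep τ (∑ i, C (y i) * L i)
  refine ⟨v, funext fun i => ?_⟩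
  rw [← hx.eval_eq_mulVec hv]
  simp [hL]

/-- Reduced to a combination of the `ψ_a`, such a polynomial has coefficient vector in the kernel of
the invertible matrix `critDiff`. Hence the jacobian ideal consists of all functions vanishing on
the critical set, as the residue formula requires. -/
theorem IsHomogeneousBasis.mem_jacIdeal_of_eval (hψ : IsHomogeneousBasis Y ψ d)
    {τ : Fin Y.rank → ℂ} {x : Fin Y.rank → Fin 3 → ℂ} (hx : IsCritEnum Y ψ τ x) {φ : Poly3}
    (hφ : ∀ i, eval (x i) φ = 0) : φ ∈ jacIdeal (deform Y ψ τ) := by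
  obtain ⟨v, hv⟩ := hψ.exists_rep τ φ
  have h0 : (critDiff Y ψ x).mulVec v = (critDiff Y ψ x).mulVec 0 := by
    rw [Matrix.mulVec_zero]
    funext i
    rw [← hx.eval_eq_mulVec hv, hφ i, Pi.zero_apply]
  have hv0 : v = 0 := Matrix.mulVec_injective_of_isUnit
    ((Matrix.isUnit_iff_isUnit_det _).2 (hψ.isUnit_critDiff hx)) h0
  simpa [hv0] using hv

theorem IsHomogeneousBasis.residue_eq (hψ : IsHomogeneousBasis Y ψ d)
    {τ : Fin Y.rank → ℂ} {x : Fin Y.rank → Fin 3 → ℂ} (hx : IsCritEnum Y ψ τ x) (φ : Poly3) :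
    residue (grad (deform Y ψ τ)) φ =
      ∑ i, (hessDet (deform Y ψ τ) (x i))⁻¹ * eval (x i) φ :=
  residue_apply_of_simple_zeros hx.1 hx.eval_grad (fun _ => hψ.mem_jacIdeal_of_eval hx)
    (fun i => by rw [hessDet, ← Matrix.det_transpose]; rfl) hx.2.2 φ

theorem IsHomogeneousBasis.residueMetric_eq (hψ : IsHomogeneousBasis Y ψ d)
    {τ : Fin Y.rank → ℂ} {x : Fin Y.rank → Fin 3 → ℂ} (hx : IsCritEnum Y ψ τ x) :
    residueMetric Y ψ τ = (critDiff Y ψ x).transpose *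
      Matrix.diagonal (fun i => (hessDet (deform Y ψ τ) (x i))⁻¹) * critDiff Y ψ x := by
  ext a b
  rw [residueMetric, Matrix.of_apply, hψ.residue_eq hx, Matrix.mul_apply]
  refine Finset.sum_congr rfl fun i _ => ?_
  rw [Matrix.mul_diagonal, Matrix.transpose_apply, critDiff, Matrix.of_apply, Matrix.of_apply,
    map_mul]
  ring

theorem euler_apply (d : Fin Y.rank → ℚ) (τ : Fin Y.rank → ℂ) (a : Fin Y.rank) :
    euler Y d τ a = ((1 - d a : ℚ) : ℂ) * τ a := by
  rw [euler, exponent, add_sub_cancel_left, mul_div_cancel_left₀ _ Y.coxeter_ne_zero]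

/-- Euler's identity gives `∑ w_j x_j ∂_j f_τ = f + ∑ d_a τ^a ψ_a`. The left side vanishes at a
critical point, where therefore `f_τ = ∑ (1 - d_a) τ^a ψ_a`; that is, `E u^i = u^i`. -/
theorem IsHomogeneousBasis.critDiff_euler (hψ : IsHomogeneousBasis Y ψ d)
    {τ : Fin Y.rank → ℂ} {x : Fin Y.rank → Fin 3 → ℂ} (hx : IsCritEnum Y ψ τ x)
    (i : Fin Y.rank) :
    (critDiff Y ψ x).mulVec (euler Y d τ) i = eval (x i) (deform Y ψ τ) := by
  have h1 : ∑ j, C ((Y.weight j : ℚ) : ℂ) * (X j * grad (deform Y ψ τ) j) =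
      Y.poly + ∑ a, C (τ a) * (C (d a : ℂ) * ψ a) := by
    have hsplit : ∀ j, C ((Y.weight j : ℚ) : ℂ) * (X j * grad (deform Y ψ τ) j) =
        C ((Y.weight j : ℚ) : ℂ) * (X j * pderiv j Y.poly) +
          ∑ a, C (τ a) * (C ((Y.weight j : ℚ) : ℂ) * (X j * pderiv j (ψ a))) := by
      intro j
      rw [grad_deform, mul_add, mul_add, Finset.mul_sum, Finset.mul_sum]
      refine congrArg _ (Finset.sum_congr rfl fun a _ => ?_)
      ring
    rw [Finset.sum_congr rfl fun j _ => hsplit j, Finset.sum_add_distrib,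
      sum_weight_mul_X_mul_pderiv Y.isWeightedHomogeneous_poly, Finset.sum_comm, Rat.cast_one,
      map_one, one_mul]
    refine congrArg _ (Finset.sum_congr rfl fun a _ => ?_)
    rw [← Finset.mul_sum, sum_weight_mul_X_mul_pderiv (hψ.1 a)]
  have h2 := congrArg (eval (x i)) h1
  simp only [map_sum, map_mul, map_add, hx.eval_grad i, mul_zero, Finset.sum_const_zero,
    eval_C] at h2
  rw [critDiff_mulVec, deform]
  simp only [euler_apply, map_sum, map_mul, map_add, eval_C, Rat.cast_sub, Rat.cast_one, sub_mul,
    one_mul, Finset.sum_sub_distrib]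
  have h3 : ∀ a, (d a : ℂ) * τ a * eval (x i) (ψ a) = τ a * ((d a : ℂ) * eval (x i) (ψ a)) :=
    fun a => by ring
  simp only [h3]
  linear_combination h2

/-- Evaluation at a critical point is a ring homomorphism on the quotient, so it turns
multiplication by `E` into multiplication by `u^i`. Surjectivity of `tangentMap` makes the
`Function.invFun` in `eulerMul` a genuine right inverse. -/
theorem IsHomogeneousBasis.critDiff_mul_eulerMul (hψ : IsHomogeneousBasis Y ψ d)
    {τ : Fin Y.rank → ℂ} {x : Fin Y.rank → Fin 3 → ℂ} (hx : IsCritEnum Y ψ τ x) :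
    critDiff Y ψ x * eulerMul Y ψ d τ = critU Y ψ τ x * critDiff Y ψ x := by
  ext i b
  let ev : Poly3 ⧸ jacIdeal (deform Y ψ τ) →+* ℂ :=
    Ideal.Quotient.lift _ (eval (x i)) fun φ hφ => hx.eval_eq_zero hφ i
  have hev : ∀ v, ev (tangentMap Y ψ τ v) = (critDiff Y ψ x).mulVec v i := fun v => by
    rw [critDiff_mulVec]; exact Ideal.Quotient.lift_mk _ _ _
  have h1 := congrArg ev (Function.invFun_eq (hψ.surjective_tangentMap τ
    (tangentMap Y ψ τ (euler Y d τ) * tangentMap Y ψ τ (Pi.single b 1))))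
  rw [map_mul, hev, hev, hev, hψ.critDiff_euler hx, Matrix.mulVec_single_one] at h1
  rw [critU, Matrix.diagonal_mul]
  exact h1

/-- The Gram determinant at `τ` is nonzero by the residue formula, and it contains the determinant
of the Jacobian matrix as a factor. -/
theorem IsFlatCoords.isUnit_jacobian (hψ : IsHomogeneousBasis Y ψ d)
    {t : (Fin Y.rank → ℂ) → (Fin Y.rank → ℂ)} (ht : IsFlatCoords Y ψ d t)
    {τ : Fin Y.rank → ℂ} {x : Fin Y.rank → Fin 3 → ℂ} (hx : IsCritEnum Y ψ τ x) :
    IsUnit (jacobian Y t τ).det := by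
  have h := congrArg Matrix.det ((ht.2.2.2 τ).symm.trans (hψ.residueMetric_eq hx))
  simp only [Matrix.det_mul, Matrix.det_transpose, Matrix.det_diagonal] at h
  refine isUnit_iff_ne_zero.2 fun h0 => ?_
  have hD := (hψ.isUnit_critDiff hx).ne_zero
  rw [h0, mul_zero] at h
  refine mul_ne_zero (mul_ne_zero hD (Finset.prod_ne_zero_iff.2 fun i _ => ?_)) hD h.symm
  exact inv_ne_zero (hx.2.2 i)

/-- The vectors `∂/∂u^i` are orthogonal of square length `1/Δ_i`, so the factors `√Δ_i` normalize
them; the flat coordinates carry the metric at `τ` to that of `H`. -/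
theorem psiMat_orthonormal (hψ : IsHomogeneousBasis Y ψ d)
    {t : (Fin Y.rank → ℂ) → (Fin Y.rank → ℂ)} (ht : IsFlatCoords Y ψ d t)
    {τ : Fin Y.rank → ℂ} {x : Fin Y.rank → Fin 3 → ℂ} (hx : IsCritEnum Y ψ τ x)
    {r : Fin Y.rank → ℂ} (hr : ∀ i, r i ^ 2 = hessDet (deform Y ψ τ) (x i)) :
    (psiMat Y ψ t τ x r).transpose * residueMetric Y ψ 0 * psiMat Y ψ t τ x r = 1 := by
  have hD := Matrix.mul_nonsing_inv _ (hψ.isUnit_critDiff hx)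
  set D := critDiff Y ψ x with hDdef
  have hD' : D⁻¹.transpose * D.transpose = 1 := by
    rw [← Matrix.transpose_mul, hD, Matrix.transpose_one]
  have h := (ht.2.2.2 τ).symm.trans (hψ.residueMetric_eq hx)
  rw [← hDdef] at h
  rw [psiMat, ← hDdef, Matrix.transpose_mul, Matrix.transpose_mul, Matrix.diagonal_transpose]
  calc Matrix.diagonal r * (D⁻¹.transpose * (jacobian Y t τ).transpose) * residueMetric Y ψ 0 *
        (jacobian Y t τ * D⁻¹ * Matrix.diagonal r)
      = Matrix.diagonal r * D⁻¹.transpose * ((jacobian Y t τ).transpose * residueMetric Y ψ 0 *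
          jacobian Y t τ) * D⁻¹ * Matrix.diagonal r := by simp only [Matrix.mul_assoc]
    _ = Matrix.diagonal r * (D⁻¹.transpose * D.transpose) *
          Matrix.diagonal (fun i => (hessDet (deform Y ψ τ) (x i))⁻¹) * (D * D⁻¹) *
            Matrix.diagonal r := by rw [h]; simp only [Matrix.mul_assoc]
    _ = 1 := by
      rw [hD, hD', mul_one, mul_one, Matrix.diagonal_mul_diagonal, Matrix.diagonal_mul_diagonal,
        ← Matrix.diagonal_one]
      congr 1
      funext i
      have := hx.2.2 i
      rw [← hr i] at this ⊢
      have hri : r i ≠ 0 := fun h0 => this (by rw [h0]; ring)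
      field_simp

theorem eulerMulH_mul_psiMat (hψ : IsHomogeneousBasis Y ψ d)
    {t : (Fin Y.rank → ℂ) → (Fin Y.rank → ℂ)} (ht : IsFlatCoords Y ψ d t)
    {τ : Fin Y.rank → ℂ} {x : Fin Y.rank → Fin 3 → ℂ} (hx : IsCritEnum Y ψ τ x)
    (r : Fin Y.rank → ℂ) :
    eulerMulH Y ψ d t τ * psiMat Y ψ t τ x r = psiMat Y ψ t τ x r * critU Y ψ τ x := by
  have hD := Matrix.mul_nonsing_inv _ (hψ.isUnit_critDiff hx)
  have hD' := Matrix.nonsing_inv_mul _ (hψ.isUnit_critDiff hx)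
  have hJ := Matrix.nonsing_inv_mul _ (ht.isUnit_jacobian hψ hx)
  have hE := hψ.critDiff_mul_eulerMul hx
  rw [eulerMulH, psiMat]
  set D := critDiff Y ψ x
  set J := jacobian Y t τ
  set A := eulerMul Y ψ d τ
  have h1 : A * D⁻¹ = D⁻¹ * critU Y ψ τ x := by
    calc A * D⁻¹ = D⁻¹ * D * A * D⁻¹ := by rw [hD', one_mul]
      _ = D⁻¹ * (D * A) * D⁻¹ := by simp only [Matrix.mul_assoc]
      _ = D⁻¹ * critU Y ψ τ x * (D * D⁻¹) := by rw [hE]; simp only [Matrix.mul_assoc]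
      _ = _ := by rw [hD, mul_one]
  calc J * A * J⁻¹ * (J * D⁻¹ * Matrix.diagonal r)
      = J * A * (J⁻¹ * J) * D⁻¹ * Matrix.diagonal r := by simp only [Matrix.mul_assoc]
    _ = J * (A * D⁻¹) * Matrix.diagonal r := by rw [hJ, mul_one]; simp only [Matrix.mul_assoc]
    _ = J * D⁻¹ * (critU Y ψ τ x * Matrix.diagonal r) := by rw [h1]; simp only [Matrix.mul_assoc]
    _ = J * D⁻¹ * (Matrix.diagonal r * critU Y ψ τ x) := by
      congr 1
      rw [critU, Matrix.diagonal_mul_diagonal, Matrix.diagonal_mul_diagonal]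
      simp only [mul_comm]
    _ = _ := by simp only [Matrix.mul_assoc]

/-- A formal asymptotic solution in an orthonormal frame exists only if `μ` is antisymmetric. -/
theorem IsAsymptoticSolution.mu_anti {N : ℕ} {G μ 𝓔 Ψ : Mat N} {u : Fin N → ℂ}
    {R : PowerSeries (Mat N)} (hR : IsAsymptoticSolution μ 𝓔 Ψ (Matrix.diagonal u) R)
    (hΨ : Ψ.transpose * G * Ψ = 1) (h𝓔 : 𝓔 * Ψ = Ψ * Matrix.diagonal u) :
    μ.transpose * G = -(G * μ) := by
  obtain ⟨h1, -, h3⟩ := isUnit_det_of_frame hΨ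
  have hGs := transpose_eq_of_frame hΨ
  have e0 := hR.conj_eq h1 h𝓔 0
  set A := PowerSeries.coeff 1 R with hA
  have hAt : A.transpose = A := by
    have := congrArg (PowerSeries.coeff 1) hR.2.2
    rw [coeff_one_mul', PowerSeries.coeff_mk, PowerSeries.coeff_mk, hR.1, adj, adj, ← hA,
      PowerSeries.coeff_one] at this
    simp only [inv_one, Matrix.transpose_one, mul_one, one_mul, pow_zero, pow_one, one_smul,
      neg_smul, one_ne_zero, if_false] at this
    exact (add_neg_eq_zero.1 this).symm
  rw [hR.1, Nat.cast_zero, zero_smul, mul_one, zero_sub] at e0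
  -- In the frame, `G μ` becomes `[U, R₁]`, a commutator of symmetric matrices and therefore
  -- antisymmetric. The remaining steps transport this back through `Ψ`.
  have hV : Ψ.transpose * G * μ * Ψ = Matrix.diagonal u * A - A * Matrix.diagonal u := by
    rw [← h3, ← sub_eq_zero, ← neg_eq_zero, ← e0]
    abel
  have hVt := congrArg Matrix.transpose hV
  simp only [Matrix.transpose_mul, Matrix.transpose_sub, Matrix.transpose_transpose, hGs, hAt,
    Matrix.diagonal_transpose] at hVt
  have hs : Ψ.transpose * (μ.transpose * G + G * μ) * Ψ = 0 := by
    calc _ = Ψ.transpose * (μ.transpose * (G * Ψ)) + Ψ.transpose * G * μ * Ψ := by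
          simp only [Matrix.mul_add, Matrix.add_mul, Matrix.mul_assoc]
      _ = 0 := by rw [hVt, hV]; abel
  have hi : Ψ * Ψ⁻¹ = 1 := Matrix.mul_nonsing_inv _ h1
  have hi' : Ψ⁻¹.transpose * Ψ.transpose = 1 := by
    rw [← Matrix.transpose_mul, hi, Matrix.transpose_one]
  refine eq_neg_of_add_eq_zero_left ?_
  calc μ.transpose * G + G * μ = Ψ⁻¹.transpose * Ψ.transpose * (μ.transpose * G + G * μ) *
        (Ψ * Ψ⁻¹) := by rw [hi, hi', one_mul, mul_one]
    _ = Ψ⁻¹.transpose * (Ψ.transpose * (μ.transpose * G + G * μ) * Ψ) * Ψ⁻¹ := by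
        simp only [Matrix.mul_assoc]
    _ = 0 := by rw [hs, mul_zero, zero_mul]

theorem isFrame_of_semisimple (hψ : IsHomogeneousBasis Y ψ d)
    {t : (Fin Y.rank → ℂ) → (Fin Y.rank → ℂ)} (ht : IsFlatCoords Y ψ d t)
    {τ : Fin Y.rank → ℂ} {x : Fin Y.rank → Fin 3 → ℂ} (hx : IsCritEnum Y ψ τ x)
    {r : Fin Y.rank → ℂ} (hr : ∀ i, r i ^ 2 = hessDet (deform Y ψ τ) (x i))
    {S : PowerSeries (Mat Y.rank)}
    (hS : IsCalibration (residueMetric Y ψ 0) (mu Y d) (eulerMulH Y ψ d t τ) S)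
    {R : PowerSeries (Mat Y.rank)}
    (hR : IsAsymptoticSolution (mu Y d) (eulerMulH Y ψ d t τ) (psiMat Y ψ t τ x r)
      (critU Y ψ τ x) R) :
    IsFrame (residueMetric Y ψ 0) (mu Y d) (eulerMulH Y ψ d t τ) (psiMat Y ψ t τ x r)
      (fun i => eval (x i) (deform Y ψ τ)) S R where
  orthonormal := psiMat_orthonormal hψ ht hx hr
  mu_anti := hR.mu_anti (psiMat_orthonormal hψ ht hx hr) (eulerMulH_mul_psiMat hψ ht hx r)
  euler_eigen := eulerMulH_mul_psiMat hψ ht hx r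
  calibration := hS
  asymptotic := hR

end Deformation

end ADEVirasoro

end

/-! ### The Proposition -/

open ADEVirasoro

theorem proposition7 (X : SimpleSing)
    (ψ : Fin X.rank → Poly3) (d : Fin X.rank → ℚ) (hψ : IsHomogeneousBasis X ψ d)
    (t : (Fin X.rank → ℂ) → (Fin X.rank → ℂ)) (ht : IsFlatCoords X ψ d t)
    (τ : Fin X.rank → ℂ) (x : Fin X.rank → (Fin 3 → ℂ)) (hx : IsCritEnum X ψ τ x)
    (r : Fin X.rank → ℂ) (hr : ∀ i, r i ^ 2 = hessDet (deform X ψ τ) (x i))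
    (S : PowerSeries (Mat X.rank))
    (hS : IsCalibration (residueMetric X ψ 0) (mu X d) (eulerMulH X ψ d t τ) S)
    (R : PowerSeries (Mat X.rank))
    (hR : IsAsymptoticSolution (mu X d) (eulerMulH X ψ d t τ) (psiMat X ψ t τ x r)
      (critU X ψ τ x) R)
    (c : ℂ) :
    let G : Mat X.rank := residueMetric X ψ 0
    let μ : Mat X.rank := mu X d
    let Ψ : Mat X.rank := psiMat X ψ t τ x r
    let U : Mat X.rank := critU X ψ τ x
    let central : ℂ := (μ * adj G μ).trace / 4
    -- `M̂` is a bijection between its domain and its range, with inverse `M̂⁻¹`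
    (Set.BijOn (quantM G Ψ U S R c) (domM U) (ranM G S) ∧
      Set.InvOn (quantMInv G Ψ U S R c) (quantM G Ψ U S R c) (domM U) (ranM G S)) ∧
    Set.MapsTo (quantize G (virasoro μ)) (ranM G S) (ranM G S) ∧
    -- the conjugation formula
    (∀ F ∈ domM U,
      quantMInv G Ψ U S R c (quantize G (virasoro μ) (quantM G Ψ U S R c F)) =
        quantize 1 (conjM Ψ U S R (virasoro μ)) F
          + MvPowerSeries.C (HahnSeries.C central) * F) ∧
    -- the origin of the central term
    (∀ F ∈ polys X.rank,
      expOp (quantize 1 (-opPos (logSeries R)))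
        (quantize 1 (opNeg (linSeries U)) (expOp (quantize 1 (opPos (logSeries R))) F)) =
        quantize 1 (Op.comp (Op.comp (opPos (Ring.inverse R)) (opNeg (linSeries U))) (opPos R)) F
          + MvPowerSeries.C
              (HahnSeries.C (cocycle 1 (opNeg (linSeries U)) (opPos (logSeries R)))) * F) ∧
    cocycle 1 (opNeg (linSeries U)) (opPos (logSeries R)) =
      ∑ i, PowerSeries.coeff 1 R i i * MvPolynomial.eval (x i) (deform X ψ τ) / 2 ∧
    ∑ i, PowerSeries.coeff 1 R i i * MvPolynomial.eval (x i) (deform X ψ τ) / 2 = central := by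
  intro G μ Ψ U central
  have h : IsFrame G μ (eulerMulH X ψ d t τ) Ψ
      (fun i => MvPolynomial.eval (x i) (deform X ψ τ)) S R :=
    isFrame_of_semisimple hψ ht hx hr hS hR
  refine ⟨⟨(h.invOn_quantM c).bijOn (IsFrame.mapsTo_quantM c) (IsFrame.mapsTo_quantMInv c),
    h.invOn_quantM c⟩, h.mapsTo_virasoro, fun F hF => ?_, fun F hF => h.conj_U_R hF,
    IsFrame.cocycle_pole _ R, h.trace_eq⟩
  have := h.conj_quantM c hF
  rwa [h.poleCocycle_eq] at this
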